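/- **Theorem (existence and uniqueness).** Consider on $\mathbb R^3$ the Boussinesq system $$\partial_t u+u\cdot\nabla u+\nabla P=\Delta u+\theta e_3,\qquad \operatorname{div}u=0,\qquad \partial_t\theta+u\cdot\nabla\theta=\Delta\theta,\qquad u(0)=u_0,\ \theta(0)=\theta_0,$$ where $e_3=(0,0,1)^T$. Let $\mathbb P=\mathrm{Id}+\nabla(-\Delta)^{-1}\operatorname{div}$ be the Leray projector, and for (Lebesgue) measurable $u:(0,\infty)\times\mathbb R^3\to\mathbb R^3$ and $\theta:(0,\infty)\times\mathbb R^3\to\mathbb R$ put $$\|u\|_{\mathcal X}=\sup_{t>0,\,x\in\mathbb R^3}(\sqrt t+|x|)\,|u(t,x)|,\qquad \|\theta\|_{\mathcal Y}=\sup_{t>0,\,x\in\mathbb R^3}(\sqrt t+|x|)^3\,|\theta(t,x)|;$$ $\mathcal X$ and $\mathcal Y$ are the spaces of such functions with finite norm. A pair $(u,\theta)\in\mathcal X\times\mathcal Y$ is a *mild solution* with data $(u_0,\theta_0)$ if, for all $t>0$ and $x\in\mathbb R^3$, $$u(t)=e^{t\Delta}u_0+t e^{t\Delta}\mathbb P(\theta_0e_3)-\int_0^t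 e^{(t-s)\Delta}\mathbb P\nabla\cdot(u\otimes u)(s)\,ds-\int_0^t(t-s)e^{(t-s)\Delta}\mathbb P\big(\nabla\cdot(\theta u)(s)\,e_3\big)\,ds,$$ $$\theta(t)=e^{t\Delta}\theta_0-\int_0^t e^{(t-s)\Delta}\nabla\cdot(\theta u)(s)\,ds,$$ where $e^{t\Delta}\nabla\cdot$ and $e^{t\Delta}\mathbb P\nabla\cdot$ denote convolution with the corresponding first derivatives of the kernels of $e^{t\Delta}$ and $e^{t\Delta}\mathbb P$. There are absolute constants $\epsilon_0>0$ and $C>0$ such that the following holds for every $0<\epsilon\le\epsilon_0$. Let $u_0:\mathbb R^3\to\mathbb R^3$ be a measurable vector field which is divergence-free in the sense of distributions, let $\theta_0$ be a real tempered distribution on $\mathbb R^3$, and suppose that $$\sup_{x\in\mathbb R^3}|x||u_0(x)|<\epsilon,\qquad \|te^{t\Delta}\mathbb P(\theta_0e_3)\|_{\mathcal X}<\epsilon,\qquad \|e^{t\Delta}\theta_0\|_{\mathcal Y}<\epsilon.$$ (Here $e^{t\Delta}\mathbb P(\theta_0e_3)$ is understood as $e^{\frac t2\Delta}\mathbb P\big((e^{\frac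 t2\Delta}\theta_0)e_3\big)$.) Then there is a mild solution $(u,\theta)\in\mathcal X\times\mathcal Y$ with data $(u_0,\theta_0)$ such that $$\|u\|_{\mathcal X}\le C\epsilon,\qquad \|\theta\|_{\mathcal Y}\le C\epsilon,$$ and $u(t)$ is divergence-free in the sense of distributions for every $t>0$. It is unique: every mild solution $(v,\eta)\in\mathcal X\times\mathcal Y$ with the same data and $\|v\|_{\mathcal X}\le C\epsilon$, $\|\eta\|_{\mathcal Y}\le C\epsilon$ satisfies $v(t,x)=u(t,x)$ and $\eta(t,x)=\theta(t,x)$ for all $t>0$, $x\in\mathbb R^3$. -/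

import Mathlib

open MeasureTheory Set
open scoped ENNReal SchwartzMap ContDiff

noncomputable section

namespace Boussinesq

/-- Euclidean space `ℝ³`. -/
abbrev E3 := EuclideanSpace ℝ (Fin 3)

/-- Real tempered distributions on `ℝ³`: continuous linear functionals on the real-valued
Schwartz functions. -/
abbrev RealTempered := 𝓢(E3, ℝ) →L[ℝ] ℝ

/-- The partial derivative `∂_k f` of a scalar function on `ℝ³`. -/
def pd (k : Fin 3) (f : E3 → ℝ) (x : E3) : ℝ :=
  fderiv ℝ f x (EuclideanSpace.single k 1)

/-! ### Kernels -/

/-- The heat kernel `(4πt)^(-3/2) exp(-|x|²/(4t))`, i.e. the kernel of `e^{tΔ}`, for `t > 0`. -/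
def heatKernel (t : ℝ) (x : E3) : ℝ :=
  (4 * Real.pi * t) ^ (-(3 / 2) : ℝ) * Real.exp (-(1 / (4 * t)) * ‖x‖ ^ 2)

/-- The kernel `∫_t^∞ e^{sΔ} ds` of `(-Δ)⁻¹ e^{tΔ}`, for `t > 0`. -/
def invLaplaceHeatKernel (t : ℝ) (x : E3) : ℝ :=
  ∫ s in Ioi t, heatKernel s x

/-- The Oseen kernel: the `(j, l)` entry of the matrix kernel of `e^{tΔ} ℙ`, where
`ℙ = Id + ∇ (-Δ)⁻¹ div` is the Leray projector (the Fourier multiplier `δ_{jl} - ξ_j ξ_l / |ξ|²`). -/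
def oseenKernel (j l : Fin 3) (t : ℝ) (x : E3) : ℝ :=
  (if j = l then heatKernel t x else 0) + pd j (pd l (invLaplaceHeatKernel t)) x

/-! ### The heat kernel as a Schwartz function -/

theorem gaussian_poly_bound {a : ℝ} (ha : 0 < a) (m : ℕ) :
    ∃ C : ℝ, ∀ r : ℝ, 0 ≤ r → (1 + r) ^ m * Real.exp (-a * r ^ 2) ≤ C := by
  refine ⟨(m.factorial : ℝ) * Real.exp (1 + 1 / (4 * a)), fun r hr => ?_⟩
  have h1 : (1 + r) ^ m ≤ (m.factorial : ℝ) * Real.exp (1 + r) := by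
    have h := Real.pow_div_factorial_le_exp (1 + r) (by positivity) m
    rw [div_le_iff₀ (by positivity)] at h
    linarith
  calc (1 + r) ^ m * Real.exp (-a * r ^ 2)
      ≤ ((m.factorial : ℝ) * Real.exp (1 + r)) * Real.exp (-a * r ^ 2) := by gcongr
    _ = (m.factorial : ℝ) * Real.exp (1 + r + -a * r ^ 2) := by rw [mul_assoc, ← Real.exp_add]
    _ ≤ _ := by
        have h2 : r - a * r ^ 2 ≤ 1 / (4 * a) := by
          rw [le_div_iff₀ (by positivity)]
          nlinarith [sq_nonneg (2 * a * r - 1)]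
        refine mul_le_mul_of_nonneg_left (Real.exp_le_exp.2 ?_) (by positivity)
        linarith

theorem gaussian_decay {a : ℝ} (ha : 0 < a) (p n : ℕ) :
    ∃ C : ℝ, ∀ x : E3,
      ‖x‖ ^ p * ‖iteratedFDeriv ℝ n (fun y : E3 => Real.exp (-a * ‖y‖ ^ 2)) x‖ ≤ C := by
  have hf : Function.HasTemperateGrowth (fun y : E3 => -a * ‖y‖ ^ 2) :=
    (Function.HasTemperateGrowth.const (-a)).mul (Function.hasTemperateGrowth_norm_sq E3)
  obtain ⟨k, K, hK0, hK⟩ := hf.norm_iteratedFDeriv_le_uniform n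
  obtain ⟨C, hC⟩ := gaussian_poly_bound ha (p + k * n)
  refine ⟨n.factorial * (1 + K) ^ n * C, fun x => ?_⟩
  have hone : (1 : ℝ) ≤ 1 + ‖x‖ := by linarith [norm_nonneg x]
  have hbase : (1 : ℝ) ≤ (1 + K) * (1 + ‖x‖) ^ k := by
    have := one_le_pow₀ hone (n := k)
    nlinarith
  have hcomp := norm_iteratedFDeriv_comp_le (𝕜 := ℝ) (g := Real.exp)
    (f := fun y : E3 => -a * ‖y‖ ^ 2) (n := n) (N := (n : ℕ∞)) Real.contDiff_exp
    (hf.1.of_le (by exact_mod_cast le_top)) le_rfl x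
    (C := Real.exp (-a * ‖x‖ ^ 2)) (D := (1 + K) * (1 + ‖x‖) ^ k)
    (fun i _ => by
      rw [norm_iteratedFDeriv_eq_norm_iteratedDeriv, iteratedDeriv_eq_iterate, Real.iter_deriv_exp,
        Real.norm_of_nonneg (Real.exp_nonneg _)])
    (fun i hi hin => by
      calc ‖iteratedFDeriv ℝ i (fun y : E3 => -a * ‖y‖ ^ 2) x‖
          ≤ K * (1 + ‖x‖) ^ k := hK i hin x
        _ ≤ (1 + K) * (1 + ‖x‖) ^ k := by gcongr; linarith
        _ ≤ _ := le_self_pow₀ hbase (by omega))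
  have hxp : ‖x‖ ^ p ≤ (1 + ‖x‖) ^ p := by gcongr; linarith
  calc ‖x‖ ^ p * ‖iteratedFDeriv ℝ n (fun y : E3 => Real.exp (-a * ‖y‖ ^ 2)) x‖
      ≤ (1 + ‖x‖) ^ p * (n.factorial * Real.exp (-a * ‖x‖ ^ 2) * ((1 + K) * (1 + ‖x‖) ^ k) ^ n) := by
        gcongr
        exact hcomp
    _ = n.factorial * (1 + K) ^ n * ((1 + ‖x‖) ^ (p + k * n) * Real.exp (-a * ‖x‖ ^ 2)) := by
        rw [mul_pow, ← pow_mul, pow_add]; ring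
    _ ≤ _ := by gcongr; exact hC _ (norm_nonneg x)

/-- The Gaussian `exp(-a|x|²)`, `a > 0`, as a Schwartz function. -/
def gaussianSchwartz (a : ℝ) (ha : 0 < a) : 𝓢(E3, ℝ) where
  toFun := fun y => Real.exp (-a * ‖y‖ ^ 2)
  smooth' := Real.contDiff_exp.comp (contDiff_const.mul (contDiff_norm_sq ℝ))
  decay' := gaussian_decay ha

/-- The heat kernel at time `t > 0` as a Schwartz function (`0` by convention for `t ≤ 0`). -/
def heatSchwartz (t : ℝ) : 𝓢(E3, ℝ) :=
  if ht : 0 < t then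
    (4 * Real.pi * t) ^ (-(3 / 2) : ℝ) • gaussianSchwartz (1 / (4 * t)) (by positivity)
  else 0

theorem heatSchwartz_apply {t : ℝ} (ht : 0 < t) (x : E3) : heatSchwartz t x = heatKernel t x := by
  rw [heatSchwartz, dif_pos ht]
  rfl

/-! ### Free evolutions -/

/-- `e^{tΔ} u₀` for a vector field `u₀`. -/
def heatFlow (u₀ : E3 → E3) (t : ℝ) (x : E3) : E3 :=
  ∫ y, heatKernel t (x - y) • u₀ y

/-- `e^{tΔ} θ₀` for a tempered distribution `θ₀`: the smooth function
`x ↦ ⟨θ₀, heatKernel t (x - ·)⟩` (the heat kernel is even). -/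
def heatFlowDistr (θ₀ : RealTempered) (t : ℝ) (x : E3) : ℝ :=
  θ₀ (SchwartzMap.compSubConstCLM ℝ x (heatSchwartz t))

/-- `e^{tΔ} ℙ(θ₀ e₃)` for a tempered distribution `θ₀`. As the Oseen kernel only decays like
`|x|⁻³` it is not a Schwartz function, so the semigroup property
`e^{tΔ} ℙ (θ₀ e₃) = e^{(t/2)Δ} ℙ ((e^{(t/2)Δ} θ₀) e₃)` is used to apply the kernel to a function.
If `|e^{tΔ} θ₀(x)| ≤ C (√t + |x|)⁻³`, then the integral converges absolutely. -/
def lerayHeatFlowDistr (θ₀ : RealTempered) (t : ℝ) (x : E3) : E3 :=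
  WithLp.toLp 2 fun j =>
    ∫ y, oseenKernel j 2 (t / 2) (x - y) * heatFlowDistr θ₀ (t / 2) y

/-! ### Function spaces -/

/-- `‖u‖_𝓧 = sup_{t > 0, x} (√t + |x|) |u(t,x)|`. -/
def normX (u : ℝ → E3 → E3) : ℝ≥0∞ :=
  ⨆ (t : ℝ) (_ : 0 < t) (x : E3), ENNReal.ofReal (√t + ‖x‖) * ‖u t x‖ₑ

/-- `‖θ‖_𝓨 = sup_{t > 0, x} (√t + |x|)³ |θ(t,x)|`. -/
def normY (θ : ℝ → E3 → ℝ) : ℝ≥0∞ :=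
  ⨆ (t : ℝ) (_ : 0 < t) (x : E3), ENNReal.ofReal ((√t + ‖x‖) ^ 3) * ‖θ t x‖ₑ

/-- `u ∈ 𝓧`: (Lebesgue) measurable on `(0,∞) × ℝ³` with finite norm. -/
def MemX (u : ℝ → E3 → E3) : Prop :=
  AEStronglyMeasurable (Function.uncurry u) (volume.restrict (Ioi (0 : ℝ) ×ˢ univ)) ∧ normX u < ⊤

/-- `θ ∈ 𝓨`: (Lebesgue) measurable on `(0,∞) × ℝ³` with finite norm. -/
def MemY (θ : ℝ → E3 → ℝ) : Prop :=
  AEStronglyMeasurable (Function.uncurry θ) (volume.restrict (Ioi (0 : ℝ) ×ˢ univ)) ∧ normY θ < ⊤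

/-- `div v = 0` in the sense of distributions (for a locally integrable `v`). -/
def IsDivFree (v : E3 → E3) : Prop :=
  ∀ φ : E3 → ℝ, ContDiff ℝ ∞ φ → HasCompactSupport φ → ∫ x, fderiv ℝ φ x (v x) = 0

/-! ### Mild solutions -/

/-- `B(u,u)(t) = -∫₀ᵗ e^{(t-s)Δ} ℙ ∇·(u ⊗ u)(s) ds`, the derivative falling on the kernel. -/
def termB (u : ℝ → E3 → E3) (t : ℝ) (x : E3) : E3 :=
  WithLp.toLp 2 fun j => -∫ s in Ioo 0 t, ∫ y,
    ∑ k, ∑ l, pd k (oseenKernel j l (t - s)) (x - y) * (u s y k * u s y l)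

/-- `E(u,θ)(t) = -∫₀ᵗ (t-s) e^{(t-s)Δ} ℙ (∇·(θ u)(s) e₃) ds`, the derivative falling on the
kernel. -/
def termE (u : ℝ → E3 → E3) (θ : ℝ → E3 → ℝ) (t : ℝ) (x : E3) : E3 :=
  WithLp.toLp 2 fun j => -∫ s in Ioo 0 t, (t - s) * ∫ y,
    ∑ k, pd k (oseenKernel j 2 (t - s)) (x - y) * (θ s y * u s y k)

/-- `B̃(θ,u)(t) = -∫₀ᵗ e^{(t-s)Δ} ∇·(θ u)(s) ds`, the derivative falling on the kernel. -/
def termBt (θ : ℝ → E3 → ℝ) (u : ℝ → E3 → E3) (t : ℝ) (x : E3) : ℝ :=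
  -∫ s in Ioo 0 t, ∫ y, ∑ k, pd k (heatKernel (t - s)) (x - y) * (θ s y * u s y k)

/-- `(u, θ)` is a mild solution of the Boussinesq system with data `(u₀, θ₀)`: for all `t > 0`
and `x`, `u = e^{tΔ} u₀ + t e^{tΔ} ℙ(θ₀ e₃) + B(u,u) + E(u,θ)` and `θ = e^{tΔ} θ₀ + B̃(θ,u)`. -/
def IsMildSolution (u₀ : E3 → E3) (θ₀ : RealTempered) (u : ℝ → E3 → E3) (θ : ℝ → E3 → ℝ) : Prop :=
  ∀ t : ℝ, 0 < t → ∀ x : E3,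
    u t x = heatFlow u₀ t x + t • lerayHeatFlowDistr θ₀ t x + termB u t x + termE u θ t x ∧
    θ t x = heatFlowDistr θ₀ t x + termBt θ u t x

end Boussinesq

end

/-! Every quantity is measured by the parabolic weight $\sqrt t+|x|$, and the theorem is a
contraction argument in a ball of $\mathcal X\times\mathcal Y$.

The kernels of $e^{\tau\Delta}\nabla$ and $e^{\tau\Delta}\mathbb P\nabla$ are bounded by
$c(\sqrt\tau+|z|)^{-4}$ (`heatD1_bound`, `oseenGrad_bound`). For the Oseen kernel this follows by
writing the nonlocal part as $\int_t^\infty\partial_j\partial_l e^{s\Delta}\,ds$: integration in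
time gains two powers of the weight (`sqrt_tail`).

The sources $u\otimes u$ and $\theta u$ decay like the weight to the powers $-2$ and $-4$. Put
$R=\sqrt t+|x|$, $A=\sqrt{t-s}+|x-y|$, $B=\sqrt s+|y|$. Then $R\le A+B$, so the larger of $A,B$ is
at least $R/2$, and for $p\le4$ one gets $A^{-4}B^{-p}\le16R^{-p}(A^{-4}+B^{-4})$
(`inv_pow_mul_inv_pow_le`). Both fourth powers have space-time integral a multiple of $\sqrt t$ over
$(0,t)\times\mathbb R^3$. Hence each Duhamel term is at most a multiple of $\sqrt t\,R^{-p}$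
(`abs_duhamel_le`), with a further factor $t$ for the buoyancy term. Since $\sqrt t\le R$, the
results $\sqrt t R^{-2}$, $t^{3/2}R^{-4}$ and $\sqrt tR^{-4}$ are at most $R^{-1}$, $R^{-1}$ and
$R^{-3}$: the quadratic terms are bounded in $\mathcal X$ and $\mathcal Y$ (`operator_bounds`).

The term $e^{t\Delta}u_0$ is controlled by $|u_0|\le\epsilon/|x|$ (`heatFlow_bound`); the other two
free terms are small by hypothesis. In a ball of radius $M$ with $LM\le1/8$ the mild map is a
self-map and halves distances (`admissible_mild`, `within_mild`). Picard iteration gives existence,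
and the same contraction gives uniqueness.

For the divergence, the columns of the Oseen kernel are solenoidal because
$\sum_j\partial_j\partial_j\partial_l=\partial_s\partial_l$ on the heat kernel
(`sum_oseenGrad_eq_zero`). Fubini carries this to every term containing $\mathbb P$, and
$e^{t\Delta}u_0$ is an average of translates of $u_0$. -/

noncomputable section

namespace Boussinesq

open Filter Topology

/-! ### Linear forms on `ℝ³` -/

/-- The linear form `v ↦ ∑ k, a k * v k`. -/
def linForm (a : Fin 3 → ℝ) : E3 →L[ℝ] ℝ :=
  ∑ k, a k • (EuclideanSpace.proj k : E3 →L[ℝ] ℝ)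

theorem linForm_apply (a : Fin 3 → ℝ) (v : E3) : linForm a v = ∑ k, a k * v k := by
  simp [linForm]

theorem linForm_single (a : Fin 3 → ℝ) (k : Fin 3) :
    linForm a (EuclideanSpace.single k 1) = a k := by
  rw [linForm_apply]
  simp

theorem norm_apply_le (v : E3) (k : Fin 3) : |v k| ≤ ‖v‖ := by
  simpa using PiLp.norm_apply_le v k

theorem norm_le_sum_abs (v : E3) : ‖v‖ ≤ ∑ k, |v k| := by
  have h : v = ∑ k, v k • EuclideanSpace.single k (1 : ℝ) := by
    ext i
    simp [Pi.single_apply]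
  calc ‖v‖ = ‖∑ k, v k • EuclideanSpace.single k (1 : ℝ)‖ := by rw [← h]
    _ ≤ ∑ k, ‖v k • EuclideanSpace.single k (1 : ℝ)‖ := norm_sum_le _ _
    _ = _ := by simp [norm_smul]

theorem norm_linForm_le (a : Fin 3 → ℝ) : ‖linForm a‖ ≤ ∑ k, |a k| := by
  refine ContinuousLinearMap.opNorm_le_bound _ (by positivity) fun v => ?_
  rw [linForm_apply, Finset.sum_mul]
  refine (norm_sum_le _ _).trans (Finset.sum_le_sum fun k _ => ?_)
  rw [norm_mul]
  exact mul_le_mul_of_nonneg_left (norm_apply_le v k) (abs_nonneg _)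

theorem clm_apply_eq_sum (L : E3 →L[ℝ] ℝ) (v : E3) :
    L v = ∑ k, v k * L (EuclideanSpace.single k 1) := by
  have h : v = ∑ k, v k • EuclideanSpace.single k (1 : ℝ) := by
    ext i
    simp [Pi.single_apply]
  conv_lhs => rw [h]
  rw [map_sum]
  simp

theorem fderiv_apply_eq_sum_pd (f : E3 → ℝ) (x v : E3) :
    fderiv ℝ f x v = ∑ k, v k * pd k f x :=
  clm_apply_eq_sum _ v

theorem pd_eq_of_hasFDerivAt {f : E3 → ℝ} {a : Fin 3 → ℝ} {x : E3}
    (h : HasFDerivAt f (linForm a) x) (k : Fin 3) : pd k f x = a k := by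
  rw [pd, h.fderiv, linForm_single]

theorem hasFDerivAt_coord (k : Fin 3) (x : E3) :
    HasFDerivAt (fun y : E3 => y k) (EuclideanSpace.proj k : E3 →L[ℝ] ℝ) x :=
  (EuclideanSpace.proj k : E3 →L[ℝ] ℝ).hasFDerivAt

/-! ### Derivatives of the heat kernel -/

/-- The Kronecker symbol. -/
def kron (j l : Fin 3) : ℝ := if j = l then 1 else 0

/-- `∂_l` of the heat kernel. -/
def heatD1 (l : Fin 3) (s : ℝ) (x : E3) : ℝ := -(x l / (2 * s)) * heatKernel s x

/-- `∂_j ∂_l` of the heat kernel. -/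
def heatD2 (j l : Fin 3) (s : ℝ) (x : E3) : ℝ :=
  (x j * x l / (4 * s ^ 2) - kron j l / (2 * s)) * heatKernel s x

/-- `∂_k ∂_j ∂_l` of the heat kernel. -/
def heatD3 (k j l : Fin 3) (s : ℝ) (x : E3) : ℝ :=
  (-(x k * x j * x l) / (8 * s ^ 3)
    + (kron j l * x k + kron k j * x l + kron k l * x j) / (4 * s ^ 2)) * heatKernel s x

/-- Time enters only through coefficients, so the spatial derivatives need no sign condition on `s`.
Positivity is used only in the bounds and in the time derivatives. -/
theorem hasFDerivAt_heatKernel (s : ℝ) (x : E3) :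
    HasFDerivAt (heatKernel s) (linForm fun k => heatD1 k s x) x := by
  have h := ((((hasStrictFDerivAt_norm_sq x).hasFDerivAt.const_mul
    (-(1 / (4 * s)))).exp).const_mul ((4 * Real.pi * s) ^ (-(3 / 2) : ℝ)))
  refine h.congr_fderiv ?_
  ext v
  simp only [linForm_apply, heatD1, heatKernel, smul_apply,
    innerSL_apply_apply, smul_eq_mul, nsmul_eq_mul, PiLp.inner_apply, Fin.sum_univ_three,
    RCLike.inner_apply, conj_trivial]
  push_cast
  ring

theorem proj_apply (k : Fin 3) (v : E3) : (EuclideanSpace.proj k : E3 →L[ℝ] ℝ) v = v k := rfl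

theorem sum_kron_mul (l : Fin 3) (f : Fin 3 → ℝ) : ∑ k, kron k l * f k = f l := by
  simp [kron]

theorem hasFDerivAt_heatD1 (l : Fin 3) (s : ℝ) (x : E3) :
    HasFDerivAt (heatD1 l s) (linForm fun k => heatD2 k l s x) x := by
  have h := (((hasFDerivAt_coord l x).mul_const (1 / (2 * s))).neg).mul
    (hasFDerivAt_heatKernel s x)
  refine (h.congr_of_eventuallyEq ?_).congr_fderiv ?_
  · exact Eventually.of_forall fun y => by simp [heatD1, div_eq_mul_inv]
  · ext v
    have := sum_kron_mul l fun k => v k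
    simp only [Fin.sum_univ_three] at this
    simp only [linForm_apply, heatD1, heatD2, smul_apply,
      add_apply, neg_apply, Pi.neg_apply,
      smul_eq_mul, Fin.sum_univ_three, proj_apply]
    rw [← this]
    ring

theorem hasFDerivAt_heatD2 (j l : Fin 3) (s : ℝ) (x : E3) :
    HasFDerivAt (heatD2 j l s) (linForm fun k => heatD3 k j l s x) x := by
  have h := ((((hasFDerivAt_coord j x).mul (hasFDerivAt_coord l x)).mul_const
    (1 / (4 * s ^ 2))).sub_const (kron j l / (2 * s))).mul (hasFDerivAt_heatKernel s x)
  refine (h.congr_of_eventuallyEq ?_).congr_fderiv ?_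
  · exact Eventually.of_forall fun y => by simp [heatD2, div_eq_mul_inv]
  · ext v
    have h1 := sum_kron_mul l fun k => v k
    have h2 := sum_kron_mul j fun k => v k
    simp only [Fin.sum_univ_three] at h1 h2
    simp only [linForm_apply, heatD1, heatD3, smul_apply,
      add_apply, Pi.mul_apply,
      smul_eq_mul, Fin.sum_univ_three, proj_apply]
    rw [← h1, ← h2]
    ring

theorem hasDerivAt_heatKernel_time {s : ℝ} (hs : 0 < s) (x : E3) :
    HasDerivAt (fun r => heatKernel r x)
      ((‖x‖ ^ 2 / (4 * s ^ 2) - 3 / (2 * s)) * heatKernel s x) s := by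
  have hp : 0 < 4 * Real.pi * s := by positivity
  have h1 : HasDerivAt (fun r : ℝ => 4 * Real.pi * r) (4 * Real.pi) s := by
    simpa using (hasDerivAt_id s).const_mul (4 * Real.pi)
  have h2 := h1.rpow_const (p := (-(3 / 2) : ℝ)) (Or.inl hp.ne')
  have h3 : HasDerivAt (fun r : ℝ => -(1 / (4 * r)) * ‖x‖ ^ 2) (1 / (4 * s ^ 2) * ‖x‖ ^ 2) s := by
    have := ((hasDerivAt_inv hs.ne').const_mul (-(1 / 4 : ℝ))).mul_const (‖x‖ ^ 2)
    refine (this.congr_of_eventuallyEq (Eventually.of_forall fun r => ?_)).congr_deriv ?_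
    · simp only [one_div, mul_inv]; ring
    · field_simp
  refine (h2.mul h3.exp).congr_deriv ?_
  rw [Real.rpow_sub_one hp.ne']
  simp only [heatKernel]
  field_simp
  ring

/-- `∑_j ∂_j ∂_j ∂_l = ∂_s ∂_l` on the heat kernel. -/
theorem hasDerivAt_heatD1_time (l : Fin 3) {s : ℝ} (hs : 0 < s) (x : E3) :
    HasDerivAt (fun r => heatD1 l r x) (∑ j, heatD3 j j l s x) s := by
  have h1 : HasDerivAt (fun r : ℝ => -(x l / (2 * r))) (x l / (2 * s ^ 2)) s := by
    have := ((hasDerivAt_inv hs.ne').const_mul (-(x l / 2)))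
    refine (this.congr_of_eventuallyEq (Eventually.of_forall fun r => ?_)).congr_deriv ?_
    · simp only [div_eq_mul_inv, mul_inv]; ring
    · field_simp
  refine (h1.mul (hasDerivAt_heatKernel_time hs x)).congr_deriv ?_
  have hn : ‖x‖ ^ 2 = x 0 ^ 2 + x 1 ^ 2 + x 2 ^ 2 := by
    rw [EuclideanSpace.norm_sq_eq]
    simp [Fin.sum_univ_three]
  have h2 := sum_kron_mul l fun k => x k
  simp only [Fin.sum_univ_three] at h2
  simp only [heatD3, Fin.sum_univ_three, hn]
  rw [← h2]
  have : ∀ j, kron j j = 1 := fun j => by simp [kron]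
  simp only [this]
  field_simp
  ring

/-! ### Pointwise bounds -/

theorem heatKernel_nonneg {s : ℝ} (hs : 0 < s) (x : E3) : 0 ≤ heatKernel s x := by
  unfold heatKernel
  positivity

/-- In the variable $|x|/\sqrt s$ this is the boundedness of a polynomial times a Gaussian. The
surplus of $2n$ powers pays for the polynomial prefactors of derivatives of order $n$. -/
theorem heatKernel_le (n : ℕ) : ∃ C : ℝ, 0 < C ∧ ∀ s : ℝ, 0 < s → ∀ x : E3,
    (√s + ‖x‖) ^ (2 * n + 3) * heatKernel s x ≤ C * √s ^ (2 * n) := by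
  obtain ⟨C, hC⟩ := gaussian_poly_bound (a := 1 / 4) (by norm_num) (2 * n + 3)
  have hC0 : 0 < C := lt_of_lt_of_le (by norm_num) (hC 0 le_rfl)
  refine ⟨(4 * Real.pi) ^ (-(3 / 2) : ℝ) * C, by positivity, fun s hs x => ?_⟩
  have hσ : 0 < √s := Real.sqrt_pos.2 hs
  have h1 : (4 * Real.pi * s) ^ (-(3 / 2) : ℝ)
      = (4 * Real.pi) ^ (-(3 / 2) : ℝ) * (√s ^ 3)⁻¹ := by
    rw [Real.mul_rpow (by positivity) hs.le, Real.rpow_neg hs.le, Real.sqrt_eq_rpow,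
      ← Real.rpow_natCast, ← Real.rpow_mul hs.le]
    norm_num
  have h2 : -(1 / (4 * s)) * ‖x‖ ^ 2 = -(1 / 4) * (‖x‖ / √s) ^ 2 := by
    rw [div_pow, Real.sq_sqrt hs.le]
    field_simp
  have h3 := hC (‖x‖ / √s) (by positivity)
  have h4 : √s + ‖x‖ = √s * (1 + ‖x‖ / √s) := by field_simp
  rw [heatKernel, h1, h2, h4, mul_pow]
  calc _ = (4 * Real.pi) ^ (-(3 / 2) : ℝ) * ((√s ^ (2 * n + 3)) * (√s ^ 3)⁻¹) *
        ((1 + ‖x‖ / √s) ^ (2 * n + 3) * Real.exp (-(1 / 4) * (‖x‖ / √s) ^ 2)) := by ring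
    _ ≤ (4 * Real.pi) ^ (-(3 / 2) : ℝ) * ((√s ^ (2 * n + 3)) * (√s ^ 3)⁻¹) * C := by gcongr
    _ = _ := by rw [pow_add]; field_simp

/-- A derivative of order $n$ is a prefactor `q` times the heat kernel, so the derivative bounds
reduce to estimating `q`. Terms of `q` with fewer factors of `x` reach the required form through
$s\le(\sqrt s+|x|)^2$. -/
theorem mul_heatKernel_le (n : ℕ) : ∃ C : ℝ, 0 < C ∧ ∀ s : ℝ, 0 < s → ∀ (x : E3) (q : ℝ),
    |q| ≤ (√s + ‖x‖) ^ n / s ^ n →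
      |q * heatKernel s x| ≤ C * ((√s + ‖x‖) ^ (n + 3))⁻¹ := by
  obtain ⟨C, hC0, hC⟩ := heatKernel_le n
  refine ⟨C, hC0, fun s hs x q hq => ?_⟩
  have hσ : 0 < √s := Real.sqrt_pos.2 hs
  have hw : 0 < √s + ‖x‖ := by positivity
  rw [abs_mul, abs_of_nonneg (heatKernel_nonneg hs x), ← div_eq_mul_inv, le_div_iff₀ (by positivity)]
  calc |q| * heatKernel s x * (√s + ‖x‖) ^ (n + 3)
      ≤ (√s + ‖x‖) ^ n / s ^ n * heatKernel s x * (√s + ‖x‖) ^ (n + 3) := by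
        have := heatKernel_nonneg hs x
        gcongr
    _ = ((√s + ‖x‖) ^ (2 * n + 3) * heatKernel s x) / s ^ n := by ring
    _ ≤ C * √s ^ (2 * n) / s ^ n := by exact div_le_div_of_nonneg_right (hC s hs x) (by positivity)
    _ = C := by rw [pow_mul, Real.sq_sqrt hs.le]; field_simp

theorem abs_kron_le (j l : Fin 3) : |kron j l| ≤ 1 := by
  unfold kron
  split_ifs <;> simp

theorem heatKernel_bound : ∃ C : ℝ, 0 < C ∧ ∀ s : ℝ, 0 < s → ∀ x : E3,
    |heatKernel s x| ≤ C * ((√s + ‖x‖) ^ 3)⁻¹ := by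
  obtain ⟨C, hC0, hC⟩ := mul_heatKernel_le 0
  exact ⟨C, hC0, fun s hs x => by simpa using hC s hs x 1 (by simp)⟩

theorem heatD1_bound : ∃ C : ℝ, 0 < C ∧ ∀ l, ∀ s : ℝ, 0 < s → ∀ x : E3,
    |heatD1 l s x| ≤ C * ((√s + ‖x‖) ^ 4)⁻¹ := by
  obtain ⟨C, hC0, hC⟩ := mul_heatKernel_le 1
  refine ⟨C, hC0, fun l s hs x => hC s hs x _ ?_⟩
  have h1 := norm_apply_le x l
  rw [abs_neg, abs_div, abs_of_pos (by positivity : 0 < 2 * s), div_le_div_iff₀ (by positivity)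
    (by positivity)]
  have : |x l| ≤ √s + ‖x‖ := by linarith [Real.sqrt_nonneg s]
  nlinarith [abs_nonneg (x l), mul_le_mul_of_nonneg_right this hs.le]

theorem heatD2_bound : ∃ C : ℝ, 0 < C ∧ ∀ j l, ∀ s : ℝ, 0 < s → ∀ x : E3,
    |heatD2 j l s x| ≤ C * ((√s + ‖x‖) ^ 5)⁻¹ := by
  obtain ⟨C, hC0, hC⟩ := mul_heatKernel_le 2
  refine ⟨C, hC0, fun j l s hs x => hC s hs x _ ?_⟩
  have hσ := Real.sqrt_nonneg s
  have hj : |x j| ≤ √s + ‖x‖ := by linarith [norm_apply_le x j]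
  have hl : |x l| ≤ √s + ‖x‖ := by linarith [norm_apply_le x l]
  have hs2 : s ≤ (√s + ‖x‖) ^ 2 := by
    nlinarith [Real.sq_sqrt hs.le, mul_nonneg hσ (norm_nonneg x)]
  have hjl : |x j * x l| ≤ (√s + ‖x‖) ^ 2 := by
    rw [abs_mul, sq]
    gcongr
  have h1 : |x j * x l / (4 * s ^ 2)| ≤ (√s + ‖x‖) ^ 2 / s ^ 2 / 4 := by
    rw [abs_div, abs_of_pos (by positivity : 0 < 4 * s ^ 2), div_div, mul_comm (s ^ 2)]
    gcongr
  have h2 : |kron j l / (2 * s)| ≤ (√s + ‖x‖) ^ 2 / s ^ 2 / 2 := by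
    rw [abs_div, abs_of_pos (by positivity : 0 < 2 * s)]
    calc |kron j l| / (2 * s) ≤ 1 / (2 * s) := by gcongr; exact abs_kron_le j l
      _ = s / s ^ 2 / 2 := by field_simp
      _ ≤ _ := by gcongr
  have h3 : 0 ≤ (√s + ‖x‖) ^ 2 / s ^ 2 := by positivity
  calc _ ≤ |x j * x l / (4 * s ^ 2)| + |kron j l / (2 * s)| := abs_sub _ _
    _ ≤ _ := by linarith

theorem heatD3_bound : ∃ C : ℝ, 0 < C ∧ ∀ k j l, ∀ s : ℝ, 0 < s → ∀ x : E3,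
    |heatD3 k j l s x| ≤ C * ((√s + ‖x‖) ^ 6)⁻¹ := by
  obtain ⟨C, hC0, hC⟩ := mul_heatKernel_le 3
  refine ⟨C, hC0, fun k j l s hs x => hC s hs x _ ?_⟩
  have hσ := Real.sqrt_nonneg s
  have hx : ∀ i, |x i| ≤ √s + ‖x‖ := fun i => by linarith [norm_apply_le x i]
  have hs2 : s ≤ (√s + ‖x‖) ^ 2 := by
    nlinarith [Real.sq_sqrt hs.le, mul_nonneg hσ (norm_nonneg x)]
  have hw : 0 ≤ √s + ‖x‖ := by positivity
  have h1 : |-(x k * x j * x l) / (8 * s ^ 3)| ≤ (√s + ‖x‖) ^ 3 / s ^ 3 / 8 := by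
    rw [abs_div, abs_of_pos (by positivity : 0 < 8 * s ^ 3), div_div, mul_comm (s ^ 3), abs_neg,
      abs_mul, abs_mul]
    gcongr
    calc |x k| * |x j| * |x l| ≤ (√s + ‖x‖) * (√s + ‖x‖) * (√s + ‖x‖) := by
          gcongr <;> exact hx _
      _ = _ := by ring
  have hk : ∀ a b i, |kron a b * x i| ≤ √s + ‖x‖ := fun a b i => by
    rw [abs_mul]
    calc |kron a b| * |x i| ≤ 1 * (√s + ‖x‖) := by
          gcongr
          · exact abs_kron_le _ _
          · exact hx i
      _ = _ := one_mul _
  have h2 : |(kron j l * x k + kron k j * x l + kron k l * x j) / (4 * s ^ 2)|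
      ≤ 3 / 4 * ((√s + ‖x‖) ^ 3 / s ^ 3) := by
    rw [abs_div, abs_of_pos (by positivity : 0 < 4 * s ^ 2)]
    calc |kron j l * x k + kron k j * x l + kron k l * x j| / (4 * s ^ 2)
        ≤ (3 * (√s + ‖x‖)) / (4 * s ^ 2) := by
          gcongr
          refine (abs_add_three _ _ _).trans ?_
          linarith [hk j l k, hk k j l, hk k l j]
      _ = 3 / 4 * ((√s + ‖x‖) * s / s ^ 3) := by field_simp
      _ ≤ 3 / 4 * ((√s + ‖x‖) * (√s + ‖x‖) ^ 2 / s ^ 3) := by gcongr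
      _ = _ := by ring
  have h3 : 0 ≤ (√s + ‖x‖) ^ 3 / s ^ 3 := by positivity
  refine (abs_add_le _ _).trans ?_
  linarith

/-! ### Measurability -/

theorem measurable_coord (k : Fin 3) : Measurable fun x : E3 => x k :=
  (EuclideanSpace.proj k : E3 →L[ℝ] ℝ).continuous.measurable

theorem measurable_heatKernel : Measurable fun p : ℝ × E3 => heatKernel p.1 p.2 := by
  unfold heatKernel
  fun_prop

theorem measurable_heatD1 (l : Fin 3) : Measurable fun p : ℝ × E3 => heatD1 l p.1 p.2 := by
  have h : ∀ k, Measurable fun p : ℝ × E3 => p.2 k :=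
    fun k => (measurable_coord k).comp measurable_snd
  exact (((h l).div (measurable_fst.const_mul 2)).neg).mul measurable_heatKernel

theorem measurable_heatD2 (j l : Fin 3) : Measurable fun p : ℝ × E3 => heatD2 j l p.1 p.2 := by
  have h : ∀ k, Measurable fun p : ℝ × E3 => p.2 k :=
    fun k => (measurable_coord k).comp measurable_snd
  exact ((((h j).mul (h l)).div ((measurable_fst.pow_const 2).const_mul 4)).sub
    (measurable_const.div (measurable_fst.const_mul 2))).mul measurable_heatKernel

theorem measurable_heatD3 (k j l : Fin 3) :
    Measurable fun p : ℝ × E3 => heatD3 k j l p.1 p.2 := by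
  have h : ∀ k, Measurable fun p : ℝ × E3 => p.2 k :=
    fun k => (measurable_coord k).comp measurable_snd
  exact ((((((h k).mul (h j)).mul (h l)).neg).div ((measurable_fst.pow_const 3).const_mul 8)).add
    (((((h k).const_mul _).add ((h l).const_mul _)).add ((h j).const_mul _)).div
    ((measurable_fst.pow_const 2).const_mul 4))).mul measurable_heatKernel

/-! ### Tails in time -/

/-- The integrand is at most $-2$ times the derivative of $(\sqrt s+\rho)^{-(n+1)}$, because $(\sqrt
s+\rho)^{-1}\le s^{-1/2}$. Integration over $(t,\infty)$ thus gains two powers of the weight. -/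
theorem sqrt_tail (n : ℕ) {t ρ : ℝ} (ht : 0 < t) (hρ : 0 ≤ ρ) :
    IntegrableOn (fun s => ((√s + ρ) ^ (n + 3))⁻¹) (Ioi t) ∧
      ∫ s in Ioi t, ((√s + ρ) ^ (n + 3))⁻¹ ≤ 2 * ((√t + ρ) ^ (n + 1))⁻¹ := by
  have hd : ∀ s ∈ Ici t, HasDerivAt (fun s => ((√s + ρ) ^ (n + 1))⁻¹)
      (-((n + 1) * ((√s + ρ) ^ (n + 2))⁻¹ / (2 * √s))) s := fun s hs => by
    have hs0 : 0 < s := ht.trans_le hs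
    have hσ : 0 < √s := Real.sqrt_pos.2 hs0
    have h := (((Real.hasDerivAt_sqrt hs0.ne').add_const ρ).pow (n + 1)).inv
      (by simp only [Pi.pow_apply]; positivity)
    refine h.congr_deriv ?_
    simp only [Nat.add_sub_cancel, Pi.pow_apply]
    push_cast
    field_simp
    ring
  have hneg : ∀ s ∈ Ioi t, -((n + 1) * ((√s + ρ) ^ (n + 2))⁻¹ / (2 * √s)) ≤ 0 := fun s _ => by
    rw [neg_nonpos]
    positivity
  have hlim : Tendsto (fun s => ((√s + ρ) ^ (n + 1))⁻¹) atTop (𝓝 0) := by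
    refine tendsto_inv_atTop_zero.comp ((tendsto_pow_atTop (by omega)).comp ?_)
    exact tendsto_atTop_add_const_right _ _ Real.tendsto_sqrt_atTop
  have hI := integrableOn_Ioi_deriv_of_nonpos' hd hneg hlim
  have hE := integral_Ioi_of_hasDerivAt_of_nonpos' hd hneg hlim
  have hle : ∀ s ∈ Ioi t, ((√s + ρ) ^ (n + 3))⁻¹
      ≤ -2 * -((n + 1) * ((√s + ρ) ^ (n + 2))⁻¹ / (2 * √s)) := fun s hs => by
    have hσ : 0 < √s := Real.sqrt_pos.2 (ht.trans hs)
    have h1 : (√s + ρ)⁻¹ ≤ (√s)⁻¹ := by gcongr; linarith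
    have h2 : (1 : ℝ) ≤ n + 1 := by linarith [n.cast_nonneg (α := ℝ)]
    calc ((√s + ρ) ^ (n + 3))⁻¹ = 1 * ((√s + ρ) ^ (n + 2))⁻¹ * (√s + ρ)⁻¹ := by
          rw [pow_succ, mul_inv, one_mul]
      _ ≤ (n + 1) * ((√s + ρ) ^ (n + 2))⁻¹ * (√s)⁻¹ := by gcongr
      _ = _ := by field_simp
  have hint : IntegrableOn (fun s => ((√s + ρ) ^ (n + 3))⁻¹) (Ioi t) := by
    refine (hI.const_mul (-2)).mono' ?_ ?_
    · exact Measurable.aestronglyMeasurable (by fun_prop)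
    · filter_upwards [ae_restrict_mem measurableSet_Ioi] with s hs
      rw [Real.norm_of_nonneg (by positivity)]
      exact hle s hs
  refine ⟨hint, (setIntegral_mono_on hint (hI.const_mul (-2)) measurableSet_Ioi hle).trans ?_⟩
  rw [integral_const_mul, hE]
  apply le_of_eq
  ring

/-! ### The Oseen kernel -/

theorem integrableOn_Ioi_of_bound {g : ℝ → ℝ} {n : ℕ} {C t ρ : ℝ} (ht : 0 < t) (hρ : 0 ≤ ρ)
    (hm : Measurable g) (hb : ∀ s, 0 < s → |g s| ≤ C * ((√s + ρ) ^ (n + 3))⁻¹) :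
    IntegrableOn g (Ioi t) := by
  refine ((sqrt_tail n ht hρ).1.const_mul C).mono' hm.aestronglyMeasurable ?_
  filter_upwards [ae_restrict_mem measurableSet_Ioi] with s hs
  exact hb s (ht.trans hs)

theorem abs_integral_Ioi_le {g : ℝ → ℝ} {n : ℕ} {C t ρ : ℝ} (ht : 0 < t) (hρ : 0 ≤ ρ)
    (hC : 0 ≤ C) (hb : ∀ s, 0 < s → |g s| ≤ C * ((√s + ρ) ^ (n + 3))⁻¹) :
    |∫ s in Ioi t, g s| ≤ 2 * C * ((√t + ρ) ^ (n + 1))⁻¹ := by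
  have h := norm_integral_le_of_norm_le (μ := volume.restrict (Ioi t)) (f := g)
    ((sqrt_tail n ht hρ).1.const_mul C) (by
      filter_upwards [ae_restrict_mem measurableSet_Ioi] with s hs
      exact hb s (ht.trans hs))
  refine h.trans ?_
  rw [integral_const_mul]
  calc _ ≤ C * (2 * ((√t + ρ) ^ (n + 1))⁻¹) := by gcongr; exact (sqrt_tail n ht hρ).2
    _ = _ := by ring

theorem hasFDerivAt_integral_Ioi {g : ℝ → E3 → ℝ} {g' : Fin 3 → ℝ → E3 → ℝ} {n m : ℕ} {C C' t : ℝ}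
    (ht : 0 < t) (hC' : 0 ≤ C') (hm : ∀ x, Measurable fun s => g s x)
    (hm' : ∀ k x, Measurable fun s => g' k s x)
    (hd : ∀ s x, HasFDerivAt (g s) (linForm fun k => g' k s x) x)
    (hb : ∀ s, 0 < s → ∀ x, |g s x| ≤ C * ((√s + ‖x‖) ^ (n + 3))⁻¹)
    (hb' : ∀ k s, 0 < s → ∀ x, |g' k s x| ≤ C' * ((√s + ‖x‖) ^ (m + 3))⁻¹) (x : E3) :
    HasFDerivAt (fun x => ∫ s in Ioi t, g s x) (linForm fun k => ∫ s in Ioi t, g' k s x) x := by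
  have hi : ∀ k, IntegrableOn (fun s => g' k s x) (Ioi t) := fun k =>
    integrableOn_Ioi_of_bound ht (norm_nonneg x) (hm' k x) fun s hs => hb' k s hs x
  have h := hasFDerivAt_integral_of_dominated_of_fderiv_le (𝕜 := ℝ) (μ := volume.restrict (Ioi t))
    (F := fun x s => g s x) (F' := fun x s => linForm fun k => g' k s x) (x₀ := x) (s := univ)
    -- Dropping $|y|$ from the weight gives a majorant uniform over all of space, and `sqrt_tail`
    -- with $\rho=0$ integrates it.
    (bound := fun s => 3 * C' * ((√s + 0) ^ (m + 3))⁻¹) univ_mem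
    (Eventually.of_forall fun y => (hm y).aestronglyMeasurable)
    (integrableOn_Ioi_of_bound ht (norm_nonneg x) (hm x) fun s hs => hb s hs x)
    (by
      refine Measurable.aestronglyMeasurable ?_
      unfold linForm
      exact Finset.measurable_sum _ fun k _ => (hm' k x).smul_const _)
    (by
      filter_upwards [ae_restrict_mem measurableSet_Ioi] with s hs y _
      have hs0 : 0 < s := ht.trans hs
      have hσ : 0 < √s := Real.sqrt_pos.2 hs0
      refine (norm_linForm_le _).trans ?_
      have : ∀ k, |g' k s y| ≤ C' * ((√s + 0) ^ (m + 3))⁻¹ := fun k =>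
        (hb' k s hs0 y).trans (by gcongr; exact norm_nonneg y)
      calc _ ≤ ∑ _k : Fin 3, C' * ((√s + 0) ^ (m + 3))⁻¹ := Finset.sum_le_sum fun k _ => this k
        _ = _ := by simp; ring)
    ((sqrt_tail m ht le_rfl).1.const_mul _)
    (Eventually.of_forall fun s y _ => hd s y)
  refine h.congr_fderiv ?_
  unfold linForm
  rw [integral_finsetSum _ fun k _ => (hi k).smul_const _]
  exact Finset.sum_congr rfl fun k _ => integral_smul_const _ _

/-- Explicit form of the Oseen kernel. -/
def oseenExplicit (j l : Fin 3) (t : ℝ) (x : E3) : ℝ :=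
  kron j l * heatKernel t x + ∫ s in Ioi t, heatD2 j l s x

/-- Explicit form of `∂_k` of the Oseen kernel. -/
def oseenGrad (k j l : Fin 3) (t : ℝ) (x : E3) : ℝ :=
  kron j l * heatD1 k t x + ∫ s in Ioi t, heatD3 k j l s x

/-- Two differentiations under $\int_t^\infty$ are legitimate because the first and second
derivatives of the heat kernel are $O(s^{-2})$ and $O(s^{-5/2})$ uniformly in space. -/
theorem oseenKernel_eq (j l : Fin 3) {t : ℝ} (ht : 0 < t) :
    oseenKernel j l t = oseenExplicit j l t := by
  obtain ⟨C0, -, h0⟩ := heatKernel_bound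
  obtain ⟨C1, h1p, h1⟩ := heatD1_bound
  obtain ⟨C2, h2p, h2⟩ := heatD2_bound
  have e1 : ∀ l, pd l (invLaplaceHeatKernel t) = fun x => ∫ s in Ioi t, heatD1 l s x := fun l => by
    ext x
    exact pd_eq_of_hasFDerivAt (hasFDerivAt_integral_Ioi (n := 0) (m := 1) ht h1p.le
      (fun x => measurable_heatKernel.comp (measurable_id.prodMk measurable_const))
      (fun k x => (measurable_heatD1 k).comp (measurable_id.prodMk measurable_const))
      hasFDerivAt_heatKernel h0 h1 x) l
  ext x
  have e2 : pd j (fun x => ∫ s in Ioi t, heatD1 l s x) x = ∫ s in Ioi t, heatD2 j l s x :=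
    pd_eq_of_hasFDerivAt (hasFDerivAt_integral_Ioi (n := 1) (m := 2)
      (g' := fun k s x => heatD2 k l s x) ht h2p.le
      (fun x => (measurable_heatD1 l).comp (measurable_id.prodMk measurable_const))
      (fun k x => (measurable_heatD2 k l).comp (measurable_id.prodMk measurable_const))
      (hasFDerivAt_heatD1 l) (h1 l) (fun k => h2 k l) x) j
  rw [oseenKernel, oseenExplicit, e1, e2, kron]
  split_ifs <;> simp

theorem hasFDerivAt_oseenExplicit (j l : Fin 3) {t : ℝ} (ht : 0 < t) (x : E3) :
    HasFDerivAt (oseenExplicit j l t) (linForm fun k => oseenGrad k j l t x) x := by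
  obtain ⟨C2, -, h2⟩ := heatD2_bound
  obtain ⟨C3, h3p, h3⟩ := heatD3_bound
  have h := ((hasFDerivAt_heatKernel t x).const_mul (kron j l)).add
    (hasFDerivAt_integral_Ioi (n := 2) (m := 3) (g' := fun k s x => heatD3 k j l s x) ht h3p.le
      (fun x => (measurable_heatD2 j l).comp (measurable_id.prodMk measurable_const))
      (fun k x => (measurable_heatD3 k j l).comp (measurable_id.prodMk measurable_const))
      (hasFDerivAt_heatD2 j l) (h2 j l) (fun k => h3 k j l) x)
  refine h.congr_fderiv ?_
  ext v
  simp only [add_apply, smul_apply, linForm_apply, smul_eq_mul, oseenGrad, Finset.mul_sum,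
    ← Finset.sum_add_distrib]
  exact Finset.sum_congr rfl fun k _ => by ring

theorem pd_oseenKernel (k j l : Fin 3) {t : ℝ} (ht : 0 < t) (x : E3) :
    pd k (oseenKernel j l t) x = oseenGrad k j l t x := by
  rw [oseenKernel_eq j l ht]
  exact pd_eq_of_hasFDerivAt (hasFDerivAt_oseenExplicit j l ht x) k

theorem pd_heatKernel (k : Fin 3) (t : ℝ) (x : E3) : pd k (heatKernel t) x = heatD1 k t x :=
  pd_eq_of_hasFDerivAt (hasFDerivAt_heatKernel t x) k

/-- By the heat equation the summed integrand is $\partial_s\partial_l$ of the heat kernel. Its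
integral over $(t,\infty)$ is minus the value of $\partial_l$ at time $t$, which cancels the
Kronecker term. -/
theorem sum_oseenGrad_eq_zero (l : Fin 3) {t : ℝ} (ht : 0 < t) (x : E3) :
    ∑ j, oseenGrad j j l t x = 0 := by
  obtain ⟨C1, h1p, h1⟩ := heatD1_bound
  obtain ⟨C3, h3p, h3⟩ := heatD3_bound
  have hi : ∀ j, IntegrableOn (fun s => heatD3 j j l s x) (Ioi t) := fun j =>
    integrableOn_Ioi_of_bound (n := 3) ht (norm_nonneg x)
      ((measurable_heatD3 j j l).comp (measurable_id.prodMk measurable_const))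
      fun s hs => h3 j j l s hs x
  have hlim : Tendsto (fun s => heatD1 l s x) atTop (𝓝 0) := by
    have hz : Tendsto (fun s => C1 * ((√s + ‖x‖) ^ 4)⁻¹) atTop (𝓝 0) := by
      have : Tendsto (fun s => ((√s + ‖x‖) ^ 4)⁻¹) atTop (𝓝 0) :=
        tendsto_inv_atTop_zero.comp ((tendsto_pow_atTop (by omega)).comp
          (tendsto_atTop_add_const_right _ _ Real.tendsto_sqrt_atTop))
      simpa using this.const_mul C1
    refine squeeze_zero_norm' ?_ hz
    filter_upwards [eventually_gt_atTop 0] with s hs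
    exact h1 l s hs x
  have hE := integral_Ioi_of_hasDerivAt_of_tendsto' (a := t) (f := fun s => heatD1 l s x)
    (f' := fun s => ∑ j, heatD3 j j l s x)
    (fun s hs => hasDerivAt_heatD1_time l (ht.trans_le hs) x)
    (integrable_finsetSum _ fun j _ => hi j) hlim
  rw [integral_finsetSum _ fun j _ => hi j] at hE
  simp only [oseenGrad, Finset.sum_add_distrib, hE, kron]
  simp

/-- The two powers gained in time turn the exponent $-5$ of `heatD2` into $-3$, the exponent used
for the local part. -/
theorem oseenExplicit_bound : ∃ C : ℝ, 0 < C ∧ ∀ j l, ∀ t : ℝ, 0 < t → ∀ x : E3,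
    |oseenExplicit j l t x| ≤ C * ((√t + ‖x‖) ^ 3)⁻¹ := by
  obtain ⟨C0, h0p, h0⟩ := heatKernel_bound
  obtain ⟨C2, h2p, h2⟩ := heatD2_bound
  refine ⟨C0 + 2 * C2, by positivity, fun j l t ht x => (abs_add_le _ _).trans ?_⟩
  have e1 := abs_integral_Ioi_le (n := 2) ht (norm_nonneg x) h2p.le fun s hs => h2 j l s hs x
  have e2 : |kron j l * heatKernel t x| ≤ 1 * (C0 * ((√t + ‖x‖) ^ 3)⁻¹) := by
    rw [abs_mul]
    exact mul_le_mul (abs_kron_le j l) (h0 t ht x) (abs_nonneg _) zero_le_one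
  linarith

theorem oseenGrad_bound : ∃ C : ℝ, 0 < C ∧ ∀ k j l, ∀ t : ℝ, 0 < t → ∀ x : E3,
    |oseenGrad k j l t x| ≤ C * ((√t + ‖x‖) ^ 4)⁻¹ := by
  obtain ⟨C1, h1p, h1⟩ := heatD1_bound
  obtain ⟨C3, h3p, h3⟩ := heatD3_bound
  refine ⟨C1 + 2 * C3, by positivity, fun k j l t ht x => (abs_add_le _ _).trans ?_⟩
  have e1 := abs_integral_Ioi_le (n := 3) ht (norm_nonneg x) h3p.le fun s hs => h3 k j l s hs x
  have e2 : |kron j l * heatD1 k t x| ≤ 1 * (C1 * ((√t + ‖x‖) ^ 4)⁻¹) := by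
    rw [abs_mul]
    exact mul_le_mul (abs_kron_le j l) (h1 k t ht x) (abs_nonneg _) zero_le_one
  linarith

theorem measurable_integral_Ioi {g : ℝ → E3 → ℝ} (hg : Measurable fun p : ℝ × E3 => g p.1 p.2) :
    Measurable fun p : ℝ × E3 => ∫ s in Ioi p.1, g s p.2 := by
  have h : Measurable fun q : (ℝ × E3) × ℝ =>
      {q : (ℝ × E3) × ℝ | q.1.1 < q.2}.indicator (fun q => g q.2 q.1.2) q := by
    refine Measurable.indicator ?_ (measurableSet_lt (by fun_prop) (by fun_prop))
    exact hg.comp (measurable_snd.prodMk (measurable_snd.comp measurable_fst))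
  have h2 := (h.stronglyMeasurable.integral_prod_right' (ν := volume)).measurable
  refine (congrArg Measurable (funext fun p => ?_)).mpr h2
  rw [← integral_indicator measurableSet_Ioi]
  rfl

theorem measurable_oseenExplicit (j l : Fin 3) :
    Measurable fun p : ℝ × E3 => oseenExplicit j l p.1 p.2 :=
  (measurable_heatKernel.const_mul _).add (measurable_integral_Ioi (measurable_heatD2 j l))

theorem measurable_oseenGrad (k j l : Fin 3) :
    Measurable fun p : ℝ × E3 => oseenGrad k j l p.1 p.2 :=
  ((measurable_heatD1 k).const_mul _).add (measurable_integral_Ioi (measurable_heatD3 k j l))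

/-! ### The columns of the Oseen kernel are solenoidal -/

theorem contDiff_pd {φ : E3 → ℝ} (hφ : ContDiff ℝ ∞ φ) (k : Fin 3) : ContDiff ℝ ∞ (pd k φ) :=
  (hφ.fderiv_right (m := ∞) (by simp)).clm_apply contDiff_const

theorem hasCompactSupport_pd {φ : E3 → ℝ} (hφ : HasCompactSupport φ) (k : Fin 3) :
    HasCompactSupport (pd k φ) :=
  (hφ.fderiv (𝕜 := ℝ)).comp_left (g := fun L : E3 →L[ℝ] ℝ => L (EuclideanSpace.single k 1)) rfl

theorem pd_comm {φ : E3 → ℝ} (hφ : ContDiff ℝ ∞ φ) (j k : Fin 3) (x : E3) :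
    pd j (pd k φ) x = pd k (pd j φ) x := by
  have hd : DifferentiableAt ℝ (fderiv ℝ φ) x :=
    (hφ.fderiv_right (m := ∞) (by simp)).differentiable (by simp) x
  have h : ∀ a b : Fin 3, pd a (pd b φ) x = fderiv ℝ (fderiv ℝ φ) x (EuclideanSpace.single a 1)
      (EuclideanSpace.single b 1) := fun a b => by
    have := hd.hasFDerivAt.clm_apply (hasFDerivAt_const (EuclideanSpace.single b (1 : ℝ)) x)
    rw [pd, show pd b φ = fun y => fderiv ℝ φ y (EuclideanSpace.single b 1) from rfl, this.fderiv]
    simp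
  rw [h, h]
  exact (hφ.contDiffAt.isSymmSndFDerivAt (by simp; exact WithTop.coe_le_coe.2 (le_top : (2 : ℕ∞) ≤ ⊤))) _ _

theorem integrable_mul_of_bound {φ f : E3 → ℝ} {C : ℝ} (hφ : Continuous φ)
    (hc : HasCompactSupport φ) (hf : AEStronglyMeasurable f volume) (hb : ∀ x, |f x| ≤ C) :
    Integrable (fun x => φ x * f x) :=
  (hφ.integrable_of_hasCompactSupport hc).mul_bdd (c := C) hf (Eventually.of_forall hb)

theorem integral_pd_mul {φ f : E3 → ℝ} {f' : Fin 3 → E3 → ℝ} {C C' : ℝ} (hφ : ContDiff ℝ ∞ φ)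
    (hc : HasCompactSupport φ) (hf : ∀ x, HasFDerivAt f (linForm fun k => f' k x) x)
    (hm' : ∀ k, AEStronglyMeasurable (f' k) volume)
    (hb : ∀ x, |f x| ≤ C) (hb' : ∀ k x, |f' k x| ≤ C') (k : Fin 3) :
    ∫ x, pd k φ x * f x = -∫ x, φ x * f' k x := by
  have hfc : Continuous f := continuous_iff_continuousAt.2 fun x => (hf x).continuousAt
  have e : ∀ x, fderiv ℝ f x (EuclideanSpace.single k 1) = f' k x := fun x =>
    pd_eq_of_hasFDerivAt (hf x) k
  have h := integral_mul_fderiv_eq_neg_fderiv_mul_of_integrable (𝕜 := ℝ) (μ := volume) (f := φ)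
    (g := f) (v := EuclideanSpace.single k 1)
    (integrable_mul_of_bound (contDiff_pd hφ k).continuous (hasCompactSupport_pd hc k)
      hfc.aestronglyMeasurable hb)
    (by simpa only [e] using integrable_mul_of_bound hφ.continuous hc (hm' k) (hb' k))
    (integrable_mul_of_bound hφ.continuous hc hfc.aestronglyMeasurable hb)
    (fun x _ => (hφ.differentiable (by simp) x)) (fun x _ => (hf x).differentiableAt)
  simp only [e] at h
  rw [h, neg_neg]
  rfl

theorem inv_pow_add_le {t : ℝ} (ht : 0 < t) (n : ℕ) (x : E3) :
    ((√t + ‖x‖) ^ n)⁻¹ ≤ (√t ^ n)⁻¹ := by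
  have : 0 < √t := Real.sqrt_pos.2 ht
  gcongr
  linarith [norm_nonneg x]

theorem hasFDerivAt_oseenExplicit_sub (j l : Fin 3) {t : ℝ} (ht : 0 < t) (y x : E3) :
    HasFDerivAt (fun x => oseenExplicit j l t (x - y))
      (linForm fun k => oseenGrad k j l t (x - y)) x := by
  have := (hasFDerivAt_oseenExplicit j l ht (x - y)).comp x ((hasFDerivAt_id x).sub_const y)
  refine this.congr_fderiv ?_
  ext v
  simp

theorem aestronglyMeasurable_oseenGrad_sub (k j l : Fin 3) (t : ℝ) (y : E3) :
    AEStronglyMeasurable (fun x => oseenGrad k j l t (x - y)) volume :=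
  ((measurable_oseenGrad k j l).comp
    (measurable_const.prodMk (measurable_id.sub_const y))).aestronglyMeasurable

theorem integral_sum_pd_mul_oseen {φ : E3 → ℝ} (hφ : ContDiff ℝ ∞ φ) (hc : HasCompactSupport φ)
    (l : Fin 3) {t : ℝ} (ht : 0 < t) (y : E3) :
    ∫ x, ∑ j, pd j φ x * oseenExplicit j l t (x - y) = 0 := by
  obtain ⟨C, hC, hb⟩ := oseenExplicit_bound
  obtain ⟨C', hC', hb'⟩ := oseenGrad_bound
  have b : ∀ j x, |oseenExplicit j l t (x - y)| ≤ C * (√t ^ 3)⁻¹ := fun j x =>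
    (hb j l t ht _).trans (by exact mul_le_mul_of_nonneg_left (inv_pow_add_le ht 3 _) hC.le)
  have b' : ∀ k j x, |oseenGrad k j l t (x - y)| ≤ C' * (√t ^ 4)⁻¹ := fun k j x =>
    (hb' k j l t ht _).trans (by exact mul_le_mul_of_nonneg_left (inv_pow_add_le ht 4 _) hC'.le)
  have hd := fun j x => hasFDerivAt_oseenExplicit_sub j l ht y x
  have hfc : ∀ j, Continuous fun x => oseenExplicit j l t (x - y) := fun j =>
    continuous_iff_continuousAt.2 fun x => (hd j x).continuousAt
  have hm := fun k j => aestronglyMeasurable_oseenGrad_sub k j l t y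
  rw [integral_finsetSum _ fun j _ => integrable_mul_of_bound (contDiff_pd hφ j).continuous
    (hasCompactSupport_pd hc j) (hfc j).aestronglyMeasurable (b j)]
  have e : ∀ j, ∫ x, pd j φ x * oseenExplicit j l t (x - y)
      = -∫ x, φ x * oseenGrad j j l t (x - y) := fun j =>
    integral_pd_mul hφ hc (hd j) (fun k => hm k j) (b j) (fun k => b' k j) j
  simp only [e]
  rw [Finset.sum_neg_distrib, ← integral_finsetSum _ fun j _ =>
    integrable_mul_of_bound hφ.continuous hc (hm j j) (b' j j)]
  simp only [← Finset.mul_sum, sum_oseenGrad_eq_zero l ht]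
  simp

/-- The derivative $\partial_k$ is moved onto the test function and commuted with $\partial_j$. This
leaves the statement for the undifferentiated kernel tested against $\partial_k\varphi$, so no
second derivatives of the Oseen kernel are needed. -/
theorem integral_sum_pd_mul_oseenGrad {φ : E3 → ℝ} (hφ : ContDiff ℝ ∞ φ)
    (hc : HasCompactSupport φ) (k l : Fin 3) {t : ℝ} (ht : 0 < t) (y : E3) :
    ∫ x, ∑ j, pd j φ x * oseenGrad k j l t (x - y) = 0 := by
  obtain ⟨C, hC, hb⟩ := oseenExplicit_bound
  obtain ⟨C', hC', hb'⟩ := oseenGrad_bound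
  have b : ∀ j x, |oseenExplicit j l t (x - y)| ≤ C * (√t ^ 3)⁻¹ := fun j x =>
    (hb j l t ht _).trans (by exact mul_le_mul_of_nonneg_left (inv_pow_add_le ht 3 _) hC.le)
  have b' : ∀ k j x, |oseenGrad k j l t (x - y)| ≤ C' * (√t ^ 4)⁻¹ := fun k j x =>
    (hb' k j l t ht _).trans (by exact mul_le_mul_of_nonneg_left (inv_pow_add_le ht 4 _) hC'.le)
  have hd := fun j x => hasFDerivAt_oseenExplicit_sub j l ht y x
  have hfc : ∀ j, Continuous fun x => oseenExplicit j l t (x - y) := fun j =>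
    continuous_iff_continuousAt.2 fun x => (hd j x).continuousAt
  have hm := fun k j => aestronglyMeasurable_oseenGrad_sub k j l t y
  rw [integral_finsetSum _ fun j _ => integrable_mul_of_bound (contDiff_pd hφ j).continuous
    (hasCompactSupport_pd hc j) (hm k j) (b' k j)]
  have e : ∀ j, ∫ x, pd j φ x * oseenGrad k j l t (x - y)
      = -∫ x, pd j (pd k φ) x * oseenExplicit j l t (x - y) := fun j => by
    rw [← neg_eq_iff_eq_neg, ← integral_pd_mul (contDiff_pd hφ j) (hasCompactSupport_pd hc j)
      (hd j) (fun k => hm k j) (b j) (fun k => b' k j) k]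
    simp only [pd_comm hφ j k]
  simp only [e]
  rw [Finset.sum_neg_distrib, ← integral_finsetSum _ fun j _ =>
    integrable_mul_of_bound (contDiff_pd (contDiff_pd hφ k) j).continuous
      (hasCompactSupport_pd (hasCompactSupport_pd hc k) j) (hfc j).aestronglyMeasurable (b j),
    integral_sum_pd_mul_oseen (contDiff_pd hφ k) (hasCompactSupport_pd hc k) l ht y, neg_zero]

/-! ### Regularity of `e^{tΔ} θ₀` for a tempered distribution -/

theorem tendsto_schwartz_of_le {ι : Type*} {l : Filter ι} {u : ι → 𝓢(E3, ℝ)} {f : 𝓢(E3, ℝ)}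
    {d : ι → ℝ} (hd : Tendsto d l (𝓝 0))
    (h : ∀ p n : ℕ, ∃ C : ℝ, ∀ᶠ a in l, ∀ y,
      ‖y‖ ^ p * ‖iteratedFDeriv ℝ n (u a - f : 𝓢(E3, ℝ)) y‖ ≤ C * |d a|) :
    Tendsto u l (𝓝 f) := by
  rw [(schwartz_withSeminorms ℝ E3 ℝ).tendsto_nhds]
  rintro ⟨p, n⟩ ε hε
  obtain ⟨C, hC⟩ := h p n
  have h0 : Tendsto (fun a => |C| * |d a|) l (𝓝 0) := by
    simpa using (hd.abs.const_mul |C|)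
  filter_upwards [hC, h0.eventually_lt_const hε] with a ha hlt
  refine lt_of_le_of_lt (SchwartzMap.seminorm_le_bound ℝ p n _ (by positivity) fun y => ?_) hlt
  exact (ha y).trans (mul_le_mul_of_nonneg_right (le_abs_self C) (abs_nonneg _))

/-- The mean value inequality for the $n$-th derivative between $y-a$ and $y-a_0$ bounds each
seminorm of the difference by a multiple of $|a-a_0|$, using the decay of the derivative of order
$n+1$. -/
theorem continuous_compSubConst (f : 𝓢(E3, ℝ)) :
    Continuous fun a : E3 => SchwartzMap.compSubConstCLM ℝ a f := by
  refine continuous_iff_continuousAt.2 fun a₀ => ?_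
  have hd : Tendsto (fun a : E3 => ‖a - a₀‖) (𝓝 a₀) (𝓝 0) := by
    simpa using ((continuous_id.sub continuous_const).norm.tendsto a₀ :
      Tendsto (fun a : E3 => ‖a - a₀‖) (𝓝 a₀) (𝓝 ‖a₀ - a₀‖))
  refine tendsto_schwartz_of_le hd fun p n => ?_
  obtain ⟨K, hK⟩ : ∃ K : ℝ, ∀ z, (1 + ‖z‖) ^ p * ‖iteratedFDeriv ℝ (n + 1) f z‖ ≤ K :=
    ⟨_, fun z => SchwartzMap.one_add_le_sup_seminorm_apply (𝕜 := ℝ) (m := (p, n + 1)) le_rfl le_rfl f z⟩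
  refine ⟨(2 + ‖a₀‖) ^ p * K, ?_⟩
  filter_upwards [Metric.closedBall_mem_nhds a₀ one_pos] with a ha y
  have ha1 : ‖a - a₀‖ ≤ 1 := by simpa [dist_eq_norm] using ha
  have e : ∀ b, iteratedFDeriv ℝ n (SchwartzMap.compSubConstCLM ℝ b f) y
      = iteratedFDeriv ℝ n f (y - b) := fun b =>
    congrFun (iteratedFDeriv_comp_sub' (𝕜 := ℝ) (f := f) n b) y
  have hsub : iteratedFDeriv ℝ n
      (SchwartzMap.compSubConstCLM ℝ a f - SchwartzMap.compSubConstCLM ℝ a₀ f : 𝓢(E3, ℝ)) y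
      = iteratedFDeriv ℝ n f (y - a) - iteratedFDeriv ℝ n f (y - a₀) := by
    rw [← e a, ← e a₀]
    exact iteratedFDeriv_sub_apply ((SchwartzMap.smooth _ n).contDiffAt)
      ((SchwartzMap.smooth _ n).contDiffAt)
  have hy0 : 0 < (1 + ‖y‖) ^ p := by positivity
  have hmv : ‖iteratedFDeriv ℝ n f (y - a) - iteratedFDeriv ℝ n f (y - a₀)‖
      ≤ ((2 + ‖a₀‖) ^ p * K / (1 + ‖y‖) ^ p) * ‖(y - a) - (y - a₀)‖ := by
    refine (convex_closedBall (y - a₀) 1).norm_image_sub_le_of_norm_fderiv_le (𝕜 := ℝ)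
      (fun z _ => (f.smooth (n + 1 : ℕ)).differentiable_iteratedFDeriv
        (by exact_mod_cast Nat.lt_succ_self n) z) (fun z hz => ?_)
      (Metric.mem_closedBall_self zero_le_one) (by simpa [dist_eq_norm, norm_sub_rev] using ha1)
    rw [norm_fderiv_iteratedFDeriv, le_div_iff₀ hy0]
    have hz1 : ‖z - (y - a₀)‖ ≤ 1 := by simpa [dist_eq_norm] using hz
    -- The weight at $y$ is comparable to the weight at the intermediate point $z$, which lies
    -- within distance 1 of $y-a_0$.
    have hy : 1 + ‖y‖ ≤ (2 + ‖a₀‖) * (1 + ‖z‖) := by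
      have h1 : ‖y‖ ≤ ‖z‖ + ‖z - (y - a₀)‖ + ‖a₀‖ := by
        calc ‖y‖ = ‖z - (z - (y - a₀)) + a₀‖ := by congr 1; abel
          _ ≤ _ := (norm_add_le _ _).trans (by gcongr; exact norm_sub_le _ _)
      nlinarith [norm_nonneg z, norm_nonneg a₀, mul_nonneg (norm_nonneg z) (norm_nonneg a₀)]
    calc ‖iteratedFDeriv ℝ (n + 1) f z‖ * (1 + ‖y‖) ^ p
        ≤ ‖iteratedFDeriv ℝ (n + 1) f z‖ * ((2 + ‖a₀‖) * (1 + ‖z‖)) ^ p := by gcongr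
      _ = (2 + ‖a₀‖) ^ p * ((1 + ‖z‖) ^ p * ‖iteratedFDeriv ℝ (n + 1) f z‖) := by
        rw [mul_pow]; ring
      _ ≤ _ := by gcongr; exact hK z
  rw [hsub, abs_of_nonneg (norm_nonneg _)]
  have hyp : ‖y‖ ^ p ≤ (1 + ‖y‖) ^ p := by gcongr; linarith
  calc _ ≤ (1 + ‖y‖) ^ p * (((2 + ‖a₀‖) ^ p * K / (1 + ‖y‖) ^ p) * ‖(y - a) - (y - a₀)‖) := by
        gcongr
    _ = (2 + ‖a₀‖) ^ p * K * ‖(y - a) - (y - a₀)‖ := by field_simp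
    _ = _ := by rw [sub_sub_sub_cancel_left, norm_sub_rev]

/-- Mean value inequality in the parameter $c$ of $\partial_r^i e^{-cr}$. Differentiating the
exponent costs one factor $r$; the base $1+M\ge1$ makes all powers up to $n$ comparable to the
$n$-th. -/
theorem abs_pow_mul_exp_sub_le {m M a b r : ℝ} (hm : 0 < m) (ha : a ∈ Icc m M) (hb : b ∈ Icc m M)
    (hr : 0 ≤ r) {i n : ℕ} (hi : i ≤ n) :
    |(-a) ^ i * Real.exp (-a * r) - (-b) ^ i * Real.exp (-b * r)|
      ≤ ((1 + M) ^ n * (n + 1) * ((1 + r) * Real.exp (-m * r))) * |a - b| := by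
  have hd : ∀ c ∈ Icc m M, HasDerivWithinAt (fun c => (-c) ^ i * Real.exp (-c * r))
      (i * (-c) ^ (i - 1) * (-1) * Real.exp (-c * r) + (-c) ^ i * (Real.exp (-c * r) * (-1 * r)))
      (Icc m M) c := fun c _ =>
    ((((hasDerivAt_id c).neg).pow i).mul (((hasDerivAt_id c).neg.mul_const r).exp)).hasDerivWithinAt
  refine (convex_Icc m M).norm_image_sub_le_of_norm_hasDerivWithin_le hd (fun c hc => ?_) hb ha
  have hc0 : 0 < c := hm.trans_le hc.1
  have hM : 1 ≤ 1 + M := by linarith [hc.2]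
  have hexp : Real.exp (-c * r) ≤ Real.exp (-m * r) :=
    Real.exp_le_exp.2 (by nlinarith [hc.1])
  have hpow : ∀ q, q ≤ n → |(-c) ^ q| ≤ (1 + M) ^ n := fun q hq => by
    rw [abs_pow, abs_neg, abs_of_pos hc0]
    calc c ^ q ≤ (1 + M) ^ q := by gcongr; linarith [hc.2]
      _ ≤ _ := pow_le_pow_right₀ hM hq
  have hin : (i : ℝ) ≤ n := by exact_mod_cast hi
  have h1 : |i * (-c) ^ (i - 1) * (-1) * Real.exp (-c * r)|
      ≤ n * (1 + M) ^ n * Real.exp (-m * r) := by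
    rw [abs_mul, abs_mul, abs_mul, abs_neg, abs_one, mul_one, abs_of_nonneg i.cast_nonneg,
      abs_of_pos (Real.exp_pos _)]
    gcongr
    exact hpow _ (by omega)
  have h2 : |(-c) ^ i * (Real.exp (-c * r) * (-1 * r))| ≤ (1 + M) ^ n * (Real.exp (-m * r) * r) := by
    rw [abs_mul, abs_mul, abs_mul, abs_neg, abs_one, one_mul, abs_of_nonneg hr,
      abs_of_pos (Real.exp_pos _)]
    gcongr
    exact hpow _ hi
  refine (abs_add_le _ _).trans ((add_le_add h1 h2).trans ?_)
  have h3 : 0 ≤ (1 + M) ^ n * Real.exp (-m * r) := by positivity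
  nlinarith [mul_nonneg h3 (mul_nonneg n.cast_nonneg hr : (0 : ℝ) ≤ n * r)]

/-- The Gaussian is Lipschitz in its parameter for every Schwartz seminorm: the difference is a
function of $|y|^2$ whose derivatives carry the factor $|a-b|$, and $|y|^2$ has derivatives of
polynomial growth. -/
theorem gaussian_sub_decay {m M : ℝ} (hm : 0 < m) (p n : ℕ) :
    ∃ C : ℝ, ∀ a ∈ Icc m M, ∀ b ∈ Icc m M, ∀ y : E3,
      ‖y‖ ^ p * ‖iteratedFDeriv ℝ n
        (fun y : E3 => Real.exp (-a * ‖y‖ ^ 2) - Real.exp (-b * ‖y‖ ^ 2)) y‖ ≤ C * |a - b| := by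
  have hf : Function.HasTemperateGrowth (fun y : E3 => ‖y‖ ^ 2) :=
    Function.hasTemperateGrowth_norm_sq E3
  obtain ⟨k, K, hK0, hK⟩ := hf.norm_iteratedFDeriv_le_uniform n
  -- The exponent collects `p` from the seminorm, 2 from the factor $1+|y|^2$, and `k * n` from the
  -- bound for the composition.
  obtain ⟨C, hC⟩ := gaussian_poly_bound hm (p + 2 + k * n)
  refine ⟨n.factorial * (1 + K) ^ n * ((1 + M) ^ n * (n + 1)) * C, fun a ha b hb y => ?_⟩
  have hM : 0 < 1 + M := by linarith [ha.1, ha.2]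
  have hone : (1 : ℝ) ≤ 1 + ‖y‖ := by linarith [norm_nonneg y]
  have hbase : (1 : ℝ) ≤ (1 + K) * (1 + ‖y‖) ^ k := by
    have := one_le_pow₀ hone (n := k)
    nlinarith
  have hsm : ∀ c : ℝ, ContDiff ℝ ∞ fun r : ℝ => Real.exp (-c * r) := fun c =>
    Real.contDiff_exp.comp (contDiff_const.mul contDiff_id)
  have hder : ∀ (i : ℕ) (c r : ℝ), iteratedDeriv i (fun r : ℝ => Real.exp (-c * r)) r
      = (-c) ^ i * Real.exp (-c * r) := fun i c r =>
    congrFun (iteratedDeriv_exp_const_mul i (-c)) r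
  have hcomp := norm_iteratedFDeriv_comp_le (𝕜 := ℝ)
    (g := fun r => Real.exp (-a * r) - Real.exp (-b * r))
    (f := fun y : E3 => ‖y‖ ^ 2) (n := n) (N := (n : ℕ∞))
    (((hsm a).sub (hsm b)).of_le (by exact_mod_cast le_top))
    (hf.1.of_le (by exact_mod_cast le_top)) le_rfl y
    (C := ((1 + M) ^ n * (n + 1) * ((1 + ‖y‖ ^ 2) * Real.exp (-m * ‖y‖ ^ 2))) * |a - b|)
    (D := (1 + K) * (1 + ‖y‖) ^ k)
    (fun i hi => by
      rw [norm_iteratedFDeriv_eq_norm_iteratedDeriv,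
        iteratedDeriv_fun_sub ((hsm a).of_le (by exact_mod_cast le_top)).contDiffAt
          ((hsm b).of_le (by exact_mod_cast le_top)).contDiffAt, hder, hder]
      exact abs_pow_mul_exp_sub_le hm ha hb (by positivity) hi)
    (fun i hi hin => by
      calc ‖iteratedFDeriv ℝ i (fun y : E3 => ‖y‖ ^ 2) y‖
          ≤ K * (1 + ‖y‖) ^ k := hK i hin y
        _ ≤ (1 + K) * (1 + ‖y‖) ^ k := by gcongr; linarith
        _ ≤ _ := le_self_pow₀ hbase (by omega))
  have hyp : ‖y‖ ^ p ≤ (1 + ‖y‖) ^ p := by gcongr; linarith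
  have hy2 : 1 + ‖y‖ ^ 2 ≤ (1 + ‖y‖) ^ 2 := by nlinarith [norm_nonneg y]
  calc _ ≤ (1 + ‖y‖) ^ p * (n.factorial * (((1 + M) ^ n * (n + 1) * ((1 + ‖y‖) ^ 2 *
          Real.exp (-m * ‖y‖ ^ 2))) * |a - b|) * ((1 + K) * (1 + ‖y‖) ^ k) ^ n) := by
        refine mul_le_mul hyp (hcomp.trans ?_) (norm_nonneg _) (by positivity)
        gcongr
    _ = n.factorial * (1 + K) ^ n * ((1 + M) ^ n * (n + 1)) *
          ((1 + ‖y‖) ^ (p + 2 + k * n) * Real.exp (-m * ‖y‖ ^ 2)) * |a - b| := by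
        rw [mul_pow, ← pow_mul, pow_add, pow_add]; ring
    _ ≤ _ := by gcongr; exact hC _ (norm_nonneg y)

/-- The Gaussian as a Schwartz function, `0` for a nonpositive parameter. -/
def gaussianSchwartzExt (a : ℝ) : 𝓢(E3, ℝ) := if ha : 0 < a then gaussianSchwartz a ha else 0

theorem continuousAt_gaussianSchwartzExt {a₀ : ℝ} (h0 : 0 < a₀) :
    ContinuousAt gaussianSchwartzExt a₀ := by
  have hd : Tendsto (fun a : ℝ => a - a₀) (𝓝 a₀) (𝓝 0) := by
    simpa using (continuous_sub_right a₀).tendsto a₀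
  refine tendsto_schwartz_of_le hd fun p n => ?_
  obtain ⟨C, hC⟩ := gaussian_sub_decay (m := a₀ / 2) (M := 2 * a₀) (by linarith) p n
  refine ⟨C, ?_⟩
  filter_upwards [Icc_mem_nhds (show a₀ / 2 < a₀ by linarith) (show a₀ < 2 * a₀ by linarith)]
    with a ha y
  have ha0 : 0 < a := by linarith [ha.1]
  rw [gaussianSchwartzExt, gaussianSchwartzExt, dif_pos ha0, dif_pos h0]
  exact hC a ha a₀ ⟨by linarith, by linarith⟩ y

theorem continuousOn_heatSchwartz : ContinuousOn heatSchwartz (Ioi 0) := by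
  intro t (ht : 0 < t)
  refine ContinuousAt.continuousWithinAt ?_
  have h : ContinuousAt (fun t : ℝ =>
      (4 * Real.pi * t) ^ (-(3 / 2) : ℝ) • gaussianSchwartzExt (1 / (4 * t))) t := by
    have h1 : ContinuousAt (fun t : ℝ => (4 * Real.pi * t) ^ (-(3 / 2) : ℝ)) t :=
      ContinuousAt.rpow_const (by fun_prop) (Or.inl (by positivity))
    have h2 : ContinuousAt (fun t : ℝ => gaussianSchwartzExt (1 / (4 * t))) t :=
      ContinuousAt.comp (f := fun t : ℝ => 1 / (4 * t))
        (continuousAt_gaussianSchwartzExt (by positivity))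
        (continuousAt_const.div (by fun_prop) (by positivity))
    exact h1.smul h2
  refine h.congr ?_
  filter_upwards [lt_mem_nhds ht] with r hr
  rw [heatSchwartz, dif_pos hr, gaussianSchwartzExt, dif_pos (by positivity)]

/-- A distribution offers no integral formula to which Fubini applies. Joint measurability comes
instead from continuity in `x` for fixed `t` and measurability in `t` for fixed `x`, where the value
is 0 for `t ≤ 0`. -/
theorem measurable_heatFlowDistr (θ₀ : RealTempered) :
    Measurable fun p : ℝ × E3 => heatFlowDistr θ₀ p.1 p.2 := by
  have h : Measurable (Function.uncurry fun (x : E3) (t : ℝ) => heatFlowDistr θ₀ t x) := by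
    refine measurable_uncurry_of_continuous_of_measurable
      (u := fun (x : E3) (t : ℝ) => heatFlowDistr θ₀ t x) (fun t => ?_) fun x => ?_
    · exact θ₀.continuous.comp (continuous_compSubConst (heatSchwartz t))
    · have hc : ContinuousOn (fun t => heatFlowDistr θ₀ t x) (Ioi 0) :=
        (θ₀.continuous.comp (SchwartzMap.compSubConstCLM ℝ x).continuous).comp_continuousOn
          continuousOn_heatSchwartz
      classical
      have hp := hc.measurable_piecewise (g := fun _ => 0) continuousOn_const measurableSet_Ioi
      refine (congrArg Measurable (funext fun t => ?_)).mpr hp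
      by_cases ht : t ∈ Ioi (0 : ℝ)
      · rw [piecewise_eq_of_mem _ _ _ ht]
      · rw [piecewise_eq_of_notMem _ _ _ ht, heatFlowDistr, heatSchwartz, dif_neg (show ¬ 0 < t from ht),
          map_zero, map_zero]
  have h2 := h.comp (measurable_swap (α := ℝ) (β := E3))
  exact h2

/-! ### Space-time integrals of the parabolic weights -/

/-- The constant `∫ (1 + |x|)⁻⁴ dx`. -/
def weightConst : ℝ := ∫ x : E3, ((1 + ‖x‖) ^ 4)⁻¹

theorem weightConst_nonneg : 0 ≤ weightConst := integral_nonneg fun x => by positivity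

theorem integrable_one_add_norm_inv_pow_four :
    Integrable (fun x : E3 => ((1 + ‖x‖) ^ 4)⁻¹) volume := by
  have h := integrable_one_add_norm (E := E3) (μ := volume) (r := 4) (by simp; norm_num)
  refine h.congr (Eventually.of_forall fun x => ?_)
  simp only
  rw [Real.rpow_neg (by positivity)]
  norm_cast

theorem weight_scaling {σ : ℝ} (hσ : 0 < σ) (x : E3) :
    ((σ + ‖x‖) ^ 4)⁻¹ = (σ ^ 4)⁻¹ * ((1 + ‖σ⁻¹ • x‖) ^ 4)⁻¹ := by
  rw [norm_smul, Real.norm_of_nonneg (by positivity), ← mul_inv, ← mul_pow]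
  congr 2
  field_simp

theorem integrable_weight {σ : ℝ} (hσ : 0 < σ) :
    Integrable (fun x : E3 => ((σ + ‖x‖) ^ 4)⁻¹) volume := by
  simp only [weight_scaling hσ]
  exact (integrable_one_add_norm_inv_pow_four.comp_smul (inv_ne_zero hσ.ne')).const_mul _

theorem integral_weight {σ : ℝ} (hσ : 0 < σ) :
    ∫ x : E3, ((σ + ‖x‖) ^ 4)⁻¹ = weightConst * σ⁻¹ := by
  simp only [weight_scaling hσ]
  rw [integral_const_mul,
    Measure.integral_comp_smul volume (fun x : E3 => ((1 + ‖x‖) ^ 4)⁻¹) σ⁻¹]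
  simp only [finrank_euclideanSpace, Fintype.card_fin, smul_eq_mul, weightConst]
  rw [abs_of_pos (by positivity)]
  field_simp

theorem integrable_weight_sub {σ : ℝ} (hσ : 0 < σ) (x : E3) :
    Integrable (fun y : E3 => ((σ + ‖x - y‖) ^ 4)⁻¹) volume :=
  (integrable_weight hσ).comp_sub_left x

theorem integral_weight_sub {σ : ℝ} (hσ : 0 < σ) (x : E3) :
    ∫ y : E3, ((σ + ‖x - y‖) ^ 4)⁻¹ = weightConst * σ⁻¹ := by
  rw [← integral_weight hσ]
  exact integral_sub_left_eq_self (fun y : E3 => ((σ + ‖y‖) ^ 4)⁻¹) volume x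

theorem inv_sqrt_eq_rpow {s : ℝ} (hs : 0 ≤ s) : (√s)⁻¹ = s ^ (-(1 / 2) : ℝ) := by
  rw [Real.sqrt_eq_rpow, Real.rpow_neg hs]

theorem integral_inv_sqrt {t : ℝ} (ht : 0 < t) :
    IntegrableOn (fun s => (√s)⁻¹) (Ioo 0 t) ∧ ∫ s in Ioo 0 t, (√s)⁻¹ = 2 * √t := by
  have e : EqOn (fun s => (√s)⁻¹) (fun s => s ^ (-(1 / 2) : ℝ)) (Ioo 0 t) :=
    fun s hs => inv_sqrt_eq_rpow hs.1.le
  have h : IntervalIntegrable (fun s : ℝ => s ^ (-(1 / 2) : ℝ)) volume 0 t :=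
    intervalIntegral.intervalIntegrable_rpow' (by norm_num)
  have h1 : IntegrableOn (fun s : ℝ => s ^ (-(1 / 2) : ℝ)) (Ioo 0 t) :=
    ((intervalIntegrable_iff_integrableOn_Ioc_of_le ht.le).1 h).mono_set Ioo_subset_Ioc_self
  refine ⟨h1.congr_fun e.symm measurableSet_Ioo, ?_⟩
  rw [setIntegral_congr_fun measurableSet_Ioo e, ← integral_Ioc_eq_integral_Ioo,
    ← intervalIntegral.integral_of_le ht.le, integral_rpow (Or.inl (by norm_num)),
    Real.sqrt_eq_rpow]
  norm_num
  ring

theorem integral_inv_sqrt_sub {t : ℝ} (ht : 0 < t) :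
    IntegrableOn (fun s => (√(t - s))⁻¹) (Ioo 0 t) ∧ ∫ s in Ioo 0 t, (√(t - s))⁻¹ = 2 * √t := by
  obtain ⟨h1, h2⟩ := integral_inv_sqrt ht
  have hI : IntervalIntegrable (fun s => (√s)⁻¹) volume 0 t := by
    rw [intervalIntegrable_iff_integrableOn_Ioc_of_le ht.le, integrableOn_Ioc_iff_integrableOn_Ioo]
    exact h1
  constructor
  · have := (hI.comp_sub_left t).symm
    simp only [sub_self, sub_zero] at this
    rwa [intervalIntegrable_iff_integrableOn_Ioc_of_le ht.le,
      integrableOn_Ioc_iff_integrableOn_Ioo] at this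
  · have := intervalIntegral.integral_comp_sub_left (a := 0) (b := t) (fun s => (√s)⁻¹) t
    rw [sub_self, sub_zero, intervalIntegral.integral_of_le ht.le,
      intervalIntegral.integral_of_le ht.le, integral_Ioc_eq_integral_Ioo,
      integral_Ioc_eq_integral_Ioo, h2] at this
    exact this

/-- Lebesgue measure on `(0,∞) × ℝ³`. -/
abbrev spaceTime : Measure (ℝ × E3) := volume.restrict (Ioi (0 : ℝ) ×ˢ univ)

/-- Lebesgue measure on `(0,t) × ℝ³`. -/
def slab (t : ℝ) : Measure (ℝ × E3) := (volume.restrict (Ioo 0 t)).prod volume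

instance (t : ℝ) : SFinite (slab t) := by unfold slab; infer_instance

theorem slab_eq (t : ℝ) : slab t = spaceTime.restrict {q | q.1 < t} := by
  have h : {q : ℝ × E3 | q.1 < t} ∩ Ioi (0 : ℝ) ×ˢ univ = Ioo 0 t ×ˢ univ := by
    ext q
    simp only [mem_inter_iff, mem_ofPred_eq, mem_prod, mem_univ, and_true, mem_Ioi, mem_Ioo]
    tauto
  rw [Measure.restrict_restrict (measurableSet_lt measurable_fst measurable_const), h, slab,
    Measure.volume_eq_prod, ← Measure.prod_restrict, Measure.restrict_univ]

theorem ae_slab (t : ℝ) : ∀ᵐ q ∂slab t, 0 < q.1 ∧ q.1 < t := by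
  rw [slab_eq]
  filter_upwards [ae_restrict_mem (measurableSet_lt measurable_fst measurable_const),
    ae_restrict_of_ae (ae_restrict_mem (measurableSet_Ioi.prod MeasurableSet.univ))] with q h1 h2
  exact ⟨h2.1, h1⟩

theorem integrable_slab {f : ℝ × E3 → ℝ} {g : ℝ → ℝ} {t : ℝ} (hm : Measurable f)
    (h0 : ∀ q, 0 ≤ f q) (hi : ∀ s ∈ Ioo 0 t, Integrable (fun y => f (s, y)) volume)
    (he : ∀ s ∈ Ioo 0 t, ∫ y, f (s, y) = g s) (hg : IntegrableOn g (Ioo 0 t)) :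
    Integrable f (slab t) ∧ ∫ q, f q ∂slab t = ∫ s in Ioo 0 t, g s := by
  have hint : Integrable f (slab t) := by
    refine (integrable_prod_iff hm.aestronglyMeasurable).2 ⟨?_, ?_⟩
    · filter_upwards [ae_restrict_mem measurableSet_Ioo] with s hs using hi s hs
    · refine hg.congr ?_
      filter_upwards [ae_restrict_mem measurableSet_Ioo] with s hs
      rw [← he s hs]
      exact integral_congr_ae (Eventually.of_forall fun y => (Real.norm_of_nonneg (h0 _)).symm)
  refine ⟨hint, (integral_prod f hint).trans ?_⟩
  exact setIntegral_congr_fun measurableSet_Ioo he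

/-- The parabolic dimension 5 exceeds the exponent 4, so the singularity is integrable: the space
integral is a multiple of $s^{-1/2}$, whose time integral is $2\sqrt t$. -/
theorem integrable_slab_forward {t : ℝ} (ht : 0 < t) :
    Integrable (fun q : ℝ × E3 => ((√q.1 + ‖q.2‖) ^ 4)⁻¹) (slab t) ∧
      ∫ q, ((√q.1 + ‖q.2‖) ^ 4)⁻¹ ∂slab t = 2 * weightConst * √t := by
  obtain ⟨h1, h2⟩ := integral_inv_sqrt ht
  have h := integrable_slab (f := fun q : ℝ × E3 => ((√q.1 + ‖q.2‖) ^ 4)⁻¹) (t := t) (by fun_prop)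
    (fun q => by positivity) (fun s hs => integrable_weight (Real.sqrt_pos.2 hs.1))
    (fun s hs => integral_weight (Real.sqrt_pos.2 hs.1)) (h1.const_mul _)
  refine ⟨h.1, h.2.trans ?_⟩
  rw [integral_const_mul, h2]
  ring

theorem integrable_slab_backward {t : ℝ} (ht : 0 < t) (x : E3) :
    Integrable (fun q : ℝ × E3 => ((√(t - q.1) + ‖x - q.2‖) ^ 4)⁻¹) (slab t) ∧
      ∫ q, ((√(t - q.1) + ‖x - q.2‖) ^ 4)⁻¹ ∂slab t = 2 * weightConst * √t := by
  obtain ⟨h1, h2⟩ := integral_inv_sqrt_sub ht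
  have h := integrable_slab (f := fun q : ℝ × E3 => ((√(t - q.1) + ‖x - q.2‖) ^ 4)⁻¹) (t := t)
    (by fun_prop) (fun q => by positivity)
    (fun s hs => integrable_weight_sub (Real.sqrt_pos.2 (sub_pos.2 hs.2)) x)
    (fun s hs => integral_weight_sub (Real.sqrt_pos.2 (sub_pos.2 hs.2)) x) (h1.const_mul _)
  refine ⟨h.1, h.2.trans ?_⟩
  rw [integral_const_mul, h2]
  ring

/-- The larger of `A`, `B` is at least `R / 2`. If it is `B`, then $B^{-p}$ is traded for $R^{-p}$.
If it is `A`, then $p$ of its four powers are traded and the remaining $A^{-(4-p)}$ is at most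
$B^{-(4-p)}$. The constant is $2^4\ge2^p$. -/
theorem inv_pow_mul_inv_pow_le {A B R : ℝ} {p : ℕ} (hA : 0 < A) (hB : 0 < B) (hR : 0 < R)
    (h : R ≤ A + B) (hp : p ≤ 4) :
    (A ^ 4)⁻¹ * (B ^ p)⁻¹ ≤ 16 * (R ^ p)⁻¹ * ((A ^ 4)⁻¹ + (B ^ 4)⁻¹) := by
  have key : ∀ m : ℝ, R / 2 ≤ m → (m ^ p)⁻¹ ≤ 16 * (R ^ p)⁻¹ := fun m hm => by
    calc (m ^ p)⁻¹ ≤ ((R / 2) ^ p)⁻¹ := by gcongr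
      _ = 2 ^ p * (R ^ p)⁻¹ := by rw [div_pow]; field_simp
      _ ≤ 2 ^ 4 * (R ^ p)⁻¹ := by gcongr; norm_num
      _ = _ := by norm_num
  have hR' : 0 ≤ 16 * (R ^ p)⁻¹ := by positivity
  rcases le_total A B with hAB | hAB
  · have h1 := key B (by linarith)
    calc (A ^ 4)⁻¹ * (B ^ p)⁻¹ ≤ (A ^ 4)⁻¹ * (16 * (R ^ p)⁻¹) := by gcongr
      _ = 16 * (R ^ p)⁻¹ * (A ^ 4)⁻¹ := by ring
      _ ≤ _ := by gcongr; linarith [(by positivity : 0 ≤ (B ^ 4)⁻¹)]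
  · have h1 := key A (by linarith)
    have e : ∀ m : ℝ, (m ^ 4)⁻¹ = (m ^ p)⁻¹ * (m ^ (4 - p))⁻¹ := fun m => by
      rw [← mul_inv, ← pow_add, Nat.add_sub_cancel' hp]
    calc (A ^ 4)⁻¹ * (B ^ p)⁻¹ = (A ^ p)⁻¹ * (A ^ (4 - p))⁻¹ * (B ^ p)⁻¹ := by rw [e A]
      _ ≤ 16 * (R ^ p)⁻¹ * (B ^ (4 - p))⁻¹ * (B ^ p)⁻¹ := by gcongr
      _ = 16 * (R ^ p)⁻¹ * (B ^ 4)⁻¹ := by rw [e B]; ring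
      _ ≤ _ := by gcongr; linarith [(by positivity : 0 ≤ (A ^ 4)⁻¹)]

theorem parabolic_triangle {s t : ℝ} (hs : 0 ≤ s) (hst : s ≤ t) (x y : E3) :
    √t + ‖x‖ ≤ (√(t - s) + ‖x - y‖) + (√s + ‖y‖) := by
  have h1 : √t ≤ √(t - s) + √s := by
    refine Real.sqrt_le_iff.2 ⟨by positivity, ?_⟩
    nlinarith [Real.sq_sqrt hs, Real.sq_sqrt (sub_nonneg.2 hst),
      mul_nonneg (Real.sqrt_nonneg (t - s)) (Real.sqrt_nonneg s)]
  have h2 : ‖x‖ ≤ ‖x - y‖ + ‖y‖ := by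
    simpa using norm_add_le (x - y) y
  linarith

/-! ### Duhamel operators -/

/-- `|K(τ,z)| ≤ c (√τ + |z|)⁻⁴` for `0 < τ < t`. -/
def KernelBound (K : ℝ → E3 → ℝ) (t c : ℝ) : Prop :=
  ∀ τ, 0 < τ → τ < t → ∀ z, |K τ z| ≤ c * ((√τ + ‖z‖) ^ 4)⁻¹

/-- `|F(s,y)| ≤ D (√s + |y|)⁻ᵖ` for `s > 0`. -/
def DecayBound (p : ℕ) (F : ℝ → E3 → ℝ) (D : ℝ) : Prop :=
  ∀ s, 0 < s → ∀ y, |F s y| ≤ D * ((√s + ‖y‖) ^ p)⁻¹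

/-- The space-time convolution `∫₀ᵗ ∫ K(t-s,x-y) F(s,y) dy ds`. -/
def duhamel (K F : ℝ → E3 → ℝ) (t : ℝ) (x : E3) : ℝ :=
  ∫ q, K (t - q.1) (x - q.2) * F q.1 q.2 ∂slab t

theorem duhamel_integrand_le {K F : ℝ → E3 → ℝ} {p : ℕ} {t c D : ℝ} (ht : 0 < t) (hp : p ≤ 4)
    (hc : 0 ≤ c) (hD : 0 ≤ D) (hK : KernelBound K t c) (hF : DecayBound p F D) (x : E3)
    {q : ℝ × E3} (hq : 0 < q.1 ∧ q.1 < t) :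
    |K (t - q.1) (x - q.2) * F q.1 q.2| ≤ c * D * (16 * ((√t + ‖x‖) ^ p)⁻¹) *
      (((√(t - q.1) + ‖x - q.2‖) ^ 4)⁻¹ + ((√q.1 + ‖q.2‖) ^ 4)⁻¹) := by
  have h1 := hK (t - q.1) (by linarith [hq.2]) (by linarith [hq.1]) (x - q.2)
  have h2 := hF q.1 hq.1 q.2
  have hs : 0 < √q.1 := Real.sqrt_pos.2 hq.1
  have hτ : 0 < √(t - q.1) := Real.sqrt_pos.2 (by linarith [hq.2])
  have hR : 0 < √t := Real.sqrt_pos.2 ht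
  have h3 := inv_pow_mul_inv_pow_le (A := √(t - q.1) + ‖x - q.2‖) (B := √q.1 + ‖q.2‖)
    (R := √t + ‖x‖) (by positivity) (by positivity) (by positivity)
    (parabolic_triangle hq.1.le hq.2.le x q.2) hp
  rw [abs_mul]
  calc _ ≤ (c * ((√(t - q.1) + ‖x - q.2‖) ^ 4)⁻¹) * (D * ((√q.1 + ‖q.2‖) ^ p)⁻¹) :=
        mul_le_mul h1 h2 (abs_nonneg _) (by positivity)
    _ = c * D * (((√(t - q.1) + ‖x - q.2‖) ^ 4)⁻¹ * ((√q.1 + ‖q.2‖) ^ p)⁻¹) := by ring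
    _ ≤ c * D * (16 * ((√t + ‖x‖) ^ p)⁻¹ *
      (((√(t - q.1) + ‖x - q.2‖) ^ 4)⁻¹ + ((√q.1 + ‖q.2‖) ^ 4)⁻¹)) := by gcongr
    _ = _ := by ring

theorem aestronglyMeasurable_duhamel_integrand {K F : ℝ → E3 → ℝ}
    (hKm : Measurable fun p : ℝ × E3 => K p.1 p.2)
    (hFm : AEStronglyMeasurable (Function.uncurry F) spaceTime) (t : ℝ) (x : E3) :
    AEStronglyMeasurable (fun q : ℝ × E3 => K (t - q.1) (x - q.2) * F q.1 q.2) (slab t) := by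
  refine AEStronglyMeasurable.mul ?_ ?_
  · exact (hKm.comp (g := fun p : ℝ × E3 => K p.1 p.2) (f := fun q : ℝ × E3 => (t - q.1, x - q.2))
      (by fun_prop)).aestronglyMeasurable
  · rw [slab_eq]
    exact hFm.mono_measure Measure.restrict_le_self

theorem integrable_duhamel {K F : ℝ → E3 → ℝ} {p : ℕ} {t c D : ℝ} (ht : 0 < t) (hp : p ≤ 4)
    (hc : 0 ≤ c) (hD : 0 ≤ D) (hKm : Measurable fun p : ℝ × E3 => K p.1 p.2)
    (hFm : AEStronglyMeasurable (Function.uncurry F) spaceTime)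
    (hK : KernelBound K t c) (hF : DecayBound p F D) (x : E3) :
    Integrable (fun q : ℝ × E3 => K (t - q.1) (x - q.2) * F q.1 q.2) (slab t) := by
  refine Integrable.mono' (((integrable_slab_backward ht x).1.add
    (integrable_slab_forward ht).1).const_mul (c * D * (16 * ((√t + ‖x‖) ^ p)⁻¹)))
    (aestronglyMeasurable_duhamel_integrand hKm hFm t x) ?_
  filter_upwards [ae_slab t] with q hq
  exact duhamel_integrand_le ht hp hc hD hK hF x hq

/-- The one estimate behind all three quadratic terms. The constant 64 is 16 from
`inv_pow_mul_inv_pow_le` times 2 + 2 from the two slab integrals. -/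
theorem abs_duhamel_le {K F : ℝ → E3 → ℝ} {p : ℕ} {t c D : ℝ} (ht : 0 < t) (hp : p ≤ 4)
    (hc : 0 ≤ c) (hD : 0 ≤ D) (hK : KernelBound K t c) (hF : DecayBound p F D) (x : E3) :
    |duhamel K F t x| ≤ 64 * weightConst * c * D * √t * ((√t + ‖x‖) ^ p)⁻¹ := by
  have hb := integrable_slab_backward ht x
  have hf := integrable_slab_forward (t := t) ht
  have h := norm_integral_le_of_norm_le (μ := slab t)
    (f := fun q : ℝ × E3 => K (t - q.1) (x - q.2) * F q.1 q.2)
    ((hb.1.add hf.1).const_mul (c * D * (16 * ((√t + ‖x‖) ^ p)⁻¹))) (by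
      filter_upwards [ae_slab t] with q hq
      exact duhamel_integrand_le ht hp hc hD hK hF x hq)
  refine h.trans (le_of_eq ?_)
  rw [integral_const_mul]
  simp only [Pi.add_apply]
  rw [integral_add hb.1 hf.1, hb.2, hf.2]
  ring

/-- The time-dependent slab becomes an indicator under a fixed measure, so that measurability in
$(t,x)$ follows from that of parametric integrals. -/
theorem duhamel_eq_integral_spaceTime (K F : ℝ → E3 → ℝ) (t : ℝ) (x : E3) :
    duhamel K F t x = ∫ q, {q : ℝ × E3 | q.1 < t}.indicator
      (fun q => K (t - q.1) (x - q.2) * F q.1 q.2) q ∂spaceTime := by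
  rw [integral_indicator (measurableSet_lt measurable_fst measurable_const), ← slab_eq, duhamel]

theorem aestronglyMeasurable_duhamel {P : Type*} [MeasurableSpace P] {μ : Measure P} [SFinite μ]
    {K F : ℝ → E3 → ℝ} (hKm : Measurable fun p : ℝ × E3 => K p.1 p.2)
    (hFm : AEStronglyMeasurable (Function.uncurry F) spaceTime) {T : P → ℝ} {X : P → E3}
    (hT : Measurable T) (hX : Measurable X) :
    AEStronglyMeasurable (fun p => duhamel K F (T p) (X p)) μ := by
  simp only [duhamel_eq_integral_spaceTime]
  have h : AEStronglyMeasurable (fun z : P × (ℝ × E3) => {z : P × (ℝ × E3) | z.2.1 < T z.1}.indicator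
      (fun z => K (T z.1 - z.2.1) (X z.1 - z.2.2) * F z.2.1 z.2.2) z) (μ.prod spaceTime) := by
    refine AEStronglyMeasurable.indicator ?_ (measurableSet_lt (by fun_prop) (by fun_prop))
    refine AEStronglyMeasurable.mul ?_ ?_
    · exact (hKm.comp (g := fun p : ℝ × E3 => K p.1 p.2)
        (f := fun z : P × (ℝ × E3) => (T z.1 - z.2.1, X z.1 - z.2.2))
        (by fun_prop)).aestronglyMeasurable
    · exact hFm.comp_snd
  exact h.integral_prod_right'

theorem duhamel_sub {K F G : ℝ → E3 → ℝ} {p : ℕ} {t c D D' : ℝ} (ht : 0 < t) (hp : p ≤ 4)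
    (hc : 0 ≤ c) (hD : 0 ≤ D) (hD' : 0 ≤ D') (hKm : Measurable fun p : ℝ × E3 => K p.1 p.2)
    (hFm : AEStronglyMeasurable (Function.uncurry F) spaceTime)
    (hGm : AEStronglyMeasurable (Function.uncurry G) spaceTime)
    (hK : KernelBound K t c) (hF : DecayBound p F D) (hG : DecayBound p G D') (x : E3) :
    duhamel K F t x - duhamel K G t x = duhamel K (fun s y => F s y - G s y) t x := by
  rw [duhamel, duhamel, ← integral_sub (integrable_duhamel ht hp hc hD hKm hFm hK hF x)
    (integrable_duhamel ht hp hc hD' hKm hGm hK hG x)]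
  simp only [duhamel, mul_sub]

/-! ### Bounded solenoidal fields -/

/-- Bounded measurable fields that are divergence-free in the sense of distributions. -/
def BoundedSolenoidal (v : E3 → E3) : Prop :=
  AEStronglyMeasurable v volume ∧ (∃ C, ∀ x, ‖v x‖ ≤ C) ∧ IsDivFree v

theorem integrable_fderiv_apply {v : E3 → E3} (hm : AEStronglyMeasurable v volume) {C : ℝ}
    (hb : ∀ x, ‖v x‖ ≤ C) {φ : E3 → ℝ} (hφ : ContDiff ℝ ∞ φ) (hc : HasCompactSupport φ) :
    Integrable (fun x => fderiv ℝ φ x (v x)) volume := by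
  simp only [fderiv_apply_eq_sum_pd]
  refine integrable_finsetSum _ fun k _ => ?_
  simp only [mul_comm (v _ k)]
  exact integrable_mul_of_bound (contDiff_pd hφ k).continuous (hasCompactSupport_pd hc k)
    ((EuclideanSpace.proj k : E3 →L[ℝ] ℝ).continuous.comp_aestronglyMeasurable hm)
    fun x => (norm_apply_le _ k).trans (hb x)

/-- Measurability and boundedness make the pairings with test functions integrable; without
integrability the condition `IsDivFree` would not be additive. -/
theorem BoundedSolenoidal.add {v w : E3 → E3} (hv : BoundedSolenoidal v)
    (hw : BoundedSolenoidal w) : BoundedSolenoidal fun x => v x + w x := by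
  obtain ⟨hvm, ⟨C, hC⟩, hvd⟩ := hv
  obtain ⟨hwm, ⟨C', hC'⟩, hwd⟩ := hw
  refine ⟨hvm.add hwm, ⟨C + C', fun x => (norm_add_le _ _).trans (add_le_add (hC x) (hC' x))⟩,
    fun φ hφ hc => ?_⟩
  simp only [map_add]
  rw [integral_add (integrable_fderiv_apply hvm hC hφ hc) (integrable_fderiv_apply hwm hC' hφ hc),
    hvd φ hφ hc, hwd φ hφ hc, add_zero]

theorem BoundedSolenoidal.smul {v : E3 → E3} (hv : BoundedSolenoidal v) (a : ℝ) :
    BoundedSolenoidal fun x => a • v x := by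
  obtain ⟨hvm, ⟨C, hC⟩, hvd⟩ := hv
  refine ⟨hvm.const_smul a, ⟨|a| * C, fun x => ?_⟩, fun φ hφ hc => ?_⟩
  · rw [norm_smul]
    exact mul_le_mul_of_nonneg_left (hC x) (abs_nonneg a)
  · simp only [map_smul, integral_smul, hvd φ hφ hc, smul_zero]

theorem BoundedSolenoidal.zero : BoundedSolenoidal fun _ => 0 :=
  ⟨aestronglyMeasurable_const, ⟨0, by simp⟩, fun φ _ _ => by simp⟩

theorem BoundedSolenoidal.sum {ι : Type*} (s : Finset ι) {v : ι → E3 → E3}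
    (hv : ∀ i ∈ s, BoundedSolenoidal (v i)) : BoundedSolenoidal fun x => ∑ i ∈ s, v i x := by
  classical
  induction s using Finset.induction_on with
  | empty => simpa using BoundedSolenoidal.zero
  | insert i s hi ih =>
    simp only [Finset.sum_insert hi]
    exact (hv i (Finset.mem_insert_self i s)).add
      (ih fun j hj => hv j (Finset.mem_insert_of_mem hj))

theorem aestronglyMeasurable_toLp {P : Type*} [MeasurableSpace P] {μ : Measure P}
    {f : Fin 3 → P → ℝ} (hf : ∀ j, AEStronglyMeasurable (f j) μ) :
    AEStronglyMeasurable (fun p => (WithLp.toLp 2 fun j => f j p : E3)) μ := by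
  have h : AEStronglyMeasurable (fun p j => f j p) μ :=
    (aemeasurable_pi_lambda _ fun j => (hf j).aemeasurable).aestronglyMeasurable
  exact (PiLp.continuous_toLp 2 fun _ : Fin 3 => ℝ).comp_aestronglyMeasurable h

theorem norm_toLp_le {f : Fin 3 → ℝ} {C : ℝ} (hf : ∀ j, |f j| ≤ C) :
    ‖(WithLp.toLp 2 f : E3)‖ ≤ 3 * C := by
  refine (norm_le_sum_abs _).trans ((Finset.sum_le_sum fun j _ => hf j).trans ?_)
  simp

/-- After Fubini the integral in `x` is taken first, and `hdiv` makes it vanish for every fixed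
source point. -/
theorem boundedSolenoidal_duhamel {K : Fin 3 → ℝ → E3 → ℝ} {F : ℝ → E3 → ℝ} {p : ℕ} {t c D : ℝ}
    (ht : 0 < t) (hp : p ≤ 4) (hc : 0 ≤ c) (hD : 0 ≤ D)
    (hKm : ∀ j, Measurable fun p : ℝ × E3 => K j p.1 p.2)
    (hFm : AEStronglyMeasurable (Function.uncurry F) spaceTime)
    (hK : ∀ j, KernelBound (K j) t c) (hF : DecayBound p F D)
    (hdiv : ∀ φ : E3 → ℝ, ContDiff ℝ ∞ φ → HasCompactSupport φ → ∀ τ, 0 < τ → ∀ y,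
      ∫ x, ∑ j, pd j φ x * K j τ (x - y) = 0) :
    BoundedSolenoidal fun x => WithLp.toLp 2 fun j => duhamel (K j) F t x := by
  have hσ : 0 < √t := Real.sqrt_pos.2 ht
  have hw := weightConst_nonneg
  refine ⟨aestronglyMeasurable_toLp fun j =>
    aestronglyMeasurable_duhamel (hKm j) hFm measurable_const measurable_id,
    ⟨3 * (64 * weightConst * c * D * √t * (√t ^ p)⁻¹), fun x => norm_toLp_le fun j =>
      (abs_duhamel_le ht hp hc hD (hK j) hF x).trans
        (mul_le_mul_of_nonneg_left (inv_pow_add_le ht p x) (by positivity))⟩,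
    fun φ hφ hφc => ?_⟩
  set f : E3 → ℝ × E3 → ℝ := fun x q =>
    (∑ j, pd j φ x * K j (t - q.1) (x - q.2)) * F q.1 q.2 with hf
  set g : E3 → ℝ := fun x => ∑ j, |pd j φ x| with hg
  have hgi : Integrable g volume := integrable_finsetSum _ fun j _ =>
    ((contDiff_pd hφ j).continuous.integrable_of_hasCompactSupport
      (hasCompactSupport_pd hφc j)).abs
  -- Majorant for Fubini: the compactly supported `g` gives integrability in `x`, and the two
  -- weights have slab integrals independent of `x`.
  set W : E3 × (ℝ × E3) → ℝ := fun z => g z.1 *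
    (((√(t - z.2.1) + ‖z.1 - z.2.2‖) ^ 4)⁻¹ + ((√z.2.1 + ‖z.2.2‖) ^ 4)⁻¹) with hW
  have hgm : Measurable g := (continuous_finsetSum _ fun j _ =>
    (contDiff_pd hφ j).continuous.abs).measurable
  have hg0 : ∀ x, 0 ≤ g x := fun x => Finset.sum_nonneg fun j _ => abs_nonneg _
  have hWi : Integrable W (volume.prod (slab t)) := by
    have hWm : Measurable W := by
      refine (hgm.comp measurable_fst).mul (Measurable.add ?_ ?_) <;> fun_prop
    refine (integrable_prod_iff hWm.aestronglyMeasurable).2 ⟨Eventually.of_forall fun x =>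
      ((integrable_slab_backward ht x).1.add (integrable_slab_forward ht).1).const_mul (g x), ?_⟩
    have e : ∀ x, ∫ q, ‖W (x, q)‖ ∂slab t = g x * (4 * weightConst * √t) := fun x => by
      have hb := integrable_slab_backward ht x
      have hfw := integrable_slab_forward (t := t) ht
      have : ∀ q, ‖W (x, q)‖ = W (x, q) := fun q => Real.norm_of_nonneg (by
        have := hg0 x
        positivity)
      rw [integral_congr_ae (Eventually.of_forall this)]
      simp only [hW]
      rw [integral_const_mul, integral_add hb.1 hfw.1, hb.2, hfw.2]
      ring
    simp only [e]
    exact hgi.mul_const _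
  have hfi : Integrable (Function.uncurry f) (volume.prod (slab t)) := by
    refine Integrable.mono' (hWi.const_mul (c * D * (16 * (√t ^ p)⁻¹))) ?_ ?_
    · refine AEStronglyMeasurable.mul ?_ ?_
      · refine (Finset.measurable_sum _ fun j _ => Measurable.mul ?_ ?_).aestronglyMeasurable
        · exact (contDiff_pd hφ j).continuous.measurable.comp measurable_fst
        · exact (hKm j).comp (g := fun p : ℝ × E3 => K j p.1 p.2)
            (f := fun z : E3 × (ℝ × E3) => (t - z.2.1, z.1 - z.2.2)) (by fun_prop)
      · have : AEStronglyMeasurable (Function.uncurry F) (slab t) := by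
          rw [slab_eq]
          exact hFm.mono_measure Measure.restrict_le_self
        exact this.comp_snd
    · have hae : ∀ᵐ z : E3 × (ℝ × E3) ∂volume.prod (slab t), 0 < z.2.1 ∧ z.2.1 < t :=
        Measure.quasiMeasurePreserving_snd.ae (ae_slab t)
      filter_upwards [hae] with z hz
      have hj : ∀ j, |K j (t - z.2.1) (z.1 - z.2.2) * F z.2.1 z.2.2| ≤ c * D * (16 * (√t ^ p)⁻¹) *
          (((√(t - z.2.1) + ‖z.1 - z.2.2‖) ^ 4)⁻¹ + ((√z.2.1 + ‖z.2.2‖) ^ 4)⁻¹) := fun j => by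
        refine (duhamel_integrand_le ht hp hc hD (hK j) hF z.1 hz).trans ?_
        have := inv_pow_add_le ht p z.1
        gcongr
      calc ‖f z.1 z.2‖ = |∑ j, pd j φ z.1 * (K j (t - z.2.1) (z.1 - z.2.2) * F z.2.1 z.2.2)| := by
            simp only [hf, Real.norm_eq_abs, Finset.sum_mul, mul_assoc]
        _ ≤ ∑ j, |pd j φ z.1| * |K j (t - z.2.1) (z.1 - z.2.2) * F z.2.1 z.2.2| := by
            refine (Finset.abs_sum_le_sum_abs _ _).trans (le_of_eq ?_)
            simp only [abs_mul]
        _ ≤ ∑ j, |pd j φ z.1| * (c * D * (16 * (√t ^ p)⁻¹) *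
          (((√(t - z.2.1) + ‖z.1 - z.2.2‖) ^ 4)⁻¹ + ((√z.2.1 + ‖z.2.2‖) ^ 4)⁻¹)) :=
            Finset.sum_le_sum fun j _ => mul_le_mul_of_nonneg_left (hj j) (abs_nonneg _)
        _ = _ := by
            rw [← Finset.sum_mul, hW, hg]
            ring
  have e1 : ∀ x, fderiv ℝ φ x (WithLp.toLp 2 fun j => duhamel (K j) F t x)
      = ∫ q, f x q ∂slab t := fun x => by
    rw [fderiv_apply_eq_sum_pd]
    simp only [hf, Finset.sum_mul, mul_assoc]
    rw [integral_finsetSum _ fun j _ =>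
      (integrable_duhamel ht hp hc hD (hKm j) hFm (hK j) hF x).const_mul _]
    refine Finset.sum_congr rfl fun j _ => ?_
    rw [integral_const_mul, mul_comm]
    rfl
  simp only [e1]
  rw [integral_integral_swap hfi]
  refine integral_eq_zero_of_ae ?_
  filter_upwards [ae_slab t] with q hq
  simp only [hf]
  rw [integral_mul_const, hdiv φ hφ hφc (t - q.1) (by linarith [hq.2]) q.2, zero_mul]
  rfl

/-! ### Measurability along maps -/

section

variable {P : Type*} [MeasurableSpace P] {T : P → ℝ} {X : P → E3}

theorem measurable_heatKernel_comp (hT : Measurable T) (hX : Measurable X) :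
    Measurable fun p => heatKernel (T p) (X p) :=
  measurable_heatKernel.comp (g := fun p : ℝ × E3 => heatKernel p.1 p.2)
    (f := fun p => (T p, X p)) (hT.prodMk hX)

theorem measurable_oseenExplicit_comp (j l : Fin 3) (hT : Measurable T) (hX : Measurable X) :
    Measurable fun p => oseenExplicit j l (T p) (X p) :=
  (measurable_oseenExplicit j l).comp (g := fun p : ℝ × E3 => oseenExplicit j l p.1 p.2)
    (f := fun p => (T p, X p)) (hT.prodMk hX)

theorem measurable_heatFlowDistr_comp (θ₀ : RealTempered) (hT : Measurable T)
    (hX : Measurable X) : Measurable fun p => heatFlowDistr θ₀ (T p) (X p) :=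
  (measurable_heatFlowDistr θ₀).comp (g := fun p : ℝ × E3 => heatFlowDistr θ₀ p.1 p.2)
    (f := fun p => (T p, X p)) (hT.prodMk hX)

end

/-! ### Free evolution of the velocity -/

/-- The constant `∫_{|x| < 1} |x|⁻¹ dx`. -/
def singConst : ℝ := ∫ x : E3, (Metric.ball (0 : E3) 1).indicator (fun x => ‖x‖⁻¹) x

theorem singConst_nonneg : 0 ≤ singConst :=
  integral_nonneg fun x => indicator_nonneg (fun x _ => by positivity) x

theorem integrable_inv_norm_ball :
    Integrable ((Metric.ball (0 : E3) 1).indicator fun x => ‖x‖⁻¹) volume := by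
  rw [integrable_indicator_iff Metric.isOpen_ball.measurableSet,
    integrableOn_fun_norm_addHaar volume (f := fun r => r⁻¹)]
  have h : IntegrableOn (fun y : ℝ => y) (Ioo 0 1) :=
    (continuous_id.integrableOn_Icc (a := 0) (b := 1)).mono_set Ioo_subset_Icc_self
  refine h.congr_fun (fun y hy => ?_) measurableSet_Ioo
  have : y ≠ 0 := hy.1.ne'
  simp only [finrank_euclideanSpace, Fintype.card_fin, smul_eq_mul]
  field_simp

theorem inv_norm_ball_scaling {R : ℝ} (hR : 0 < R) (x : E3) :
    (Metric.ball (0 : E3) R).indicator (fun x => ‖x‖⁻¹) x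
      = R⁻¹ * (Metric.ball (0 : E3) 1).indicator (fun x => ‖x‖⁻¹) (R⁻¹ • x) := by
  have hn : ‖R⁻¹ • x‖ = R⁻¹ * ‖x‖ := by
    rw [norm_smul, Real.norm_of_nonneg (by positivity)]
  by_cases hx : ‖x‖ < R
  · rw [indicator_of_mem (by simpa using hx), indicator_of_mem, hn]
    · field_simp
    · rw [mem_ball_zero_iff, hn, inv_mul_lt_one₀ hR]
      exact hx
  · rw [indicator_of_notMem (by simpa using hx), indicator_of_notMem, mul_zero]
    rw [mem_ball_zero_iff, hn, inv_mul_lt_one₀ hR]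
    exact hx

theorem integrable_inv_norm_ball_radius {R : ℝ} (hR : 0 < R) :
    Integrable ((Metric.ball (0 : E3) R).indicator fun x => ‖x‖⁻¹) volume ∧
      ∫ x, (Metric.ball (0 : E3) R).indicator (fun x => ‖x‖⁻¹) x = R ^ 2 * singConst := by
  constructor
  · refine ((integrable_inv_norm_ball.comp_smul (inv_ne_zero hR.ne')).const_mul R⁻¹).congr ?_
    exact Eventually.of_forall fun x => (inv_norm_ball_scaling hR x).symm
  · simp only [inv_norm_ball_scaling hR]
    rw [integral_const_mul, Measure.integral_comp_smul volume
      ((Metric.ball (0 : E3) 1).indicator fun x => ‖x‖⁻¹) R⁻¹]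
    simp only [finrank_euclideanSpace, Fintype.card_fin, smul_eq_mul, singConst]
    rw [abs_of_pos (by positivity)]
    field_simp

/-- The exponent $-3$ is not integrable at infinity in $\mathbb R^3$; Gaussian decay buys one more
power at the price of $\sqrt s$. -/
theorem heatKernel_bound_four : ∃ C : ℝ, 0 < C ∧ ∀ s : ℝ, 0 < s → ∀ x : E3,
    |heatKernel s x| ≤ C * (√s * ((√s + ‖x‖) ^ 4)⁻¹) := by
  obtain ⟨C, hC0, hC⟩ := heatKernel_le 1
  refine ⟨C, hC0, fun s hs x => ?_⟩
  have hσ : 0 < √s := Real.sqrt_pos.2 hs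
  have hw : 0 < √s + ‖x‖ := by positivity
  have h0 := heatKernel_nonneg hs x
  have h1 := hC s hs x
  rw [abs_of_nonneg h0, ← mul_assoc, ← div_eq_mul_inv, le_div_iff₀ (by positivity)]
  refine le_of_mul_le_mul_right ?_ hσ
  calc heatKernel s x * (√s + ‖x‖) ^ 4 * √s
      ≤ heatKernel s x * (√s + ‖x‖) ^ 4 * (√s + ‖x‖) := by
        gcongr
        linarith [norm_nonneg x]
    _ = (√s + ‖x‖) ^ (2 * 1 + 3) * heatKernel s x := by ring
    _ ≤ C * √s ^ (2 * 1) := h1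
    _ = C * √s * √s := by ring

/-- Split at $|y|=R/2$ with $R=\sqrt t+|x|$. Far from the origin $|y|^{-1}\le2/R$. Near it $\sqrt
t+|x-y|\ge R/2$, so the kernel factor is at most $16R^{-3}$ and the singularity is integrated over a
ball, which gives $R^2$. -/
theorem weight_mul_inv_norm_le {t : ℝ} (ht : 0 < t) (x y : E3) :
    √t * ((√t + ‖x - y‖) ^ 4)⁻¹ * ‖y‖⁻¹ ≤
      2 * (√t + ‖x‖)⁻¹ * (√t * ((√t + ‖x - y‖) ^ 4)⁻¹) + 16 * ((√t + ‖x‖) ^ 3)⁻¹ *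
        (Metric.ball (0 : E3) (√t + ‖x‖)).indicator (fun x => ‖x‖⁻¹) y := by
  have hσ : 0 < √t := Real.sqrt_pos.2 ht
  have hR : 0 < √t + ‖x‖ := by positivity
  have hA : 0 < √t + ‖x - y‖ := by positivity
  have hind : 0 ≤ (Metric.ball (0 : E3) (√t + ‖x‖)).indicator (fun x => ‖x‖⁻¹) y :=
    indicator_nonneg (fun x _ => by positivity) y
  rcases le_or_gt ((√t + ‖x‖) / 2) ‖y‖ with hy | hy
  · have h1 : ‖y‖⁻¹ ≤ 2 * (√t + ‖x‖)⁻¹ := by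
      calc ‖y‖⁻¹ ≤ ((√t + ‖x‖) / 2)⁻¹ := by gcongr
        _ = _ := by field_simp
    calc _ ≤ √t * ((√t + ‖x - y‖) ^ 4)⁻¹ * (2 * (√t + ‖x‖)⁻¹) := by gcongr
      _ = 2 * (√t + ‖x‖)⁻¹ * (√t * ((√t + ‖x - y‖) ^ 4)⁻¹) + 0 := by ring
      _ ≤ _ := by gcongr; positivity
  · have hmem : y ∈ Metric.ball (0 : E3) (√t + ‖x‖) := by
      rw [mem_ball_zero_iff]
      linarith
    rw [indicator_of_mem hmem]
    have htri : ‖x‖ ≤ ‖x - y‖ + ‖y‖ := by simpa using norm_add_le (x - y) y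
    have hA2 : (√t + ‖x‖) / 2 ≤ √t + ‖x - y‖ := by linarith
    calc √t * ((√t + ‖x - y‖) ^ 4)⁻¹ * ‖y‖⁻¹
        ≤ (√t + ‖x‖) * (((√t + ‖x‖) / 2) ^ 4)⁻¹ * ‖y‖⁻¹ := by
          gcongr
          linarith [norm_nonneg x]
      _ = 0 + 16 * ((√t + ‖x‖) ^ 3)⁻¹ * ‖y‖⁻¹ := by field_simp; ring
      _ ≤ _ := by gcongr; positivity

theorem integral_weight_mul_inv_norm {t : ℝ} (ht : 0 < t) (x : E3) :
    Integrable (fun y : E3 => √t * ((√t + ‖x - y‖) ^ 4)⁻¹ * ‖y‖⁻¹) volume ∧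
      ∫ y : E3, √t * ((√t + ‖x - y‖) ^ 4)⁻¹ * ‖y‖⁻¹
        ≤ (2 * weightConst + 16 * singConst) * (√t + ‖x‖)⁻¹ := by
  have hσ : 0 < √t := Real.sqrt_pos.2 ht
  have hR : 0 < √t + ‖x‖ := by positivity
  have h1 := ((integrable_weight_sub hσ x).const_mul √t).const_mul (2 * (√t + ‖x‖)⁻¹)
  obtain ⟨hb, hbi⟩ := integrable_inv_norm_ball_radius hR
  have h2 := hb.const_mul (16 * ((√t + ‖x‖) ^ 3)⁻¹)
  have hint : Integrable (fun y : E3 => √t * ((√t + ‖x - y‖) ^ 4)⁻¹ * ‖y‖⁻¹) volume := by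
    refine (h1.add h2).mono' (Measurable.aestronglyMeasurable (by fun_prop))
      (Eventually.of_forall fun y => ?_)
    rw [Real.norm_of_nonneg (by positivity)]
    exact weight_mul_inv_norm_le ht x y
  refine ⟨hint, (integral_mono hint (h1.add h2) fun y => weight_mul_inv_norm_le ht x y).trans ?_⟩
  simp only [Pi.add_apply]
  rw [integral_add h1 h2, integral_const_mul, integral_const_mul, integral_const_mul,
    integral_weight_sub hσ, hbi]
  apply le_of_eq
  field_simp

theorem heatFlow_bound : ∃ C : ℝ, 0 < C ∧ ∀ (u₀ : E3 → E3) (ε : ℝ), 0 ≤ ε →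
    AEStronglyMeasurable u₀ volume → (∀ y, y ≠ 0 → ‖u₀ y‖ ≤ ε * ‖y‖⁻¹) → ∀ t, 0 < t → ∀ x,
      Integrable (fun y => heatKernel t (x - y) • u₀ y) volume ∧
      ∫ y, ‖heatKernel t (x - y) • u₀ y‖ ≤ C * ε * (√t + ‖x‖)⁻¹ := by
  obtain ⟨C, hC0, hC⟩ := heatKernel_bound_four
  have hw := weightConst_nonneg
  have hs := singConst_nonneg
  -- The summand 1 secures positivity, since the two integral constants are only shown to be
  -- nonnegative.
  refine ⟨C * (2 * weightConst + 16 * singConst) + 1, by positivity,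
    fun u₀ ε hε hm hb t ht x => ?_⟩
  obtain ⟨h1, h2⟩ := integral_weight_mul_inv_norm ht x
  have hle : ∀ᵐ y : E3, ‖heatKernel t (x - y) • u₀ y‖ ≤
      C * ε * (√t * ((√t + ‖x - y‖) ^ 4)⁻¹ * ‖y‖⁻¹) := by
    -- The bound on `u₀` says nothing at the origin, a null set.
    have h0 : ∀ᵐ y : E3, y ≠ 0 := by simp [ae_iff]
    filter_upwards [h0] with y hy
    rw [norm_smul]
    calc _ ≤ (C * (√t * ((√t + ‖x - y‖) ^ 4)⁻¹)) * (ε * ‖y‖⁻¹) :=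
          mul_le_mul (hC t ht _) (hb y hy) (norm_nonneg _) (by positivity)
      _ = _ := by ring
  have hmeas : AEStronglyMeasurable (fun y => heatKernel t (x - y) • u₀ y) volume :=
    (measurable_heatKernel.comp (measurable_const.prodMk
      (measurable_id.const_sub x))).aestronglyMeasurable.smul hm
  have hint := (h1.const_mul (C * ε)).mono' hmeas hle
  refine ⟨hint, (integral_mono_ae hint.norm (h1.const_mul (C * ε)) hle).trans ?_⟩
  rw [integral_const_mul]
  have hR : 0 ≤ (√t + ‖x‖)⁻¹ := by positivity
  calc _ ≤ C * ε * ((2 * weightConst + 16 * singConst) * (√t + ‖x‖)⁻¹) := by gcongr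
    _ ≤ C * ε * ((2 * weightConst + 16 * singConst) * (√t + ‖x‖)⁻¹) + ε * (√t + ‖x‖)⁻¹ := by
      have := mul_nonneg hε hR
      linarith
    _ = _ := by ring

theorem aestronglyMeasurable_heatFlow {P : Type*} [MeasurableSpace P] {μ : Measure P} [SFinite μ]
    {u₀ : E3 → E3} (hm : AEStronglyMeasurable u₀ volume) {T : P → ℝ} {X : P → E3}
    (hT : Measurable T) (hX : Measurable X) :
    AEStronglyMeasurable (fun p => heatFlow u₀ (T p) (X p)) μ := by
  have h : AEStronglyMeasurable (fun z : P × E3 => heatKernel (T z.1) (X z.1 - z.2) • u₀ z.2)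
      (μ.prod volume) := by
    have hG : AEStronglyMeasurable (fun z : P × E3 => heatKernel (T z.1) (X z.1 - z.2))
        (μ.prod volume) :=
      (measurable_heatKernel_comp (by fun_prop) (by fun_prop)).aestronglyMeasurable
    have hu : AEStronglyMeasurable (fun z : P × E3 => u₀ z.2) (μ.prod volume) := hm.comp_snd
    exact hG.smul hu
  exact h.integral_prod_right'

/-- With the convolution variable on `u₀`, the heat flow is an average of translates of `u₀`. Fubini
reduces the claim to testing `u₀` against translates of `φ`, with no derivative of the kernel. -/
theorem boundedSolenoidal_heatFlow {u₀ : E3 → E3} {ε : ℝ} (hε : 0 ≤ ε)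
    (hm : AEStronglyMeasurable u₀ volume) (hb : ∀ y, y ≠ 0 → ‖u₀ y‖ ≤ ε * ‖y‖⁻¹)
    (hdiv : IsDivFree u₀) {t : ℝ} (ht : 0 < t) : BoundedSolenoidal (heatFlow u₀ t) := by
  obtain ⟨C, hC0, hC⟩ := heatFlow_bound
  have hσ : 0 < √t := Real.sqrt_pos.2 ht
  have hbd : ∀ x, ∫ y, ‖heatKernel t (x - y) • u₀ y‖ ≤ C * ε * (√t)⁻¹ := fun x => by
    refine (hC u₀ ε hε hm hb t ht x).2.trans ?_
    gcongr
    linarith [norm_nonneg x]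
  refine ⟨aestronglyMeasurable_heatFlow hm measurable_const measurable_id,
    ⟨_, fun x => (norm_integral_le_integral_norm _).trans (hbd x)⟩, fun φ hφ hc => ?_⟩
  have hrev : ∀ x, Integrable (fun z => heatKernel t z • u₀ (x - z)) volume := fun x => by
    simpa using (hC u₀ ε hε hm hb t ht x).1.comp_sub_left x
  have hrev_eq : ∀ x, heatFlow u₀ t x = ∫ z, heatKernel t z • u₀ (x - z) := fun x => by
    rw [heatFlow, ← integral_sub_left_eq_self _ volume x]
    simp
  have hrev_norm : ∀ x, ∫ z, ‖heatKernel t z • u₀ (x - z)‖ ≤ C * ε * (√t)⁻¹ := fun x => by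
    refine le_trans (le_of_eq ?_) (hbd x)
    rw [← integral_sub_left_eq_self _ volume x]
    simp
  have hDφ : Continuous (fderiv ℝ φ) := hφ.continuous_fderiv (by simp)
  set f : E3 → E3 → ℝ := fun x z => fderiv ℝ φ x (heatKernel t z • u₀ (x - z)) with hf
  have hle : ∀ x z, ‖f x z‖ ≤ ‖fderiv ℝ φ x‖ * ‖heatKernel t z • u₀ (x - z)‖ := fun x z =>
    ContinuousLinearMap.le_opNorm _ _
  have hfm : AEStronglyMeasurable (Function.uncurry f) (volume.prod volume) := by
    have h1 : AEStronglyMeasurable (fun z : E3 × E3 => fderiv ℝ φ z.1) (volume.prod volume) :=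
      (hDφ.comp continuous_fst).aestronglyMeasurable
    have h2 : AEStronglyMeasurable (fun z : E3 × E3 => heatKernel t z.2 • u₀ (z.1 - z.2))
        (volume.prod volume) := by
      have hG : AEStronglyMeasurable (fun z : E3 × E3 => heatKernel t z.2) (volume.prod volume) :=
        (measurable_heatKernel_comp (by fun_prop) (by fun_prop)).aestronglyMeasurable
      have hu : AEStronglyMeasurable (fun z : E3 × E3 => u₀ (z.1 - z.2)) (volume.prod volume) :=
        hm.comp_quasiMeasurePreserving
          (quasiMeasurePreserving_sub_of_right_invariant volume volume)
      exact hG.smul hu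
    exact (isBoundedBilinearMap_apply (𝕜 := ℝ) (E := E3) (F := ℝ)).continuous.comp_aestronglyMeasurable₂
      h1 h2
  have hfi : Integrable (Function.uncurry f) (volume.prod volume) := by
    refine (integrable_prod_iff hfm).2 ⟨Eventually.of_forall fun x =>
      (fderiv ℝ φ x).integrable_comp (hrev x), ?_⟩
    have hg : Integrable (fun x => ‖fderiv ℝ φ x‖ * (C * ε * (√t)⁻¹)) volume :=
      ((hDφ.integrable_of_hasCompactSupport (hc.fderiv (𝕜 := ℝ))).norm).mul_const _
    refine hg.mono' hfm.norm.integral_prod_right' (Eventually.of_forall fun x => ?_)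
    rw [Real.norm_of_nonneg (integral_nonneg fun _ => norm_nonneg _)]
    calc ∫ z, ‖f x z‖ ≤ ∫ z, ‖fderiv ℝ φ x‖ * ‖heatKernel t z • u₀ (x - z)‖ :=
          integral_mono ((fderiv ℝ φ x).integrable_comp (hrev x)).norm
            ((hrev x).norm.const_mul _) (hle x)
      _ ≤ _ := by
          rw [integral_const_mul]
          exact mul_le_mul_of_nonneg_left (hrev_norm x) (norm_nonneg _)
  have e1 : ∀ x, fderiv ℝ φ x (heatFlow u₀ t x) = ∫ z, f x z := fun x => by
    rw [hrev_eq]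
    exact ((fderiv ℝ φ x).integral_comp_comm (hrev x)).symm
  simp only [e1]
  rw [integral_integral_swap hfi]
  refine integral_eq_zero_of_ae (Eventually.of_forall fun z => ?_)
  have hφz : ContDiff ℝ ∞ fun x => φ (x + z) := hφ.comp (contDiff_id.add contDiff_const)
  have hcz : HasCompactSupport fun x => φ (x + z) := hc.comp_homeomorph (Homeomorph.addRight z)
  have h := hdiv _ hφz hcz
  simp only [fderiv_comp_add_right] at h
  simp only [hf, map_smul, integral_smul, Pi.zero_apply]
  rw [← integral_add_right_eq_self (fun x => fderiv ℝ φ x (u₀ (x - z))) z]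
  simp [h]

/-! ### The buoyancy part of the free evolution -/

/-- The field `e^{tΔ} ℙ(θ₀ e₃)` in terms of the explicit Oseen kernel. -/
def lerayExplicit (θ₀ : RealTempered) (t : ℝ) (x : E3) : E3 :=
  WithLp.toLp 2 fun j => ∫ y, oseenExplicit j 2 (t / 2) (x - y) * heatFlowDistr θ₀ (t / 2) y

theorem lerayHeatFlowDistr_eq (θ₀ : RealTempered) {t : ℝ} (ht : 0 < t) (x : E3) :
    lerayHeatFlowDistr θ₀ t x = lerayExplicit θ₀ t x := by
  simp only [lerayHeatFlowDistr, lerayExplicit, oseenKernel_eq _ _ (half_pos ht)]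

theorem aestronglyMeasurable_lerayExplicit {P : Type*} [MeasurableSpace P] {μ : Measure P}
    [SFinite μ] (θ₀ : RealTempered) {T : P → ℝ} {X : P → E3} (hT : Measurable T)
    (hX : Measurable X) : AEStronglyMeasurable (fun p => lerayExplicit θ₀ (T p) (X p)) μ := by
  refine aestronglyMeasurable_toLp fun j => ?_
  have h : Measurable fun z : P × E3 =>
      oseenExplicit j 2 (T z.1 / 2) (X z.1 - z.2) * heatFlowDistr θ₀ (T z.1 / 2) z.2 := by
    refine Measurable.mul ?_ ?_
    · exact measurable_oseenExplicit_comp j 2 (by fun_prop) (by fun_prop)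
    · exact measurable_heatFlowDistr_comp θ₀ (by fun_prop) (by fun_prop)
  exact (h.stronglyMeasurable.integral_prod_right' (ν := volume)).aestronglyMeasurable

/-- A single inverse cube is not integrable over $\mathbb R^3$, but the product is dominated by
integrable fourth powers. The loss $\sigma^{-2}$ is harmless, as the bound serves only integrability
at a fixed time. -/
theorem inv_cube_mul_inv_cube_le {σ A B : ℝ} (hσ : 0 < σ) (hA : σ ≤ A) (hB : σ ≤ B) :
    (A ^ 3)⁻¹ * (B ^ 3)⁻¹ ≤ (σ ^ 2)⁻¹ * ((A ^ 4)⁻¹ + (B ^ 4)⁻¹) := by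
  have hA0 : 0 < A := hσ.trans_le hA
  have hB0 : 0 < B := hσ.trans_le hB
  calc (A ^ 3)⁻¹ * (B ^ 3)⁻¹ = (A * B)⁻¹ * ((A ^ 2)⁻¹ * (B ^ 2)⁻¹) := by field_simp
    _ ≤ (σ * σ)⁻¹ * ((A ^ 4)⁻¹ + (B ^ 4)⁻¹) := by
      have h : (A ^ 2)⁻¹ * (B ^ 2)⁻¹ ≤ (A ^ 4)⁻¹ + (B ^ 4)⁻¹ := by
        have e : ∀ m : ℝ, (m ^ 4)⁻¹ = (m ^ 2)⁻¹ ^ 2 := fun m => by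
          rw [inv_pow, ← pow_mul]
        rw [e A, e B]
        nlinarith [sq_nonneg ((A ^ 2)⁻¹ - (B ^ 2)⁻¹), sq_nonneg (A ^ 2)⁻¹, sq_nonneg (B ^ 2)⁻¹]
      gcongr
    _ = _ := by rw [sq]

theorem boundedSolenoidal_lerayHeatFlowDistr {θ₀ : RealTempered} {ε M : ℝ} (hε : 0 ≤ ε) {t : ℝ}
    (ht : 0 < t) (hθ : DecayBound 3 (heatFlowDistr θ₀) ε)
    (hM : ∀ x, ‖lerayHeatFlowDistr θ₀ t x‖ ≤ M) :
    BoundedSolenoidal (lerayHeatFlowDistr θ₀ t) := by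
  have hfun : lerayHeatFlowDistr θ₀ t = lerayExplicit θ₀ t :=
    funext fun x => lerayHeatFlowDistr_eq θ₀ ht x
  rw [hfun] at hM ⊢
  refine ⟨aestronglyMeasurable_lerayExplicit θ₀ measurable_const measurable_id, ⟨M, hM⟩,
    fun φ hφ hc => ?_⟩
  obtain ⟨C, hC0, hC⟩ := oseenExplicit_bound
  set τ := t / 2 with hτ
  have hτ0 : 0 < τ := half_pos ht
  have hσ : 0 < √τ := Real.sqrt_pos.2 hτ0
  have hgm : Measurable fun y => heatFlowDistr θ₀ τ y :=
    measurable_heatFlowDistr_comp θ₀ measurable_const measurable_id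
  have hOm : ∀ j, Measurable fun z : E3 × E3 => oseenExplicit j 2 τ (z.1 - z.2) := fun j =>
    measurable_oseenExplicit_comp j 2 (by fun_prop) (by fun_prop)
  have hle : ∀ j x y, |oseenExplicit j 2 τ (x - y) * heatFlowDistr θ₀ τ y| ≤
      C * ε * (√τ ^ 2)⁻¹ * (((√τ + ‖x - y‖) ^ 4)⁻¹ + ((√τ + ‖y‖) ^ 4)⁻¹) := fun j x y => by
    rw [abs_mul]
    calc _ ≤ (C * ((√τ + ‖x - y‖) ^ 3)⁻¹) * (ε * ((√τ + ‖y‖) ^ 3)⁻¹) :=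
          mul_le_mul (hC j 2 τ hτ0 _) (hθ τ hτ0 y) (abs_nonneg _) (by positivity)
      _ = C * ε * (((√τ + ‖x - y‖) ^ 3)⁻¹ * ((√τ + ‖y‖) ^ 3)⁻¹) := by ring
      _ ≤ C * ε * ((√τ ^ 2)⁻¹ * (((√τ + ‖x - y‖) ^ 4)⁻¹ + ((√τ + ‖y‖) ^ 4)⁻¹)) := by
          exact mul_le_mul_of_nonneg_left (inv_cube_mul_inv_cube_le hσ
            (by linarith [norm_nonneg (x - y)]) (by linarith [norm_nonneg y])) (by positivity)
      _ = _ := by ring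
  have hwi : ∀ x, Integrable
      (fun y : E3 => ((√τ + ‖x - y‖) ^ 4)⁻¹ + ((√τ + ‖y‖) ^ 4)⁻¹) volume := fun x =>
    (integrable_weight_sub hσ x).add (integrable_weight hσ)
  have hOi : ∀ j x, Integrable
      (fun y => oseenExplicit j 2 τ (x - y) * heatFlowDistr θ₀ τ y) volume := fun j x =>
    ((hwi x).const_mul _).mono' ((measurable_oseenExplicit_comp j 2 (by fun_prop)
      (by fun_prop)).mul hgm).aestronglyMeasurable (Eventually.of_forall fun y => hle j x y)
  set f : E3 → E3 → ℝ := fun x y =>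
    (∑ j, pd j φ x * oseenExplicit j 2 τ (x - y)) * heatFlowDistr θ₀ τ y with hf
  have hfm : Measurable (Function.uncurry f) := by
    refine Measurable.mul (Finset.measurable_sum _ fun j _ => Measurable.mul ?_ (hOm j))
      (hgm.comp measurable_snd)
    exact (contDiff_pd hφ j).continuous.measurable.comp measurable_fst
  have hfe : ∀ x y, f x y
      = ∑ j, pd j φ x * (oseenExplicit j 2 τ (x - y) * heatFlowDistr θ₀ τ y) := fun x y => by
    simp only [hf, Finset.sum_mul, mul_assoc]
  have hfl : ∀ x y, ‖f x y‖ ≤ (∑ j, |pd j φ x|) * (C * ε * (√τ ^ 2)⁻¹) *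
      (((√τ + ‖x - y‖) ^ 4)⁻¹ + ((√τ + ‖y‖) ^ 4)⁻¹) := fun x y => by
    rw [hfe, mul_assoc, Finset.sum_mul]
    refine (norm_sum_le _ _).trans (Finset.sum_le_sum fun j _ => ?_)
    rw [norm_mul]
    exact mul_le_mul_of_nonneg_left (hle j x y) (norm_nonneg _)
  have hfx : ∀ x, Integrable (f x) volume := fun x => by
    have : f x = fun y => ∑ j, pd j φ x *
      (oseenExplicit j 2 τ (x - y) * heatFlowDistr θ₀ τ y) := funext (hfe x)
    rw [this]
    exact integrable_finsetSum _ fun j _ => (hOi j x).const_mul _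
  have hfi : Integrable (Function.uncurry f) (volume.prod volume) := by
    refine (integrable_prod_iff hfm.aestronglyMeasurable).2
      ⟨Eventually.of_forall fun x => hfx x, ?_⟩
    have hg : Integrable (fun x => ∑ j, |pd j φ x|) volume := integrable_finsetSum _ fun j _ =>
      ((contDiff_pd hφ j).continuous.integrable_of_hasCompactSupport
        (hasCompactSupport_pd hc j)).abs
    refine (hg.mul_const ((C * ε * (√τ ^ 2)⁻¹) * (weightConst * (√τ)⁻¹ + weightConst * (√τ)⁻¹))).mono'
      hfm.aestronglyMeasurable.norm.integral_prod_right' (Eventually.of_forall fun x => ?_)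
    rw [Real.norm_of_nonneg (integral_nonneg fun _ => norm_nonneg _)]
    refine (integral_mono (hfx x).norm ((hwi x).const_mul _) (hfl x)).trans (le_of_eq ?_)
    rw [integral_const_mul, integral_add (integrable_weight_sub hσ x) (integrable_weight hσ),
      integral_weight hσ, integral_weight_sub hσ]
    ring
  have e1 : ∀ x, fderiv ℝ φ x (lerayExplicit θ₀ t x) = ∫ y, f x y := fun x => by
    rw [fderiv_apply_eq_sum_pd]
    simp only [hfe]
    rw [integral_finsetSum _ fun j _ => (hOi j x).const_mul _]
    refine Finset.sum_congr rfl fun j _ => ?_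
    rw [integral_const_mul, mul_comm]
    rfl
  simp only [e1]
  rw [integral_integral_swap hfi]
  refine integral_eq_zero_of_ae (Eventually.of_forall fun y => ?_)
  simp only [hf]
  rw [integral_mul_const, integral_sum_pd_mul_oseen hφ hc 2 hτ0 y, zero_mul]
  rfl

/-! ### The quadratic terms as Duhamel operators -/

/-- `-∫₀ᵗ e^{(t-s)Δ} ℙ ∇·F(s) ds` for a matrix field `F`. -/
def stressOp (F : Fin 3 → Fin 3 → ℝ → E3 → ℝ) (t : ℝ) (x : E3) : E3 :=
  WithLp.toLp 2 fun j => -∑ k, ∑ l, duhamel (oseenGrad k j l) (F k l) t x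

/-- `-∫₀ᵗ (t-s) e^{(t-s)Δ} ℙ (∇·G(s) e₃) ds` for a vector field `G`. -/
def buoyancyOp (G : Fin 3 → ℝ → E3 → ℝ) (t : ℝ) (x : E3) : E3 :=
  WithLp.toLp 2 fun j => -∑ k, duhamel (fun τ z => τ * oseenGrad k j 2 τ z) (G k) t x

/-- `-∫₀ᵗ e^{(t-s)Δ} ∇·G(s) ds` for a vector field `G`. -/
def fluxOp (G : Fin 3 → ℝ → E3 → ℝ) (t : ℝ) (x : E3) : ℝ :=
  -∑ k, duhamel (heatD1 k) (G k) t x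

/-- The components of `u ⊗ u`. -/
def stress (u : ℝ → E3 → E3) (k l : Fin 3) (s : ℝ) (y : E3) : ℝ := u s y k * u s y l

/-- The components of `θ u`. -/
def flux (u : ℝ → E3 → E3) (θ : ℝ → E3 → ℝ) (k : Fin 3) (s : ℝ) (y : E3) : ℝ := θ s y * u s y k

/-- Measurable pairs with `|u| ≤ M (√t + |x|)⁻¹` and `|θ| ≤ M (√t + |x|)⁻³`. -/
structure Admissible (M : ℝ) (u : ℝ → E3 → E3) (θ : ℝ → E3 → ℝ) : Prop where
  measU : AEStronglyMeasurable (Function.uncurry u) spaceTime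
  measT : AEStronglyMeasurable (Function.uncurry θ) spaceTime
  boundU : ∀ t, 0 < t → ∀ x, ‖u t x‖ ≤ M * (√t + ‖x‖)⁻¹
  boundT : DecayBound 3 θ M

/-- Pairs at distance at most `d` in `𝓧 × 𝓨`. -/
def Within (d : ℝ) (u v : ℝ → E3 → E3) (θ η : ℝ → E3 → ℝ) : Prop :=
  ∀ t, 0 < t → ∀ x, ‖u t x - v t x‖ ≤ d * (√t + ‖x‖)⁻¹ ∧
    |θ t x - η t x| ≤ d * ((√t + ‖x‖) ^ 3)⁻¹

section Sources

variable {M d : ℝ} {u v : ℝ → E3 → E3} {θ η : ℝ → E3 → ℝ}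

theorem aestronglyMeasurable_uncurry_coord
    (h : AEStronglyMeasurable (Function.uncurry u) spaceTime) (k : Fin 3) :
    AEStronglyMeasurable (Function.uncurry fun s y => u s y k) spaceTime :=
  (EuclideanSpace.proj k : E3 →L[ℝ] ℝ).continuous.comp_aestronglyMeasurable h

theorem Admissible.meas_stress (h : Admissible M u θ) (k l : Fin 3) :
    AEStronglyMeasurable (Function.uncurry (stress u k l)) spaceTime :=
  (aestronglyMeasurable_uncurry_coord h.measU k).mul (aestronglyMeasurable_uncurry_coord h.measU l)

theorem Admissible.meas_flux (h : Admissible M u θ) (k : Fin 3) :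
    AEStronglyMeasurable (Function.uncurry (flux u θ k)) spaceTime :=
  h.measT.mul (aestronglyMeasurable_uncurry_coord h.measU k)

theorem Admissible.coord (h : Admissible M u θ) {t : ℝ} (ht : 0 < t) (x : E3) (k : Fin 3) :
    |u t x k| ≤ M * (√t + ‖x‖)⁻¹ :=
  (norm_apply_le _ k).trans (h.boundU t ht x)

theorem Within.coord (h : Within d u v θ η) {t : ℝ} (ht : 0 < t) (x : E3) (k : Fin 3) :
    |u t x k - v t x k| ≤ d * (√t + ‖x‖)⁻¹ :=
  (norm_apply_le (u t x - v t x) k).trans (h t ht x).1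

theorem Admissible.bound_stress (hM : 0 ≤ M) (h : Admissible M u θ) (k l : Fin 3) :
    DecayBound 2 (stress u k l) (M * M) := fun s hs y => by
  rw [stress, abs_mul]
  calc _ ≤ (M * (√s + ‖y‖)⁻¹) * (M * (√s + ‖y‖)⁻¹) :=
        mul_le_mul (h.coord hs y k) (h.coord hs y l) (abs_nonneg _) (by positivity)
    _ = _ := by rw [sq, mul_inv]; ring

theorem Admissible.bound_flux (hM : 0 ≤ M) (h : Admissible M u θ) (k : Fin 3) :
    DecayBound 4 (flux u θ k) (M * M) := fun s hs y => by
  rw [flux, abs_mul]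
  calc _ ≤ (M * ((√s + ‖y‖) ^ 3)⁻¹) * (M * (√s + ‖y‖)⁻¹) :=
        mul_le_mul (h.boundT s hs y) (h.coord hs y k) (abs_nonneg _) (by positivity)
    _ = _ := by rw [pow_succ _ 3, mul_inv]; ring

theorem abs_mul_sub_mul_le {a b a' b' A B dA dB : ℝ} (ha' : |a'| ≤ A) (hb : |b| ≤ B)
    (hda : |a - a'| ≤ dA) (hdb : |b - b'| ≤ dB) : |a * b - a' * b'| ≤ dA * B + A * dB := by
  have e : a * b - a' * b' = (a - a') * b + a' * (b - b') := by ring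
  rw [e]
  refine (abs_add_le _ _).trans ?_
  rw [abs_mul, abs_mul]
  exact add_le_add
    (mul_le_mul hda hb (abs_nonneg _) ((abs_nonneg _).trans hda))
    (mul_le_mul ha' hdb (abs_nonneg _) ((abs_nonneg _).trans ha'))

theorem Within.bound_stress (hu : Admissible M u θ) (hv : Admissible M v η)
    (h : Within d u v θ η) (k l : Fin 3) :
    DecayBound 2 (fun s y => stress u k l s y - stress v k l s y) (2 * M * d) := fun s hs y => by
  refine (abs_mul_sub_mul_le (hv.coord hs y k) (hu.coord hs y l) (h.coord hs y k)
    (h.coord hs y l)).trans (le_of_eq ?_)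
  rw [sq, mul_inv]
  ring

theorem Within.bound_flux (hu : Admissible M u θ) (hv : Admissible M v η)
    (h : Within d u v θ η) (k : Fin 3) :
    DecayBound 4 (fun s y => flux u θ k s y - flux v η k s y) (2 * M * d) := fun s hs y => by
  refine (abs_mul_sub_mul_le (hv.boundT s hs y) (hu.coord hs y k) (h s hs y).2
    (h.coord hs y k)).trans (le_of_eq ?_)
  rw [pow_succ _ 3, mul_inv]
  ring

end Sources

/-! ### Bounds for the Duhamel operators -/

theorem measurable_mul_oseenGrad (k j l : Fin 3) :
    Measurable fun p : ℝ × E3 => p.1 * oseenGrad k j l p.1 p.2 :=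
  measurable_fst.mul (measurable_oseenGrad k j l)

/-- A common constant in the kernel bounds. -/
theorem kernel_bounds : ∃ c : ℝ, 0 < c ∧ ∀ t, 0 < t →
    (∀ k j l, KernelBound (oseenGrad k j l) t c) ∧
    (∀ k j l, KernelBound (fun τ z => τ * oseenGrad k j l τ z) t (t * c)) ∧
    (∀ k, KernelBound (heatD1 k) t c) := by
  obtain ⟨c₁, h1p, h1⟩ := oseenGrad_bound
  obtain ⟨c₂, h2p, h2⟩ := heatD1_bound
  have hO : ∀ k j l τ, 0 < τ → ∀ z, |oseenGrad k j l τ z| ≤ (c₁ + c₂) * ((√τ + ‖z‖) ^ 4)⁻¹ :=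
    fun k j l τ hτ z => (h1 k j l τ hτ z).trans (by gcongr; linarith)
  refine ⟨c₁ + c₂, by positivity, fun t ht => ⟨fun k j l τ hτ _ z => hO k j l τ hτ z,
    fun k j l τ hτ hτt z => ?_, fun k τ hτ _ z => (h2 k τ hτ z).trans (by gcongr; linarith)⟩⟩
  -- The restriction $\tau<t$ lets the factor $t-s$ of the buoyancy term enter the constant as $t$.
  rw [abs_mul, abs_of_pos hτ, mul_assoc]
  exact mul_le_mul hτt.le (hO k j l τ hτ z) (abs_nonneg _) ht.le

/-- Powers of $\sqrt t$ produced by the Duhamel estimate are spent on raising the weight to the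
exponent of the target space. -/
theorem sqrt_mul_inv_pow_le {t : ℝ} (ht : 0 < t) (x : E3) (m n : ℕ) :
    √t ^ m * ((√t + ‖x‖) ^ (m + n))⁻¹ ≤ ((√t + ‖x‖) ^ n)⁻¹ := by
  have hσ : 0 < √t := Real.sqrt_pos.2 ht
  have hR : 0 < √t + ‖x‖ := by positivity
  have h : √t ^ m ≤ (√t + ‖x‖) ^ m := by
    gcongr
    linarith [norm_nonneg x]
  calc √t ^ m * ((√t + ‖x‖) ^ (m + n))⁻¹ ≤ (√t + ‖x‖) ^ m * ((√t + ‖x‖) ^ (m + n))⁻¹ := by gcongr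
    _ = _ := by rw [pow_add]; field_simp

theorem operator_bounds : ∃ L : ℝ, 0 < L ∧ ∀ t, 0 < t → ∀ (D : ℝ), 0 ≤ D →
    (∀ F : Fin 3 → Fin 3 → ℝ → E3 → ℝ, (∀ k l, DecayBound 2 (F k l) D) → ∀ x,
      ‖stressOp F t x‖ ≤ L * D * (√t + ‖x‖)⁻¹) ∧
    (∀ G : Fin 3 → ℝ → E3 → ℝ, (∀ k, DecayBound 4 (G k) D) → ∀ x,
      ‖buoyancyOp G t x‖ ≤ L * D * (√t + ‖x‖)⁻¹ ∧
      |fluxOp G t x| ≤ L * D * ((√t + ‖x‖) ^ 3)⁻¹) := by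
  obtain ⟨c, hc0, hc⟩ := kernel_bounds
  have hw := weightConst_nonneg
  set L := 64 * weightConst * c with hL
  have hL0 : 0 ≤ L := by positivity
  -- In the worst case, the stress term, 27 comes from the two index sums and the passage from
  -- components to the norm. The 1 ensures positivity.
  refine ⟨27 * L + 1, by positivity, fun t ht D hD => ?_⟩
  obtain ⟨h1, h2, h3⟩ := hc t ht
  have hσ : 0 < √t := Real.sqrt_pos.2 ht
  have habs : ∀ {f : Fin 3 → ℝ} {C : ℝ}, (∀ k, |f k| ≤ C) → |∑ k, f k| ≤ 3 * C :=
    fun hf => (Finset.abs_sum_le_sum_abs _ _).trans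
      ((Finset.sum_le_sum fun k _ => hf k).trans (by simp))
  have hfin : ∀ {a b r : ℝ}, 0 ≤ a → a ≤ 27 → 0 ≤ r → b ≤ r → a * (L * D * b) ≤
      (27 * L + 1) * D * r := fun {a b r} ha ha' hr hbr => by
    calc a * (L * D * b) ≤ a * (L * D * r) := by gcongr
      _ ≤ 27 * (L * D * r) := by gcongr
      _ ≤ 27 * (L * D * r) + D * r := by
        have := mul_nonneg hD hr
        linarith
      _ = _ := by ring
  refine ⟨fun F hF x => ?_, fun G hG x => ⟨?_, ?_⟩⟩
  · refine (norm_toLp_le (C := 3 * (3 * (L * D * (√t * ((√t + ‖x‖) ^ 2)⁻¹)))) fun j => ?_).trans ?_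
    · rw [abs_neg]
      refine habs fun k => habs fun l => ?_
      refine (abs_duhamel_le ht (by norm_num) hc0.le hD (h1 k j l) (hF k l) x).trans (le_of_eq ?_)
      rw [hL]
      ring
    · have := sqrt_mul_inv_pow_le ht x 1 1
      simp only [pow_one] at this
      rw [show 3 * (3 * (3 * (L * D * (√t * ((√t + ‖x‖) ^ 2)⁻¹))))
        = 27 * (L * D * (√t * ((√t + ‖x‖) ^ 2)⁻¹)) by ring]
      exact hfin (by norm_num) (by norm_num) (by positivity) this
  · refine (norm_toLp_le (C := 3 * (L * D * (√t ^ 3 * ((√t + ‖x‖) ^ 4)⁻¹))) fun j => ?_).trans ?_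
    · rw [abs_neg]
      refine habs fun k => ?_
      refine (abs_duhamel_le ht (by norm_num) (by positivity) hD (h2 k j 2) (hG k) x).trans
        (le_of_eq ?_)
      rw [hL, pow_succ √t 2, Real.sq_sqrt ht.le]
      ring
    · have := sqrt_mul_inv_pow_le ht x 3 1
      simp only [pow_one] at this
      rw [← mul_assoc]
      exact hfin (by norm_num) (by norm_num) (by positivity) this
  · rw [fluxOp, abs_neg]
    refine (habs (C := L * D * (√t * ((√t + ‖x‖) ^ 4)⁻¹)) fun k => ?_).trans ?_
    · refine (abs_duhamel_le ht (by norm_num) hc0.le hD (h3 k) (hG k) x).trans (le_of_eq ?_)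
      rw [hL]
      ring
    · have := sqrt_mul_inv_pow_le ht x 1 3
      simp only [pow_one] at this
      exact hfin (by norm_num) (by norm_num) (by positivity) this

/-! ### Identification of the terms of the mild formulation -/

section Terms

variable {M d : ℝ} {u v : ℝ → E3 → E3} {θ η : ℝ → E3 → ℝ}

/-- Absolute integrability over the slab identifies the iterated integral with the product integral.
The explicit kernel may be inserted because $t-s>0$ there. -/
theorem termB_eq (hM : 0 ≤ M) (h : Admissible M u θ) {t : ℝ} (ht : 0 < t) (x : E3) :
    termB u t x = stressOp (stress u) t x := by
  obtain ⟨c, hc0, hc⟩ := kernel_bounds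
  have hi := fun k j l => integrable_duhamel ht (by norm_num) hc0.le (mul_nonneg hM hM)
    (measurable_oseenGrad k j l) (h.meas_stress k l) ((hc t ht).1 k j l) (h.bound_stress hM k l) x
  rw [termB, stressOp]
  congr 1
  ext j
  congr 1
  have hsum := integrable_finsetSum Finset.univ fun k _ =>
    integrable_finsetSum Finset.univ fun l _ => hi k j l
  calc _ = ∫ s in Ioo 0 t, ∫ y, ∑ k, ∑ l, oseenGrad k j l (t - s) (x - y) * stress u k l s y := by
        refine setIntegral_congr_fun measurableSet_Ioo fun s hs => ?_
        simp only [pd_oseenKernel _ _ _ (sub_pos.2 hs.2), stress]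
    _ = ∫ q, ∑ k, ∑ l, oseenGrad k j l (t - q.1) (x - q.2) * stress u k l q.1 q.2 ∂slab t :=
        (integral_prod _ hsum).symm
    _ = _ := by
        rw [integral_finsetSum _ fun k _ => integrable_finsetSum _ fun l _ => hi k j l]
        refine Finset.sum_congr rfl fun k _ => ?_
        rw [integral_finsetSum _ fun l _ => hi k j l]
        rfl

theorem termE_eq (hM : 0 ≤ M) (h : Admissible M u θ) {t : ℝ} (ht : 0 < t) (x : E3) :
    termE u θ t x = buoyancyOp (flux u θ) t x := by
  obtain ⟨c, hc0, hc⟩ := kernel_bounds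
  have hi := fun k j => integrable_duhamel ht le_rfl (by positivity) (mul_nonneg hM hM)
    (measurable_mul_oseenGrad k j 2) (h.meas_flux k) ((hc t ht).2.1 k j 2) (h.bound_flux hM k) x
  rw [termE, buoyancyOp]
  congr 1
  ext j
  congr 1
  have hsum := integrable_finsetSum Finset.univ fun k _ => hi k j
  calc _ = ∫ s in Ioo 0 t, ∫ y, ∑ k, (t - s) * oseenGrad k j 2 (t - s) (x - y) * flux u θ k s y := by
        refine setIntegral_congr_fun measurableSet_Ioo fun s hs => ?_
        simp only [pd_oseenKernel _ _ _ (sub_pos.2 hs.2), flux]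
        rw [← integral_const_mul]
        simp only [Finset.mul_sum, mul_assoc]
    _ = ∫ q, ∑ k, (t - q.1) * oseenGrad k j 2 (t - q.1) (x - q.2) * flux u θ k q.1 q.2 ∂slab t :=
        (integral_prod _ hsum).symm
    _ = _ := integral_finsetSum _ fun k _ => hi k j

theorem termBt_eq (hM : 0 ≤ M) (h : Admissible M u θ) {t : ℝ} (ht : 0 < t) (x : E3) :
    termBt θ u t x = fluxOp (flux u θ) t x := by
  obtain ⟨c, hc0, hc⟩ := kernel_bounds
  have hi := fun k => integrable_duhamel ht le_rfl hc0.le (mul_nonneg hM hM)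
    (measurable_heatD1 k) (h.meas_flux k) ((hc t ht).2.2 k) (h.bound_flux hM k) x
  rw [termBt, fluxOp]
  congr 1
  have hsum := integrable_finsetSum Finset.univ fun k _ => hi k
  calc _ = ∫ s in Ioo 0 t, ∫ y, ∑ k, heatD1 k (t - s) (x - y) * flux u θ k s y := by
        simp only [pd_heatKernel, flux]
    _ = ∫ q, ∑ k, heatD1 k (t - q.1) (x - q.2) * flux u θ k q.1 q.2 ∂slab t :=
        (integral_prod _ hsum).symm
    _ = _ := integral_finsetSum _ fun k _ => hi k

theorem stressOp_sub (hM : 0 ≤ M) (hu : Admissible M u θ) (hv : Admissible M v η) {t : ℝ}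
    (ht : 0 < t) (x : E3) : stressOp (stress u) t x - stressOp (stress v) t x
      = stressOp (fun k l s y => stress u k l s y - stress v k l s y) t x := by
  obtain ⟨c, hc0, hc⟩ := kernel_bounds
  have e := fun k j l => duhamel_sub ht (by norm_num) hc0.le (mul_nonneg hM hM) (mul_nonneg hM hM)
    (measurable_oseenGrad k j l) (hu.meas_stress k l) (hv.meas_stress k l) ((hc t ht).1 k j l)
    (hu.bound_stress hM k l) (hv.bound_stress hM k l) x
  ext j
  simp only [stressOp, PiLp.sub_apply, ← e, Finset.sum_sub_distrib]
  ring

theorem buoyancyOp_sub (hM : 0 ≤ M) (hu : Admissible M u θ) (hv : Admissible M v η) {t : ℝ}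
    (ht : 0 < t) (x : E3) : buoyancyOp (flux u θ) t x - buoyancyOp (flux v η) t x
      = buoyancyOp (fun k s y => flux u θ k s y - flux v η k s y) t x := by
  obtain ⟨c, hc0, hc⟩ := kernel_bounds
  have e := fun k j => duhamel_sub ht le_rfl (by positivity) (mul_nonneg hM hM) (mul_nonneg hM hM)
    (measurable_mul_oseenGrad k j 2) (hu.meas_flux k) (hv.meas_flux k) ((hc t ht).2.1 k j 2)
    (hu.bound_flux hM k) (hv.bound_flux hM k) x
  ext j
  simp only [buoyancyOp, PiLp.sub_apply, ← e, Finset.sum_sub_distrib]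
  ring

theorem fluxOp_sub (hM : 0 ≤ M) (hu : Admissible M u θ) (hv : Admissible M v η) {t : ℝ}
    (ht : 0 < t) (x : E3) : fluxOp (flux u θ) t x - fluxOp (flux v η) t x
      = fluxOp (fun k s y => flux u θ k s y - flux v η k s y) t x := by
  obtain ⟨c, hc0, hc⟩ := kernel_bounds
  have e := fun k => duhamel_sub ht le_rfl hc0.le (mul_nonneg hM hM) (mul_nonneg hM hM)
    (measurable_heatD1 k) (hu.meas_flux k) (hv.meas_flux k) ((hc t ht).2.2 k)
    (hu.bound_flux hM k) (hv.bound_flux hM k) x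
  simp only [fluxOp, ← e, Finset.sum_sub_distrib]
  ring

theorem aestronglyMeasurable_stressOp (h : Admissible M u θ) :
    AEStronglyMeasurable (fun p : ℝ × E3 => stressOp (stress u) p.1 p.2) spaceTime :=
  aestronglyMeasurable_toLp fun j => (Finset.aestronglyMeasurable_fun_sum _ fun k _ =>
    Finset.aestronglyMeasurable_fun_sum _ fun l _ => aestronglyMeasurable_duhamel
      (measurable_oseenGrad k j l) (h.meas_stress k l) measurable_fst measurable_snd).neg

theorem aestronglyMeasurable_buoyancyOp (h : Admissible M u θ) :
    AEStronglyMeasurable (fun p : ℝ × E3 => buoyancyOp (flux u θ) p.1 p.2) spaceTime :=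
  aestronglyMeasurable_toLp fun j => (Finset.aestronglyMeasurable_fun_sum _ fun k _ =>
    aestronglyMeasurable_duhamel
      (measurable_mul_oseenGrad k j 2) (h.meas_flux k) measurable_fst measurable_snd).neg

theorem aestronglyMeasurable_fluxOp (h : Admissible M u θ) :
    AEStronglyMeasurable (fun p : ℝ × E3 => fluxOp (flux u θ) p.1 p.2) spaceTime :=
  (Finset.aestronglyMeasurable_fun_sum _ fun k _ => aestronglyMeasurable_duhamel
      (measurable_heatD1 k) (h.meas_flux k) measurable_fst measurable_snd).neg

theorem boundedSolenoidal_stressOp (hM : 0 ≤ M) (h : Admissible M u θ) {t : ℝ} (ht : 0 < t) :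
    BoundedSolenoidal (stressOp (stress u) t) := by
  obtain ⟨c, hc0, hc⟩ := kernel_bounds
  have e : stressOp (stress u) t = fun x => (-1 : ℝ) • ∑ k, ∑ l,
      (WithLp.toLp 2 fun j => duhamel (oseenGrad k j l) (stress u k l) t x : E3) := by
    ext x j
    simp [stressOp]
  rw [e]
  refine (BoundedSolenoidal.sum _ fun k _ => BoundedSolenoidal.sum _ fun l _ => ?_).smul (-1)
  exact boundedSolenoidal_duhamel ht (by norm_num) hc0.le (mul_nonneg hM hM)
    (fun j => measurable_oseenGrad k j l) (h.meas_stress k l) (fun j => (hc t ht).1 k j l)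
    (h.bound_stress hM k l) fun φ hφ hφc τ hτ y => integral_sum_pd_mul_oseenGrad hφ hφc k l hτ y

theorem boundedSolenoidal_buoyancyOp (hM : 0 ≤ M) (h : Admissible M u θ) {t : ℝ} (ht : 0 < t) :
    BoundedSolenoidal (buoyancyOp (flux u θ) t) := by
  obtain ⟨c, hc0, hc⟩ := kernel_bounds
  have e : buoyancyOp (flux u θ) t = fun x => (-1 : ℝ) • ∑ k,
      (WithLp.toLp 2 fun j => duhamel (fun τ z => τ * oseenGrad k j 2 τ z) (flux u θ k) t x :
        E3) := by
    ext x j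
    simp [buoyancyOp]
  rw [e]
  refine (BoundedSolenoidal.sum _ fun k _ => ?_).smul (-1)
  refine boundedSolenoidal_duhamel ht le_rfl (by positivity) (mul_nonneg hM hM)
    (fun j => measurable_mul_oseenGrad k j 2) (h.meas_flux k) (fun j => (hc t ht).2.1 k j 2)
    (h.bound_flux hM k) fun φ hφ hφc τ hτ y => ?_
  have := integral_sum_pd_mul_oseenGrad hφ hφc k 2 hτ y
  simp only [mul_left_comm _ τ, ← Finset.mul_sum]
  rw [integral_const_mul, this, mul_zero]

end Terms

/-! ### Norms of `𝓧` and `𝓨` -/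

theorem ofReal_mul_enorm {E : Type*} [SeminormedAddCommGroup E] {a : ℝ} (ha : 0 ≤ a) (v : E) :
    ENNReal.ofReal a * ‖v‖ₑ = ENNReal.ofReal (a * ‖v‖) := by
  rw [ENNReal.ofReal_mul ha, ofReal_norm]

theorem normX_le_iff {u : ℝ → E3 → E3} {M : ℝ} (hM : 0 ≤ M) :
    normX u ≤ ENNReal.ofReal M ↔ ∀ t, 0 < t → ∀ x, ‖u t x‖ ≤ M * (√t + ‖x‖)⁻¹ := by
  simp only [normX, iSup_le_iff]
  refine forall_congr' fun t => forall_congr' fun ht => forall_congr' fun x => ?_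
  have hR : 0 < √t + ‖x‖ := by
    have := Real.sqrt_pos.2 ht
    positivity
  rw [ofReal_mul_enorm hR.le, ENNReal.ofReal_le_ofReal_iff hM, ← div_eq_mul_inv,
    le_div_iff₀' hR]

theorem normY_le_iff {θ : ℝ → E3 → ℝ} {M : ℝ} (hM : 0 ≤ M) :
    normY θ ≤ ENNReal.ofReal M ↔ DecayBound 3 θ M := by
  simp only [normY, iSup_le_iff, DecayBound]
  refine forall_congr' fun t => forall_congr' fun ht => forall_congr' fun x => ?_
  have hR : 0 < (√t + ‖x‖) ^ 3 := by
    have := Real.sqrt_pos.2 ht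
    positivity
  rw [ofReal_mul_enorm hR.le, ENNReal.ofReal_le_ofReal_iff hM, ← div_eq_mul_inv,
    le_div_iff₀' hR, Real.norm_eq_abs]

theorem norm_le_of_iSup_lt {u₀ : E3 → E3} {ε : ℝ} (hε : 0 ≤ ε)
    (h : (⨆ x : E3, ‖x‖ₑ * ‖u₀ x‖ₑ) < ENNReal.ofReal ε) (y : E3) (hy : y ≠ 0) :
    ‖u₀ y‖ ≤ ε * ‖y‖⁻¹ := by
  have h1 := (le_iSup (fun x : E3 => ‖x‖ₑ * ‖u₀ x‖ₑ) y).trans h.le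
  have hn : 0 < ‖y‖ := norm_pos_iff.2 hy
  rw [← ofReal_norm y, ofReal_mul_enorm hn.le, ENNReal.ofReal_le_ofReal_iff hε] at h1
  rwa [← div_eq_mul_inv, le_div_iff₀' hn]

theorem Admissible.of_mem {M : ℝ} (hM : 0 ≤ M) {u : ℝ → E3 → E3} {θ : ℝ → E3 → ℝ} (hu : MemX u)
    (hθ : MemY θ) (hun : normX u ≤ ENNReal.ofReal M) (hθn : normY θ ≤ ENNReal.ofReal M) :
    Admissible M u θ :=
  ⟨hu.1, hθ.1, (normX_le_iff hM).1 hun, (normY_le_iff hM).1 hθn⟩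

/-! ### The fixed point -/

/-- Velocity component of the map whose fixed points are the mild solutions. -/
def mildU (u₀ : E3 → E3) (θ₀ : RealTempered) (u : ℝ → E3 → E3) (θ : ℝ → E3 → ℝ) (t : ℝ)
    (x : E3) : E3 :=
  heatFlow u₀ t x + t • lerayHeatFlowDistr θ₀ t x + termB u t x + termE u θ t x

/-- Temperature component of the map whose fixed points are the mild solutions. -/
def mildT (θ₀ : RealTempered) (u : ℝ → E3 → E3) (θ : ℝ → E3 → ℝ) (t : ℝ) (x : E3) : ℝ :=
  heatFlowDistr θ₀ t x + termBt θ u t x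

/-- The free evolution has size at most `m`. -/
structure SmallData (m : ℝ) (u₀ : E3 → E3) (θ₀ : RealTempered) : Prop where
  meas : AEStronglyMeasurable u₀ volume
  heat : ∀ t, 0 < t → ∀ x, ‖heatFlow u₀ t x + t • lerayHeatFlowDistr θ₀ t x‖ ≤ m * (√t + ‖x‖)⁻¹
  temp : DecayBound 3 (heatFlowDistr θ₀) m

theorem ae_spaceTime_pos : ∀ᵐ p ∂spaceTime, 0 < p.1 := by
  filter_upwards [ae_restrict_mem (measurableSet_Ioi.prod MeasurableSet.univ)] with p hp
  exact hp.1

/-- `L` bounds the quadratic operators. -/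
def OperatorBound (L : ℝ) : Prop := ∀ t, 0 < t → ∀ (D : ℝ), 0 ≤ D →
    (∀ F : Fin 3 → Fin 3 → ℝ → E3 → ℝ, (∀ k l, DecayBound 2 (F k l) D) → ∀ x,
      ‖stressOp F t x‖ ≤ L * D * (√t + ‖x‖)⁻¹) ∧
    (∀ G : Fin 3 → ℝ → E3 → ℝ, (∀ k, DecayBound 4 (G k) D) → ∀ x,
      ‖buoyancyOp G t x‖ ≤ L * D * (√t + ‖x‖)⁻¹ ∧
      |fluxOp G t x| ≤ L * D * ((√t + ‖x‖) ^ 3)⁻¹)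

section

variable {L M m d : ℝ} {u₀ : E3 → E3} {θ₀ : RealTempered} {u v : ℝ → E3 → E3} {θ η : ℝ → E3 → ℝ}

/-! ### The mild map: self-map, contraction, uniqueness and existence. -/

theorem mildU_eq (hM : 0 ≤ M) (h : Admissible M u θ) {t : ℝ} (ht : 0 < t) (x : E3) :
    mildU u₀ θ₀ u θ t x = heatFlow u₀ t x + t • lerayHeatFlowDistr θ₀ t x +
      stressOp (stress u) t x + buoyancyOp (flux u θ) t x := by
  rw [mildU, termB_eq hM h ht, termE_eq hM h ht]

theorem mildT_eq (hM : 0 ≤ M) (h : Admissible M u θ) {t : ℝ} (ht : 0 < t) (x : E3) :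
    mildT θ₀ u θ t x = heatFlowDistr θ₀ t x + fluxOp (flux u θ) t x := by
  rw [mildT, termBt_eq hM h ht]

/-- The free part uses at most half of the radius and each quadratic term at most an eighth. -/
theorem admissible_mild (hL : OperatorBound L) (hM : 0 ≤ M) (hLM : L * M ≤ 1 / 8)
    (hm : m ≤ M / 2) (hd : SmallData m u₀ θ₀) (h : Admissible M u θ) :
    Admissible M (mildU u₀ θ₀ u θ) (mildT θ₀ u θ) := by
  have hLMM : L * (M * M) ≤ M / 8 := by
    rw [← mul_assoc]
    nlinarith
  refine ⟨?_, ?_, fun t ht x => ?_, fun t ht x => ?_⟩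
  -- The field `lerayExplicit` is measurable on all of space-time and agrees with
  -- `lerayHeatFlowDistr` for positive times, which suffices almost everywhere.
  · have hlin : AEStronglyMeasurable
        (fun p : ℝ × E3 => heatFlow u₀ p.1 p.2 + p.1 • lerayExplicit θ₀ p.1 p.2) spaceTime :=
      (aestronglyMeasurable_heatFlow hd.meas measurable_fst measurable_snd).add
        (measurable_fst.aestronglyMeasurable.smul
          (aestronglyMeasurable_lerayExplicit θ₀ measurable_fst measurable_snd))
    refine ((hlin.add (aestronglyMeasurable_stressOp h)).add
      (aestronglyMeasurable_buoyancyOp h)).congr ?_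
    filter_upwards [ae_spaceTime_pos] with p hp
    simp only [Function.uncurry, Pi.add_apply]
    rw [mildU_eq hM h hp, lerayHeatFlowDistr_eq θ₀ hp]
  · refine ((measurable_heatFlowDistr θ₀).aestronglyMeasurable.add
      (aestronglyMeasurable_fluxOp h)).congr ?_
    filter_upwards [ae_spaceTime_pos] with p hp
    simp only [Function.uncurry, Pi.add_apply]
    rw [mildT_eq hM h hp]
  · obtain ⟨hS, hB⟩ := hL t ht (M * M) (mul_nonneg hM hM)
    have h1 := hS _ (h.bound_stress hM) x
    have h2 := (hB _ (h.bound_flux hM) x).1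
    have h3 := hd.heat t ht x
    have hR : 0 ≤ (√t + ‖x‖)⁻¹ := by positivity
    rw [mildU_eq hM h ht]
    calc _ ≤ m * (√t + ‖x‖)⁻¹ + L * (M * M) * (√t + ‖x‖)⁻¹ + L * (M * M) * (√t + ‖x‖)⁻¹ :=
          (norm_add₃_le).trans (by gcongr)
      _ = (m + L * (M * M) + L * (M * M)) * (√t + ‖x‖)⁻¹ := by ring
      _ ≤ _ := by gcongr; linarith
  · obtain ⟨hS, hB⟩ := hL t ht (M * M) (mul_nonneg hM hM)
    have h2 := (hB _ (h.bound_flux hM) x).2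
    have h3 := hd.temp t ht x
    have hR : 0 ≤ ((√t + ‖x‖) ^ 3)⁻¹ := by positivity
    rw [mildT_eq hM h ht]
    calc _ ≤ m * ((√t + ‖x‖) ^ 3)⁻¹ + L * (M * M) * ((√t + ‖x‖) ^ 3)⁻¹ :=
          (abs_add_le _ _).trans (by gcongr)
      _ = (m + L * (M * M)) * ((√t + ‖x‖) ^ 3)⁻¹ := by ring
      _ ≤ _ := by gcongr; linarith

/-- The free parts cancel, and the products differ by at most $2Md$ in the source weights. Each
operator then contributes at most $d/4$, and the velocity has two of them. -/
theorem within_mild (hL : OperatorBound L) (hM : 0 ≤ M) (hLM : L * M ≤ 1 / 8) (hd : 0 ≤ d)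
    (hu : Admissible M u θ) (hv : Admissible M v η) (h : Within d u v θ η) :
    Within (d / 2) (mildU u₀ θ₀ u θ) (mildU u₀ θ₀ v η) (mildT θ₀ u θ) (mildT θ₀ v η) := by
  intro t ht x
  obtain ⟨hS, hB⟩ := hL t ht (2 * M * d) (by positivity)
  have h1 := hS _ (h.bound_stress hu hv) x
  obtain ⟨h2, h3⟩ := hB _ (h.bound_flux hu hv) x
  have hLd : L * (2 * M * d) ≤ d / 4 := by nlinarith
  have hR : 0 ≤ (√t + ‖x‖)⁻¹ := by positivity
  have hR3 : 0 ≤ ((√t + ‖x‖) ^ 3)⁻¹ := by positivity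
  constructor
  · rw [mildU_eq hM hu ht, mildU_eq hM hv ht]
    rw [← stressOp_sub hM hu hv ht] at h1
    rw [← buoyancyOp_sub hM hu hv ht] at h2
    have e : ∀ a b c b' c' : E3, a + b + c - (a + b' + c') = (b - b') + (c - c') := fun _ _ _ _ _ =>
      by abel
    rw [e]
    calc _ ≤ L * (2 * M * d) * (√t + ‖x‖)⁻¹ + L * (2 * M * d) * (√t + ‖x‖)⁻¹ :=
          (norm_add_le _ _).trans (add_le_add h1 h2)
      _ ≤ d / 4 * (√t + ‖x‖)⁻¹ + d / 4 * (√t + ‖x‖)⁻¹ := by gcongr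
      _ = _ := by ring
  · rw [mildT_eq hM hu ht, mildT_eq hM hv ht, add_sub_add_left_eq_sub, fluxOp_sub hM hu hv ht]
    refine h3.trans ?_
    gcongr
    linarith

theorem Within.of_admissible (hu : Admissible M u θ) (hv : Admissible M v η) :
    Within (2 * M) u v θ η := fun t ht x => by
  constructor
  · refine (norm_sub_le _ _).trans ?_
    linarith [hu.boundU t ht x, hv.boundU t ht x]
  · refine (abs_sub _ _).trans ?_
    linarith [hu.boundT t ht x, hv.boundT t ht x]

theorem isMildSolution_iff : IsMildSolution u₀ θ₀ u θ ↔ ∀ t, 0 < t → ∀ x,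
    u t x = mildU u₀ θ₀ u θ t x ∧ θ t x = mildT θ₀ u θ t x :=
  Iff.rfl

theorem tendsto_const_mul_half_pow (a b : ℝ) :
    Tendsto (fun n : ℕ => a * (1 / 2) ^ n * b) atTop (𝓝 0) := by
  have h := tendsto_pow_atTop_nhds_zero_of_lt_one (r := (1 / 2 : ℝ)) (by norm_num) (by norm_num)
  simpa using (h.const_mul a).mul_const b

/-- Two solutions in the ball are at distance at most $2M$, and each application of the map halves
this bound. Smallness of the data plays no role beyond membership in the ball. -/
theorem mild_unique (hL : OperatorBound L) (hM : 0 ≤ M) (hLM : L * M ≤ 1 / 8)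
    (hu : Admissible M u θ) (hv : Admissible M v η) (hsu : IsMildSolution u₀ θ₀ u θ)
    (hsv : IsMildSolution u₀ θ₀ v η) {t : ℝ} (ht : 0 < t) (x : E3) :
    u t x = v t x ∧ θ t x = η t x := by
  rw [isMildSolution_iff] at hsu hsv
  have hn : ∀ n : ℕ, Within (2 * M * (1 / 2) ^ n) u v θ η := by
    intro n
    induction n with
    | zero => simpa using Within.of_admissible hu hv
    | succ n ih =>
      intro t ht x
      have h := within_mild (u₀ := u₀) (θ₀ := θ₀) hL hM hLM (by positivity) hu hv ih t ht x
      rw [← (hsu t ht x).1, ← (hsv t ht x).1, ← (hsu t ht x).2, ← (hsv t ht x).2] at h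
      rw [pow_succ, ← mul_assoc, mul_one_div]
      exact h
  constructor
  · have := ge_of_tendsto' (tendsto_const_mul_half_pow (2 * M) (√t + ‖x‖)⁻¹)
      fun n => (hn n t ht x).1
    exact sub_eq_zero.1 (norm_le_zero_iff.1 this)
  · have := ge_of_tendsto' (tendsto_const_mul_half_pow (2 * M) ((√t + ‖x‖) ^ 3)⁻¹)
      fun n => (hn n t ht x).2
    exact sub_eq_zero.1 (abs_nonpos_iff.1 this)

/-- The Picard iterates. -/
def picard (u₀ : E3 → E3) (θ₀ : RealTempered) : ℕ → (ℝ → E3 → E3) × (ℝ → E3 → ℝ)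
  | 0 => (fun _ _ => 0, fun _ _ => 0)
  | n + 1 => (mildU u₀ θ₀ (picard u₀ θ₀ n).1 (picard u₀ θ₀ n).2,
      mildT θ₀ (picard u₀ θ₀ n).1 (picard u₀ θ₀ n).2)

theorem admissible_picard (hL : OperatorBound L) (hM : 0 ≤ M) (hLM : L * M ≤ 1 / 8)
    (hm : m ≤ M / 2) (hd : SmallData m u₀ θ₀) (n : ℕ) :
    Admissible M (picard u₀ θ₀ n).1 (picard u₀ θ₀ n).2 := by
  induction n with
  | zero =>
    refine ⟨aestronglyMeasurable_const, aestronglyMeasurable_const, fun t _ x => ?_,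
      fun t _ x => ?_⟩
    · simp only [picard, norm_zero]
      positivity
    · simp only [picard, abs_zero]
      positivity
  | succ n ih => exact admissible_mild hL hM hLM hm hd ih

theorem within_picard (hL : OperatorBound L) (hM : 0 ≤ M) (hLM : L * M ≤ 1 / 8)
    (hm : m ≤ M / 2) (hd : SmallData m u₀ θ₀) (n : ℕ) :
    Within (2 * M * (1 / 2) ^ n) (picard u₀ θ₀ n).1 (picard u₀ θ₀ (n + 1)).1
      (picard u₀ θ₀ n).2 (picard u₀ θ₀ (n + 1)).2 := by
  have ha := admissible_picard hL hM hLM hm hd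
  induction n with
  | zero => simpa using Within.of_admissible (ha 0) (ha 1)
  | succ n ih =>
    have h := within_mild (u₀ := u₀) (θ₀ := θ₀) hL hM hLM (by positivity) (ha n) (ha (n + 1)) ih
    rw [pow_succ, ← mul_assoc, mul_one_div]
    exact h

theorem exists_mild (hL : OperatorBound L) (hM : 0 ≤ M) (hLM : L * M ≤ 1 / 8)
    (hm : m ≤ M / 2) (hd : SmallData m u₀ θ₀) :
    ∃ u θ, Admissible M u θ ∧ IsMildSolution u₀ θ₀ u θ := by
  have ha := admissible_picard hL hM hLM hm hd
  have hw := within_picard hL hM hLM hm hd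
  have hdU : ∀ t, 0 < t → ∀ x n, dist ((picard u₀ θ₀ n).1 t x) ((picard u₀ θ₀ (n + 1)).1 t x)
      ≤ 2 * M * (√t + ‖x‖)⁻¹ * (1 / 2) ^ n := fun t ht x n => by
    rw [dist_eq_norm, mul_right_comm]
    exact (hw n t ht x).1
  have hdT : ∀ t, 0 < t → ∀ x n, dist ((picard u₀ θ₀ n).2 t x) ((picard u₀ θ₀ (n + 1)).2 t x)
      ≤ 2 * M * ((√t + ‖x‖) ^ 3)⁻¹ * (1 / 2) ^ n := fun t ht x n => by
    rw [Real.dist_eq, mul_right_comm]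
    exact (hw n t ht x).2
  -- The limit is taken pointwise, so completeness of the function spaces is not needed. For `t ≤ 0`
  -- the condition is vacuous.
  have hexU : ∀ t x, ∃ a, 0 < t → Tendsto (fun n => (picard u₀ θ₀ n).1 t x) atTop (𝓝 a) :=
    fun t x => by
      by_cases ht : 0 < t
      · obtain ⟨a, h⟩ := cauchySeq_tendsto_of_complete
          (cauchySeq_of_le_geometric _ _ (by norm_num) (hdU t ht x))
        exact ⟨a, fun _ => h⟩
      · exact ⟨0, fun h => absurd h ht⟩
  have hexT : ∀ t x, ∃ a, 0 < t → Tendsto (fun n => (picard u₀ θ₀ n).2 t x) atTop (𝓝 a) :=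
    fun t x => by
      by_cases ht : 0 < t
      · obtain ⟨a, h⟩ := cauchySeq_tendsto_of_complete
          (cauchySeq_of_le_geometric _ _ (by norm_num) (hdT t ht x))
        exact ⟨a, fun _ => h⟩
      · exact ⟨0, fun h => absurd h ht⟩
  choose u hu using hexU
  choose θ hθ using hexT
  have hadm : Admissible M u θ := by
    refine ⟨aestronglyMeasurable_of_tendsto_ae atTop (fun n => (ha n).measU) ?_,
      aestronglyMeasurable_of_tendsto_ae atTop (fun n => (ha n).measT) ?_, fun t ht x =>
      le_of_tendsto' (hu t x ht).norm fun n => (ha n).boundU t ht x, fun t ht x =>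
      le_of_tendsto' (hθ t x ht).abs fun n => (ha n).boundT t ht x⟩
    · filter_upwards [ae_spaceTime_pos] with p hp using hu p.1 p.2 hp
    · filter_upwards [ae_spaceTime_pos] with p hp using hθ p.1 p.2 hp
  -- The factor 4 is the sum of the geometric tail with first term $2M\,2^{-n}$.
  have hlim : ∀ n, Within (4 * M * (1 / 2) ^ n) (picard u₀ θ₀ n).1 u (picard u₀ θ₀ n).2 θ :=
    fun n t ht x => by
      constructor
      · have := dist_le_of_le_geometric_of_tendsto _ _ (by norm_num) (hdU t ht x) (hu t x ht) n
        rw [dist_eq_norm] at this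
        refine this.trans (le_of_eq ?_)
        ring
      · have := dist_le_of_le_geometric_of_tendsto _ _ (by norm_num) (hdT t ht x) (hθ t x ht) n
        rw [Real.dist_eq] at this
        refine this.trans (le_of_eq ?_)
        ring
  refine ⟨u, θ, hadm, isMildSolution_iff.2 fun t ht x => ?_⟩
  -- By contraction the shifted iterates also converge to the image of the limit, so uniqueness of
  -- limits gives the fixed-point equation.
  have hstep : ∀ n, Within (2 * M * (1 / 2) ^ n) (picard u₀ θ₀ (n + 1)).1 (mildU u₀ θ₀ u θ)
      (picard u₀ θ₀ (n + 1)).2 (mildT θ₀ u θ) := fun n => by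
    have h := within_mild (u₀ := u₀) (θ₀ := θ₀) hL hM hLM (by positivity) (ha n) hadm (hlim n)
    rw [show 2 * M * (1 / 2 : ℝ) ^ n = 4 * M * (1 / 2) ^ n / 2 by ring]
    exact h
  constructor
  · refine tendsto_nhds_unique ((tendsto_add_atTop_iff_nat 1).2 (hu t x ht)) ?_
    rw [tendsto_iff_norm_sub_tendsto_zero]
    exact squeeze_zero (fun _ => norm_nonneg _) (fun n => (hstep n t ht x).1)
      (tendsto_const_mul_half_pow _ _)
  · refine tendsto_nhds_unique ((tendsto_add_atTop_iff_nat 1).2 (hθ t x ht)) ?_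
    rw [tendsto_iff_norm_sub_tendsto_zero]
    exact squeeze_zero (fun _ => norm_nonneg _) (fun n => (hstep n t ht x).2)
      (tendsto_const_mul_half_pow _ _)

/-- At a fixed positive time each of the four summands is bounded and solenoidal. For the buoyancy
part of the free evolution, boundedness comes from the assumed $\mathcal X$-bound divided by $t$. -/
theorem isDivFree_of_isMildSolution {ε : ℝ} (hε : 0 ≤ ε) (hM : 0 ≤ M) (h : Admissible M u θ)
    (hs : IsMildSolution u₀ θ₀ u θ) (hm : AEStronglyMeasurable u₀ volume)
    (hb : ∀ y, y ≠ 0 → ‖u₀ y‖ ≤ ε * ‖y‖⁻¹) (hdiv : IsDivFree u₀)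
    (hθ : DecayBound 3 (heatFlowDistr θ₀) ε)
    (hl : ∀ t, 0 < t → ∀ x, ‖t • lerayHeatFlowDistr θ₀ t x‖ ≤ ε * (√t + ‖x‖)⁻¹) {t : ℝ}
    (ht : 0 < t) : IsDivFree (u t) := by
  have e : u t = fun x => heatFlow u₀ t x + t • lerayHeatFlowDistr θ₀ t x +
      stressOp (stress u) t x + buoyancyOp (flux u θ) t x :=
    funext fun x => ((hs t ht x).1).trans (mildU_eq hM h ht x)
  have hσ : 0 < √t := Real.sqrt_pos.2 ht
  have hl' : ∀ x, ‖lerayHeatFlowDistr θ₀ t x‖ ≤ t⁻¹ * (ε * (√t)⁻¹) := fun x => by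
    rw [← div_eq_inv_mul, le_div_iff₀' ht]
    have h1 := hl t ht x
    rw [norm_smul, Real.norm_of_nonneg ht.le] at h1
    refine h1.trans ?_
    gcongr
    linarith [norm_nonneg x]
  rw [e]
  exact ((((boundedSolenoidal_heatFlow hε hm hb hdiv ht).add
    ((boundedSolenoidal_lerayHeatFlowDistr hε ht hθ hl').smul t)).add
    (boundedSolenoidal_stressOp hM h ht)).add (boundedSolenoidal_buoyancyOp hM h ht)).2.2

end

end Boussinesq

end

/-! ### The main theorem: choice of the constants. -/

theorem theorem3p1 :
    ∃ ε₀ : ℝ, 0 < ε₀ ∧ ∃ C : ℝ, 0 < C ∧ ∀ ε : ℝ, 0 < ε → ε ≤ ε₀ →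
      ∀ (u₀ : Boussinesq.E3 → Boussinesq.E3) (θ₀ : Boussinesq.RealTempered),
        AEStronglyMeasurable u₀ volume →
        Boussinesq.IsDivFree u₀ →
        (⨆ x : Boussinesq.E3, ‖x‖ₑ * ‖u₀ x‖ₑ) < ENNReal.ofReal ε →
        Boussinesq.normX (fun t x => t • Boussinesq.lerayHeatFlowDistr θ₀ t x)
          < ENNReal.ofReal ε →
        Boussinesq.normY (Boussinesq.heatFlowDistr θ₀) < ENNReal.ofReal ε →
        ∃ (u : ℝ → Boussinesq.E3 → Boussinesq.E3) (θ : ℝ → Boussinesq.E3 → ℝ),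
          Boussinesq.MemX u ∧ Boussinesq.MemY θ ∧
          Boussinesq.IsMildSolution u₀ θ₀ u θ ∧
          Boussinesq.normX u ≤ ENNReal.ofReal (C * ε) ∧
          Boussinesq.normY θ ≤ ENNReal.ofReal (C * ε) ∧
          (∀ t : ℝ, 0 < t → Boussinesq.IsDivFree (u t)) ∧
          ∀ (v : ℝ → Boussinesq.E3 → Boussinesq.E3) (η : ℝ → Boussinesq.E3 → ℝ),
            Boussinesq.MemX v → Boussinesq.MemY η →
            Boussinesq.IsMildSolution u₀ θ₀ v η →
            Boussinesq.normX v ≤ ENNReal.ofReal (C * ε) →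
            Boussinesq.normY η ≤ ENNReal.ofReal (C * ε) →
            ∀ t : ℝ, 0 < t → ∀ x : Boussinesq.E3, v t x = u t x ∧ η t x = θ t x := by
  obtain ⟨L, hL0, hL⟩ := Boussinesq.operator_bounds
  obtain ⟨H, hH0, hH⟩ := Boussinesq.heatFlow_bound
  -- The free velocity has size at most $(H+1)\epsilon$: `H` from the heat flow of `u₀` and 1 from
  -- the buoyancy part. The radius $M=2(H+1)\epsilon$ is twice this, and $\epsilon_0$ is chosen so
  -- that $LM\le1/8$. The same radius serves existence and uniqueness.
  refine ⟨1 / (16 * L * (H + 1)), by positivity, 2 * (H + 1), by positivity,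
    fun ε hε hεle u₀ θ₀ hm hdiv hu₀ hler hθ => ?_⟩
  have hM : 0 ≤ 2 * (H + 1) * ε := by positivity
  have hLM : L * (2 * (H + 1) * ε) ≤ 1 / 8 := by
    rw [le_div_iff₀ (by positivity)] at hεle
    linarith
  have hb := Boussinesq.norm_le_of_iSup_lt hε.le hu₀
  have hl := (Boussinesq.normX_le_iff hε.le).1 hler.le
  have ht := (Boussinesq.normY_le_iff hε.le).1 hθ.le
  have hd : Boussinesq.SmallData ((H + 1) * ε) u₀ θ₀ := by
    refine ⟨hm, fun t ht x => ?_, fun t h0 x => (ht t h0 x).trans ?_⟩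
    · refine (norm_add_le _ _).trans ((add_le_add ((norm_integral_le_integral_norm _).trans
        (hH u₀ ε hε.le hm hb t ht x).2) (hl t ht x)).trans (le_of_eq ?_))
      ring
    · gcongr
      nlinarith
  obtain ⟨u, θ, hadm, hsol⟩ := Boussinesq.exists_mild hL hM hLM (by linarith) hd
  have hX := (Boussinesq.normX_le_iff hM).2 hadm.boundU
  have hY := (Boussinesq.normY_le_iff hM).2 hadm.boundT
  refine ⟨u, θ, ⟨hadm.measU, hX.trans_lt ENNReal.ofReal_lt_top⟩,
    ⟨hadm.measT, hY.trans_lt ENNReal.ofReal_lt_top⟩, hsol, hX, hY, fun t h0 =>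
    Boussinesq.isDivFree_of_isMildSolution hε.le hM hadm hsol hm hb hdiv ht hl h0,
    fun v η hv hη hsv hvn hηn t h0 x => ?_⟩
  exact Boussinesq.mild_unique hL hM hLM (Boussinesq.Admissible.of_mem hM hv hη hvn hηn) hadm hsv
    hsol h0 x
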